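/- **Setting.** Let $E$ be a separable real Banach space, $H$ a separable real Hilbert space with $H\subset E$ densely and continuously (so that $E'\subset H'=H\subset E$), $\mu$ a finite positive Borel measure on $E$, and $T>0$. Let $A(z)$, $z\in E$, be symmetric nonnegative bounded operators on $H$ depending measurably on $z$, with nonnegative square roots $A^{1/2}(z)$, and let $b:E\to H$ be Borel measurable. Let $\mathcal FC_b^\infty$ be the set of functions $g(l_1,\dots,l_m)$ with $m\in\mathbb N$, $l_i\in E'$, $g\in C_b^\infty(\mathbb R^m)$, let $\nabla$ denote the $H$-gradient, and write $(\cdot,\cdot)$, $\|\cdot\|_2$ for the inner product and the norm of $L^2(\mu)$. For a set $W$ of functions let $bW$ be the set of its bounded elements. Assume: (A1) $\langle A(\cdot)k,k\rangle_H\in L^1(\mu)$ for all $k\in H$, and $\mathcal E^A(u,v)=\int\langle A\nabla u,\nabla v\rangle_H\,d\mu$, $u,v\in\mathcal FC_b^\infty$, is closable on $L^2(\mu)$. Let $F$ be the domain of its closure $\mathcal E^A$, and for $u\in F$ let $D_{A^{1/2}}u\in L^2(\mu;H)$ be the limit of $A^{1/2}\nabla v_n$ for any sequence $v_n\in\mathcal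 FC_b^\infty$ with $v_n\to u$ in $L^2(\mu)$ and with $A^{1/2}\nabla v_n$ convergent in $L^2(\mu;H)$, so that $\mathcal E^A(u,v)=\int\langle D_{A^{1/2}}u,D_{A^{1/2}}v\rangle_H\,d\mu$ on $F$. Set $\mathcal E^A_1(u)=\mathcal E^A(u,u)+\|u\|_2^2$. (A2) $A^{1/2}b\in L^2(\mu;H)$, and there is $\alpha\ge0$ with $\int\langle Ab,\nabla u^2\rangle_H\,d\mu\ge-\alpha\|u\|_2^2$ for all $u\in\mathcal FC_b^\infty$ with $u\ge0$. For $u\in F$, $v\in bF$ set $\mathcal E(u,v)=\mathcal E^A(u,v)+\int\langle A^{1/2}b,D_{A^{1/2}}u\rangle_H\,v\,d\mu$. (A3) $(P_t)_{t\ge0}$ is a positivity preserving $C_0$-semigroup on $L^2(\mu)$ such that, for some $C_T>0$, $\|P_tg\|_\infty\le C_T\|g\|_\infty$ for all $t\in[0,T]$ and all $g$. Its generator $(L,\mathcal D(L))$ satisfies $b\mathcal D(L)\subset bF$ and $\mathcal E(u,v)=-(Lu,v)$ for $u,v\in b\mathcal D(L)$, and for each $u\in bF$ there are uniformly bounded $u_n\in\mathcal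 D(L)$ with $\mathcal E^A_1(u_n-u)\to0$. Let $b\mathcal C_T$ be the set of bounded functions $\psi\in C^1([0,T];L^2(\mu))\cap L^2(0,T;F)$. For $\phi\in L^2(\mu)$ and $f\in L^1([0,T];L^2(\mu))$, a weak solution of $(\partial_t+L)u+f=0$ on $[0,T]$, $u_T=\phi$, is a function $u\in C([0,T];L^2(\mu))\cap L^2(0,T;F)$ such that for all $\psi\in b\mathcal C_T$ $$\int_0^T\Big((u_t,\partial_t\psi_t)+\mathcal E^A(u_t,\psi_t)+\int\langle A^{1/2}b,D_{A^{1/2}}u_t\rangle_H\,\psi_t\,d\mu\Big)dt=\int_0^T(f_t,\psi_t)\,dt+(\phi,\psi_T)-(u_0,\psi_0).$$ **Proposition 2.8.** Let $\phi=(\phi^1,\dots,\phi^l)$, $f=(f^1,\dots,f^l)$ with $\phi^i\in L^2(\mu)$, $f^i\in L^1([0,T];L^2(\mu))$, and let $u=(u^1,\dots,u^l)$, where each $u^i$ is a weak solution with data $(\phi^i,f^i)$. For every $t\in[0,T]$, $P_t$ extends (uniquely) to a bounded operator on $L^1(\mu)$, again denoted by $P_t$. For every $t\in[0,T]$ the integrals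 below exist, as Bochner integrals in $L^1(\mu)$ for the identity and in $L^2(\mu)$ for the inequality, and $\mu$-a.e. $$|u_t|^2+2\int_t^TP_{s-t}\big(|D_{A^{1/2}}u_s|_H^2\big)\,ds=P_{T-t}|\phi|^2+2\int_t^TP_{s-t}\langle u_s,f_s\rangle\,ds,$$ $$|u_t|\le P_{T-t}|\phi|+\int_t^TP_{s-t}\langle\hat u_s,f_s\rangle\,ds.$$ Here $|\cdot|$ and $\langle\cdot,\cdot\rangle$ are the Euclidean norm and inner product of $\mathbb R^l$, $|D_{A^{1/2}}u_s|_H^2=\sum_{i=1}^l|D_{A^{1/2}}u^i_s|_H^2$, and $\hat x=x/|x|$ for $x\ne0$, $\hat 0=0$. -/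

import Mathlib

open MeasureTheory Set Filter Topology
open scoped ENNReal ContDiff

noncomputable section

namespace LinearEq

section Calculus

variable {E H : Type*} [NormedAddCommGroup E] [NormedSpace ℝ E]
  [NormedAddCommGroup H] [InnerProductSpace ℝ H] [CompleteSpace H]

/-- The positive square root of a positive bounded operator: the unique positive `S` with
`S ∘ S = B`. It exists for every positive `B`; the value `0` is only used for other `B`. -/
def posSqrt (B : H →L[ℝ] H) : H →L[ℝ] H :=
  open Classical in
  if h : ∃ S : H →L[ℝ] H, S.IsPositive ∧ S ∘L S = B then h.choose else 0

/-- Finitely based smooth functions `z ↦ g (l₁ z, …, l_m z)`, where `g` is smooth and bounded with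
bounded derivatives of all orders and the `lᵢ` are continuous linear functionals on `E`. -/
def IsCyl (v : E → ℝ) : Prop :=
  ∃ (m : ℕ) (g : (Fin m → ℝ) → ℝ) (l : Fin m → (E →L[ℝ] ℝ)),
    ContDiff ℝ ∞ g ∧ (∀ k : ℕ, ∃ C : ℝ, ∀ x, ‖iteratedFDeriv ℝ k g x‖ ≤ C) ∧
      v = fun z => g (fun i => l i z)

/-- The `H`-gradient: `⟪hGrad ι v z, k⟫_H` is the derivative of `v` at `z` in the direction `k ∈ H`,
where `H` is embedded into `E` by `ι`. -/
def hGrad (ι : H →L[ℝ] E) (v : E → ℝ) (z : E) : H :=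
  gradient (fun h : H => v (z + ι h)) 0

variable [MeasurableSpace E]

/-- The form `E^A(v, w) = ∫ ⟪A ∇v, ∇w⟫ dμ` on finitely based smooth functions. -/
def preForm (ι : H →L[ℝ] E) (μ : Measure E) (A : E → H →L[ℝ] H) (v w : E → ℝ) : ℝ :=
  ∫ z, inner ℝ (A z (hGrad ι v z)) (hGrad ι w z) ∂μ

/-- Integrability of the diffusion coefficient and closability of `E^A` on `L²(μ)`. -/
structure CondA1 (ι : H →L[ℝ] E) (μ : Measure E) (A : E → H →L[ℝ] H) : Prop where
  integrable : ∀ k : H, Integrable (fun z => inner ℝ (A z k) k) μ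
  closable : ∀ v : ℕ → E → ℝ, (∀ n, IsCyl (v n)) →
    Tendsto (fun n => eLpNorm (v n) 2 μ) atTop (𝓝 0) →
    (∀ ε > 0, ∃ N, ∀ m ≥ N, ∀ n ≥ N, preForm ι μ A (v m - v n) (v m - v n) < ε) →
    Tendsto (fun n => preForm ι μ A (v n) (v n)) atTop (𝓝 0)

/-- Square integrability of `A^{1/2} b`, and the lower bound on the divergence of `A b`. -/
structure CondA2 (ι : H →L[ℝ] E) (μ : Measure E) (A : E → H →L[ℝ] H) (b : E → H) : Prop where
  memLp : MemLp (fun z => posSqrt (A z) (b z)) 2 μ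
  lower : ∃ α : ℝ, 0 ≤ α ∧ ∀ v : E → ℝ, IsCyl v → (∀ z, 0 ≤ v z) →
    -α * ∫ z, v z ^ 2 ∂μ ≤ ∫ z, inner ℝ (A z (b z)) (hGrad ι (fun y => v y ^ 2) z) ∂μ

/-- `w` is a limit in `L²(μ; H)` of `A^{1/2} ∇vₙ`, where `vₙ` are finitely based smooth functions
converging to `u` in `L²(μ)`. -/
def IsSqrtGrad (ι : H →L[ℝ] E) (μ : Measure E) (A : E → H →L[ℝ] H)
    (u : Lp ℝ 2 μ) (w : Lp H 2 μ) : Prop :=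
  ∃ v : ℕ → E → ℝ, (∀ n, IsCyl (v n)) ∧
    Tendsto (fun n => eLpNorm (fun z => v n z - u z) 2 μ) atTop (𝓝 0) ∧
    Tendsto (fun n => eLpNorm (fun z => posSqrt (A z) (hGrad ι (v n) z) - w z) 2 μ) atTop (𝓝 0)

/-- The domain `F` of the closure of `E^A`. As `E^A(v) = ‖A^{1/2} ∇v‖²` on finitely based smooth
functions, an `E^A`-Cauchy sequence is one whose `A^{1/2} ∇vₙ` converge in `L²(μ; H)`. -/
def MemF (ι : H →L[ℝ] E) (μ : Measure E) (A : E → H →L[ℝ] H) (u : Lp ℝ 2 μ) : Prop :=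
  ∃ w : Lp H 2 μ, IsSqrtGrad ι μ A u w

/-- `D_{A^{1/2}} u` for `u ∈ F`; it is unique because `E^A` is closable. -/
def D (ι : H →L[ℝ] E) (μ : Measure E) (A : E → H →L[ℝ] H) (u : Lp ℝ 2 μ) : Lp H 2 μ :=
  open Classical in if h : MemF ι μ A u then h.choose else 0

/-- The closed form `E^A(u, v) = ∫ ⟪D_{A^{1/2}} u, D_{A^{1/2}} v⟫ dμ` for `u, v ∈ F`. -/
def formA (ι : H →L[ℝ] E) (μ : Measure E) (A : E → H →L[ℝ] H) (u v : Lp ℝ 2 μ) : ℝ :=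
  ∫ z, inner ℝ (D ι μ A u z) (D ι μ A v z) ∂μ

/-- The drift part `∫ ⟪A^{1/2} b, D_{A^{1/2}} u⟫ v dμ`, for `u ∈ F` and `v ∈ F` bounded. -/
def driftForm (ι : H →L[ℝ] E) (μ : Measure E) (A : E → H →L[ℝ] H) (b : E → H)
    (u v : Lp ℝ 2 μ) : ℝ :=
  ∫ z, inner ℝ (posSqrt (A z) (b z)) (D ι μ A u z) * v z ∂μ

/-- The bilinear form `E(u, v)` for `u ∈ F` and `v ∈ F` bounded. -/
def form (ι : H →L[ℝ] E) (μ : Measure E) (A : E → H →L[ℝ] H) (b : E → H)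
    (u v : Lp ℝ 2 μ) : ℝ :=
  formA ι μ A u v + driftForm ι μ A b u v

/-- `|u| ≤ K` almost everywhere. -/
def BddBy {μ : Measure E} (K : ℝ) (u : Lp ℝ 2 μ) : Prop := ∀ᵐ z ∂μ, |u z| ≤ K

/-- `u` belongs to the domain of the generator of `P`, and the generator maps it to `g`. -/
def IsGen {μ : Measure E} (P : ℝ → Lp ℝ 2 μ →L[ℝ] Lp ℝ 2 μ) (u g : Lp ℝ 2 μ) : Prop :=
  Tendsto (fun t : ℝ => t⁻¹ • (P t u - u)) (𝓝[>] 0) (𝓝 g)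

/-- `P` (of which only the values at times `t ≥ 0` matter) is a positivity preserving
`C₀`-semigroup on `L²(μ)`, bounded in the sup norm on `[0, T]`, whose generator is associated with
the form `E`. -/
structure CondA3 (ι : H →L[ℝ] E) (μ : Measure E) (A : E → H →L[ℝ] H) (b : E → H) (T : ℝ)
    (P : ℝ → Lp ℝ 2 μ →L[ℝ] Lp ℝ 2 μ) : Prop where
  zero : P 0 = ContinuousLinearMap.id ℝ _
  add : ∀ s t : ℝ, 0 ≤ s → 0 ≤ t → P (s + t) = P s ∘L P t
  strongCont : ∀ u, Tendsto (fun t => P t u) (𝓝[>] 0) (𝓝 u)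
  pos : ∀ t : ℝ, 0 ≤ t → ∀ u, 0 ≤ u → 0 ≤ P t u
  bdd : ∃ C : ℝ, 0 < C ∧ ∀ t ∈ Icc (0 : ℝ) T, ∀ u : Lp ℝ 2 μ,
    eLpNorm (P t u) ⊤ μ ≤ ENNReal.ofReal C * eLpNorm u ⊤ μ
  dom_le : ∀ (u g : Lp ℝ 2 μ) (K : ℝ), IsGen P u g → BddBy K u → MemF ι μ A u
  dense : ∀ (u : Lp ℝ 2 μ) (K : ℝ), MemF ι μ A u → BddBy K u →
    ∃ (v : ℕ → Lp ℝ 2 μ) (C : ℝ), (∀ n, BddBy C (v n) ∧ ∃ g, IsGen P (v n) g) ∧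
      Tendsto (fun n => formA ι μ A (v n - u) (v n - u) + ‖v n - u‖ ^ 2) atTop (𝓝 0)
  assoc : ∀ (u v g h : Lp ℝ 2 μ) (K K' : ℝ), IsGen P u g → BddBy K u → IsGen P v h → BddBy K' v →
    form ι μ A b u v = -inner ℝ g v

/-- The requirement that `u` lies in `L²(0, T; F)`. -/
structure MemL2F (ι : H →L[ℝ] E) (μ : Measure E) (A : E → H →L[ℝ] H) (T : ℝ)
    (u : ℝ → Lp ℝ 2 μ) : Prop where
  mem_ae : ∀ᵐ t ∂volume.restrict (Icc (0 : ℝ) T), MemF ι μ A (u t)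
  memLp : MemLp (fun t => D ι μ A (u t)) 2 (volume.restrict (Icc (0 : ℝ) T))

/-- Bounded test functions: `φ` is `C¹` on `[0, T]` with values in `L²(μ)` and derivative `φ'`, it
lies in `L²(0, T; F)`, and it is bounded on `[0, T] × E`. -/
structure IsTest (ι : H →L[ℝ] E) (μ : Measure E) (A : E → H →L[ℝ] H) (T : ℝ)
    (φ φ' : ℝ → Lp ℝ 2 μ) : Prop where
  hasDeriv : ∀ t ∈ Icc (0 : ℝ) T, HasDerivWithinAt φ (φ' t) (Icc 0 T) t
  derivCont : ContinuousOn φ' (Icc 0 T)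
  memL2F : MemL2F ι μ A T φ
  bdd : ∃ K : ℝ, ∀ t ∈ Icc (0 : ℝ) T, BddBy K (φ t)

/-- `u` is a weak solution of `(∂ₜ + L) u + f = 0` on `[0, T]`, `u_T = φ`: it belongs to
`C([0, T]; L²) ∩ L²(0, T; F)` and satisfies the integrated relation against every bounded test
function. -/
structure IsWeakSol (ι : H →L[ℝ] E) (μ : Measure E) (A : E → H →L[ℝ] H) (b : E → H) (T : ℝ)
    (φ : Lp ℝ 2 μ) (f : ℝ → Lp ℝ 2 μ) (u : ℝ → Lp ℝ 2 μ) : Prop where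
  cont : ContinuousOn u (Icc 0 T)
  memL2F : MemL2F ι μ A T u
  weak : ∀ ψ ψ' : ℝ → Lp ℝ 2 μ, IsTest ι μ A T ψ ψ' →
    ∫ t in (0 : ℝ)..T, (inner ℝ (u t) (ψ' t) + formA ι μ A (u t) (ψ t)
        + driftForm ι μ A b (u t) (ψ t))
      = (∫ t in (0 : ℝ)..T, inner ℝ (f t) (ψ t)) + inner ℝ φ (ψ T) - inner ℝ (u 0) (ψ 0)

end Calculus

section Pointwise

variable {E : Type*} [MeasurableSpace E] {μ : Measure E}

/-- The inclusion of `L²(μ)` into `L¹(μ)` for a finite measure. -/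
def toL1 [IsFiniteMeasure μ] (u : Lp ℝ 2 μ) : Lp ℝ 1 μ :=
  (MemLp.mono_exponent (p := 1) (Lp.memLp u) (by norm_num)).toLp u

/-- `Q` extends `S` from `L²(μ)` to `L¹(μ)`. -/
def IsL1Ext [IsFiniteMeasure μ] (S : Lp ℝ 2 μ →L[ℝ] Lp ℝ 2 μ) (Q : Lp ℝ 1 μ →L[ℝ] Lp ℝ 1 μ) :
    Prop :=
  ∀ u : Lp ℝ 2 μ, Q (toL1 u) = toL1 (S u)

/-- The continuous extension of `S` to `L¹(μ)`, if there is one; it is unique because `L²(μ)` is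
dense in `L¹(μ)`. -/
def l1Ext [IsFiniteMeasure μ] (S : Lp ℝ 2 μ →L[ℝ] Lp ℝ 2 μ) : Lp ℝ 1 μ →L[ℝ] Lp ℝ 1 μ :=
  open Classical in if h : ∃ Q, IsL1Ext S Q then h.choose else 0

/-- The function `x ↦ ⟪v x, w x⟫` as an element of `L¹(μ)`. -/
def innerL1 {G : Type*} [NormedAddCommGroup G] [InnerProductSpace ℝ G] (v w : Lp G 2 μ) :
    Lp ℝ 1 μ :=
  (memLp_one_iff_integrable.2 (L2.integrable_inner (𝕜 := ℝ) v w)).toLp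
    (fun x => inner ℝ (v x) (w x))

/-- The function `x ↦ ∑ᵢ ⟪vᵢ x, wᵢ x⟫` as an element of `L¹(μ)`. -/
def sumInnerL1 {G : Type*} [NormedAddCommGroup G] [InnerProductSpace ℝ G] {l : ℕ}
    (v w : Fin l → Lp G 2 μ) : Lp ℝ 1 μ :=
  ∑ i, innerL1 (v i) (w i)

theorem aestronglyMeasurable_euclNorm {l : ℕ} (v : Fin l → Lp ℝ 2 μ) :
    AEStronglyMeasurable (fun x => √(∑ i, v i x ^ 2)) μ := by
  have h : AEStronglyMeasurable (fun x => ∑ i, v i x ^ 2) μ :=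
    Finset.aestronglyMeasurable_fun_sum _ fun i _ => (Lp.aestronglyMeasurable (v i)).pow 2
  exact Real.continuous_sqrt.comp_aestronglyMeasurable h

theorem memLp_sum_abs {l : ℕ} (v : Fin l → Lp ℝ 2 μ) :
    MemLp (fun x => ∑ i, |v i x|) 2 μ :=
  memLp_finsetSum _ fun i _ => (Lp.memLp (v i)).abs

theorem memLp_euclNorm {l : ℕ} (v : Fin l → Lp ℝ 2 μ) :
    MemLp (fun x => √(∑ i, v i x ^ 2)) 2 μ := by
  refine (memLp_sum_abs v).mono (aestronglyMeasurable_euclNorm v) (.of_forall fun x => ?_)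
  have h0 : 0 ≤ ∑ i, |v i x| := Finset.sum_nonneg fun i _ => abs_nonneg _
  rw [Real.norm_of_nonneg (Real.sqrt_nonneg _), Real.norm_of_nonneg h0, Real.sqrt_le_left h0]
  simpa using Finset.sum_sq_le_sq_sum_of_nonneg (s := Finset.univ) (f := fun i => |v i x|)
    fun i _ => abs_nonneg _

/-- The Euclidean norm `x ↦ |(v₁ x, …, v_l x)|` as an element of `L²(μ)`. -/
def euclNorm {l : ℕ} (v : Fin l → Lp ℝ 2 μ) : Lp ℝ 2 μ :=
  (memLp_euclNorm v).toLp (fun x => √(∑ i, v i x ^ 2))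

theorem memLp_hatInner {l : ℕ} (v w : Fin l → Lp ℝ 2 μ) :
    MemLp (fun x => ∑ i, v i x / √(∑ j, v j x ^ 2) * w i x) 2 μ := by
  refine (memLp_sum_abs w).mono ?_ (.of_forall fun x => ?_)
  · refine Finset.aestronglyMeasurable_fun_sum _ fun i _ => ?_
    exact ((Lp.aestronglyMeasurable (v i)).aemeasurable.div
      (aestronglyMeasurable_euclNorm v).aemeasurable).aestronglyMeasurable.mul
      (Lp.aestronglyMeasurable (w i))
  · rw [Real.norm_of_nonneg (Finset.sum_nonneg fun i _ => abs_nonneg (w i x))]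
    refine (norm_sum_le _ _).trans (Finset.sum_le_sum fun i _ => ?_)
    rw [Real.norm_eq_abs, abs_mul]
    refine mul_le_of_le_one_left (abs_nonneg _) ?_
    rw [abs_div, abs_of_nonneg (Real.sqrt_nonneg _)]
    refine div_le_one_of_le₀ ?_ (Real.sqrt_nonneg _)
    exact Real.abs_le_sqrt (Finset.single_le_sum (f := fun j => v j x ^ 2)
      (fun j _ => sq_nonneg _) (Finset.mem_univ i))

/-- The function `x ↦ ⟪v̂ x, w x⟫` as an element of `L²(μ)`, where `ŷ = y / |y|` for `y ≠ 0` and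
`ŷ = 0` for `y = 0` (division by zero gives zero). -/
def hatInner {l : ℕ} (v w : Fin l → Lp ℝ 2 μ) : Lp ℝ 2 μ :=
  (memLp_hatInner v w).toLp (fun x => ∑ i, v i x / √(∑ j, v j x ^ 2) * w i x)

end Pointwise

end LinearEq

end

/-! Formally both claims are instances of one chain rule. For smooth Φ on ℝ^l with bounded first and
second derivatives, (∂ₜ + L)Φ(u) = -∑ Φᵢ(u) fⁱ + ∑ Φᵢⱼ(u) ⟨Duⁱ, Duʲ⟩, so differentiating s ↦ P_{s-t}
Φ(u_s) and integrating over [t, T] gives a Duhamel formula (`IsSol.chain_rule`). Letting Φ increase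
to |x|² gives the identity (`IsSol.energy_identity`). Taking Φ = √(|x|² + c), which is convex, makes
the second order term nonnegative; positivity of P allows it to be dropped, and c → 0 gives the
inequality (`IsSol.comparison`).

Two things must be justified. The first is that Φ(u) lies in the domain of a generator. Products of
gradients are only integrable, so the generator has to be that of P on L¹(μ). Testing with the
smoothed sign of h and using (A2) shows that the form is accretive in L¹ up to α: the symmetric part
has a sign because the smoothed sign is nondecreasing, and the drift costs at most α times an
approximation of ‖h‖₁. Applied to orbits, this bounds P_t on L¹ by e^{αt}
(`IsAssociated.norm_toL1_le_of_gen`), hence the extension. Applied to the resolvent equation it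
gives uniqueness of weak solutions in the form domain (`IsLowerBound.norm_toL1_le`), so an element w
of the form domain with E(w, v) = ∫ g v for bounded v and g ∈ L¹ must coincide with the function
that the L¹ resolvent produces: w lies in the domain of the L¹ generator, with image -g
(`IsAssociated.hasGen_of_weak`). That Φ(u) solves such a weak equation comes from testing the
equation of uⁱ with Φᵢ(u)v (`bform_mulN`).

The second is differentiability in time. A weak solution is only continuous with values in L², so u
is replaced by its Steklov averages over [s, s + ε]. These are differentiable, and averaging the
equation in time turns it at each s into a stationary weak equation whose right-hand side contains
the time derivative of the average (`IsSol.bform_steklov`). That derivative cancels in the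
derivative of P_{s-t} Φ(u_ε), and ε → 0 is taken using mean convergence in time of order 2 for the
gradients and of order 1 for f. The composition Φ(u) is differentiable as a map from L² to L¹,
because the Taylor remainder is quadratic. -/

set_option linter.unusedSectionVars false
noncomputable section
namespace LinearEq

/-! ### Square roots of positive operators. -/

section SquareRoot

variable {H : Type*} [NormedAddCommGroup H] [InnerProductSpace ℝ H]

/-- The scalar majorant of the iteration for `1 - √(1 - r)`. -/
def majorant : ℕ → ℝ
  | 0 => 0
  | n + 1 => (1 + majorant n ^ 2) / 2

theorem majorant_mem (n : ℕ) : 0 ≤ majorant n ∧ majorant n ≤ 1 := by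
  induction n with
  | zero => simp [majorant]
  | succ n ih => constructor <;> simp only [majorant] <;> nlinarith [ih.1, ih.2]

theorem majorant_le_succ (n : ℕ) : majorant n ≤ majorant (n + 1) := by
  simp only [majorant]
  nlinarith [sq_nonneg (majorant n - 1)]

/-- The iteration `Y ↦ (R + Y²) / 2`, which converges to `1 - √(1 - R)` when `‖R‖ ≤ 1`. -/
def rootIter {B : Type*} [Ring B] [Module ℝ B] (R : B) : ℕ → B
  | 0 => 0
  | n + 1 => (2⁻¹ : ℝ) • (R + rootIter R n * rootIter R n)

theorem rootIter_commute {B : Type*} [Ring B] [Algebra ℝ B] {R X : B} (h : Commute X R) (n : ℕ) :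
    Commute X (rootIter R n) := by
  induction n with
  | zero => simp [rootIter]
  | succ n ih => exact (h.add_right (ih.mul_right ih)).smul_right _

theorem norm_rootIter_le {B : Type*} [NormedRing B] [NormedAlgebra ℝ B] {R : B} (hR : ‖R‖ ≤ 1)
    (n : ℕ) : ‖rootIter R n‖ ≤ majorant n := by
  induction n with
  | zero => simp [rootIter, majorant]
  | succ n ih =>
    simp only [rootIter, majorant]
    rw [norm_smul, Real.norm_of_nonneg (by norm_num)]
    have h1 : ‖R + rootIter R n * rootIter R n‖ ≤ 1 + majorant n ^ 2 := by
      refine (norm_add_le _ _).trans (add_le_add hR ((norm_mul_le _ _).trans ?_))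
      nlinarith [norm_nonneg (rootIter R n), (majorant_mem n).1]
    linarith

/-- All iterates are polynomials in R and so commute. Hence Yₙ₊₁² - Yₙ² factors as a sum times a
difference, exactly as for the scalar iteration, and the domination passes from one increment to the
next. -/
theorem norm_rootIter_sub_le {B : Type*} [NormedRing B] [NormedAlgebra ℝ B] {R : B}
    (hR : ‖R‖ ≤ 1) (n : ℕ) :
    ‖rootIter R (n + 1) - rootIter R n‖ ≤ majorant (n + 1) - majorant n := by
  induction n with
  | zero =>
    simp only [rootIter, majorant, mul_zero, add_zero, sub_zero]
    rw [norm_smul, Real.norm_of_nonneg (by norm_num)]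
    linarith
  | succ n ih =>
    have hc : Commute (rootIter R n) (rootIter R (n + 1)) :=
      (rootIter_commute (rootIter_commute (Commute.refl R) n).symm (n + 1))
    have h1 : rootIter R (n + 1 + 1) - rootIter R (n + 1) =
        (2⁻¹ : ℝ) • ((rootIter R (n + 1) + rootIter R n) *
          (rootIter R (n + 1) - rootIter R n)) := by
      rw [← hc.symm.mul_self_sub_mul_self_eq]
      change (2⁻¹ : ℝ) • (R + rootIter R (n + 1) * rootIter R (n + 1)) -
        (2⁻¹ : ℝ) • (R + rootIter R n * rootIter R n) = _
      rw [← smul_sub]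
      congr 1
      abel
    have h2 : majorant (n + 1 + 1) - majorant (n + 1) =
        2⁻¹ * ((majorant (n + 1) + majorant n) * (majorant (n + 1) - majorant n)) := by
      change (1 + majorant (n + 1) ^ 2) / 2 - (1 + majorant n ^ 2) / 2 = _
      ring
    rw [h1, h2, norm_smul, Real.norm_of_nonneg (by norm_num)]
    refine mul_le_mul_of_nonneg_left ?_ (by norm_num)
    refine (norm_mul_le _ _).trans (mul_le_mul ?_ ih (norm_nonneg _) ?_)
    · exact (norm_add_le _ _).trans (add_le_add (norm_rootIter_le hR _) (norm_rootIter_le hR _))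
    · exact add_nonneg (majorant_mem _).1 (majorant_mem _).1

theorem summable_majorant : Summable fun n => majorant (n + 1) - majorant n := by
  refine summable_of_sum_range_le (c := 1) (fun n => sub_nonneg.2 (majorant_le_succ n))
    fun n => ?_
  rw [Finset.sum_range_sub]
  simpa [majorant] using (majorant_mem n).2

theorem exists_tendsto_rootIter {B : Type*} [NormedRing B] [NormedAlgebra ℝ B] [CompleteSpace B]
    {R : B} (hR : ‖R‖ ≤ 1) : ∃ Y : B, Tendsto (rootIter R) atTop (𝓝 Y) := by
  have h : CauchySeq (rootIter R) :=
    cauchySeq_of_dist_le_of_summable _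
      (fun n => by rw [dist_comm, dist_eq_norm]; exact norm_rootIter_sub_le hR n)
      summable_majorant
  exact cauchySeq_tendsto_of_complete h

/-- Positivity of B tested on x - c⁻¹Bx gives 0 ≤ ⟨Bx, x⟩ - 2c⁻¹‖Bx‖² + c⁻²⟨B²x, Bx⟩, and the last
term is at most c⁻¹‖Bx‖². -/
theorem norm_sq_apply_le {B : H →L[ℝ] H} (hB : B.IsPositive) {c : ℝ} (hc : 0 < c)
    (hBc : ‖B‖ ≤ c) (x : H) : ‖B x‖ ^ 2 ≤ c * inner ℝ (B x) x := by
  have h0 := hB.inner_nonneg_left (x - c⁻¹ • B x)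
  have h1 : inner ℝ (B (B x)) x = ‖B x‖ ^ 2 := by
    rw [hB.inner_left_eq_inner_right, real_inner_self_eq_norm_sq]
  have h2 : inner ℝ (B (B x)) (B x) ≤ c * ‖B x‖ ^ 2 := by
    refine (real_inner_le_norm _ _).trans ?_
    have := (B.le_opNorm (B x)).trans (mul_le_mul_of_nonneg_right hBc (norm_nonneg _))
    nlinarith [norm_nonneg (B x)]
  simp only [map_sub, map_smul, inner_sub_left, inner_sub_right, real_inner_smul_left,
    real_inner_smul_right, h1, real_inner_self_eq_norm_sq] at h0
  have h3 : c⁻¹ * (c⁻¹ * inner ℝ (B (B x)) (B x)) ≤ c⁻¹ * ‖B x‖ ^ 2 := by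
    refine mul_le_mul_of_nonneg_left ?_ (by positivity)
    rw [inv_mul_le_iff₀ hc]
    exact h2
  have h4 : c⁻¹ * ‖B x‖ ^ 2 ≤ inner ℝ (B x) x := by linarith
  rwa [inv_mul_le_iff₀ hc] at h4

theorem norm_one_sub_smul_le {B : H →L[ℝ] H} (hB : B.IsPositive) {c : ℝ} (hc : 0 < c)
    (hBc : ‖B‖ ≤ c) : ‖(1 : H →L[ℝ] H) - c⁻¹ • B‖ ≤ 1 := by
  refine ContinuousLinearMap.opNorm_le_bound _ zero_le_one fun x => ?_
  have h1 := norm_sq_apply_le hB hc hBc x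
  have h2 := hB.inner_nonneg_left x
  have h3 : ‖x - c⁻¹ • B x‖ ^ 2 ≤ ‖x‖ ^ 2 := by
    rw [norm_sub_sq_real, real_inner_smul_right, norm_smul, mul_pow, real_inner_comm,
      Real.norm_of_nonneg (by positivity)]
    have h4 : c⁻¹ ^ 2 * ‖B x‖ ^ 2 ≤ c⁻¹ * inner ℝ (B x) x := by
      rw [sq, mul_assoc]
      refine mul_le_mul_of_nonneg_left ?_ (by positivity)
      rwa [inv_mul_le_iff₀ hc]
    have h5 : 0 ≤ c⁻¹ * inner ℝ (B x) x := by positivity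
    linarith
  rw [one_mul]
  exact (sq_le_sq₀ (norm_nonneg _) (norm_nonneg _)).1 (by simpa using h3)

variable [CompleteSpace H]

theorem isSelfAdjoint_rootIter {R : H →L[ℝ] H} (hR : IsSelfAdjoint R) (n : ℕ) :
    IsSelfAdjoint (rootIter R n) := by
  induction n with
  | zero => simp [rootIter]
  | succ n ih =>
    refine IsSelfAdjoint.smul (by simp) (hR.add ?_)
    rw [← pow_two]
    exact ih.pow 2

/-- The positive square root, obtained as the limit of the iteration. -/
theorem exists_isPositive_sqrt {B : H →L[ℝ] H} (hB : B.IsPositive) {c : ℝ} (hc : 0 < c)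
    (hBc : ‖B‖ ≤ c) : ∃ S : H →L[ℝ] H, S.IsPositive ∧ S ∘L S = B ∧
      (∀ X : H →L[ℝ] H, Commute X B → Commute X S) ∧
      Tendsto (fun n => √c • (1 - rootIter ((1 : H →L[ℝ] H) - c⁻¹ • B) n)) atTop (𝓝 S) := by
  set R : H →L[ℝ] H := 1 - c⁻¹ • B with hR
  have hR1 : ‖R‖ ≤ 1 := norm_one_sub_smul_le hB hc hBc
  have hRs : IsSelfAdjoint R := by
    refine (IsSelfAdjoint.one _).sub (IsSelfAdjoint.smul (IsSelfAdjoint.all _) hB.isSelfAdjoint)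
  obtain ⟨Y, hY⟩ := exists_tendsto_rootIter hR1
  have hYs : IsSelfAdjoint Y := by
    have h1 := (continuous_star.tendsto Y).comp hY
    refine tendsto_nhds_unique (h1.congr fun n => ?_) hY
    exact isSelfAdjoint_rootIter hRs n
  have hY1 : ‖Y‖ ≤ 1 :=
    le_of_tendsto hY.norm (.of_forall fun n => (norm_rootIter_le hR1 n).trans (majorant_mem n).2)
  have hYeq : Y = (2⁻¹ : ℝ) • (R + Y * Y) :=
    tendsto_nhds_unique ((tendsto_add_atTop_iff_nat 1).2 hY)
      (((tendsto_const_nhds (x := R)).add (hY.mul hY)).const_smul (2⁻¹ : ℝ))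
  -- The fixed point equation 2Y = R + Y² says that (1 - Y)² = 1 - R.
  have hsq : (1 - Y) * (1 - Y) = c⁻¹ • B := by
    have h1 : (2 : ℝ) • Y = R + Y * Y := by
      conv_lhs => rw [hYeq]
      rw [smul_smul]; norm_num
    have h2 : Y + Y = R + Y * Y := by rw [← h1, two_smul]
    have h3 : (1 - Y) * (1 - Y) = 1 - (Y + Y) + Y * Y := by noncomm_ring
    rw [h3, h2, hR]
    abel
  refine ⟨√c • (1 - Y), ?_, ?_, ?_, ((tendsto_const_nhds (x := 1)).sub hY).const_smul _⟩
  · refine ContinuousLinearMap.IsPositive.smul_of_nonneg ?_ (Real.sqrt_nonneg c)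
    rw [ContinuousLinearMap.isPositive_def']
    refine ⟨(IsSelfAdjoint.one _).sub hYs, fun x => ?_⟩
    simp only [ContinuousLinearMap.reApplyInnerSelf_apply, RCLike.re_to_real]
    have h1 : inner ℝ (Y x) x ≤ ‖x‖ * ‖x‖ := (real_inner_le_norm _ _).trans
      (mul_le_mul_of_nonneg_right (by simpa using Y.le_of_opNorm_le hY1 x) (norm_nonneg _))
    change 0 ≤ inner ℝ (x - Y x) x
    rw [inner_sub_left, real_inner_self_eq_norm_mul_norm]
    linarith
  · change (√c • (1 - Y)) * (√c • (1 - Y)) = B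
    rw [smul_mul_smul_comm, hsq, Real.mul_self_sqrt hc.le, smul_smul, mul_inv_cancel₀ hc.ne',
      one_smul]
  · intro X hX
    have hXR : Commute X R := (Commute.one_right X).sub_right (hX.smul_right _)
    have hXY : Commute X Y :=
      tendsto_nhds_unique (hY.const_mul X)
        ((hY.mul_const X).congr fun n => (rootIter_commute hXR n).eq.symm)
    exact ((Commute.one_right X).sub_right hXY).smul_right _

omit [CompleteSpace H] in
-- S' commutes with its square B, hence with S, so (S' + S)(S' - S) = 0. For y = (S' - S)x this
-- gives ⟨S'y, y⟩ + ⟨Sy, y⟩ = 0; both terms are nonnegative, so S'y = Sy = 0 and ‖y‖² = ⟨x, (S' -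
-- S)y⟩ = 0.
theorem isPositive_sqrt_unique {B S S' : H →L[ℝ] H} (hS : S.IsPositive) (hSB : S ∘L S = B)
    (hcomm : ∀ X : H →L[ℝ] H, Commute X B → Commute X S) (hS' : S'.IsPositive)
    (hSB' : S' ∘L S' = B) : S' = S := by
  have h1 : S' * S = S * S' := hcomm S' (by rw [← hSB']; exact (Commute.refl S').mul_right (Commute.refl S'))
  have hSB2 : S * S = B := hSB
  have hSB2' : S' * S' = B := hSB'
  ext x
  set y := S' x - S x with hy
  have h2 : S' y + S y = 0 := by
    have e1 : S' (S' x) = S (S x) := by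
      have := congrArg (fun X : H →L[ℝ] H => X x) (hSB2'.trans hSB2.symm)
      simpa using this
    have e2 : S' (S x) = S (S' x) := by
      have := congrArg (fun X : H →L[ℝ] H => X x) h1
      simpa using this
    simp only [hy, map_sub, e1, e2]
    abel
  have h3 : inner ℝ (S' y) y + inner ℝ (S y) y = 0 := by rw [← inner_add_left, h2, inner_zero_left]
  have zero_of {V : H →L[ℝ] H} (hV : V.IsPositive) (h : inner ℝ (V y) y = 0) : V y = 0 := by
    have := norm_sq_apply_le hV (c := ‖V‖ + 1) (by positivity) (by linarith) y
    rw [h, mul_zero] at this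
    have h0 : ‖V y‖ = 0 := by nlinarith [norm_nonneg (V y)]
    exact norm_eq_zero.1 h0
  have p1 := hS.inner_nonneg_left y
  have p2 := hS'.inner_nonneg_left y
  have e1 : S' y = 0 := zero_of hS' (by linarith)
  have e2 : S y = 0 := zero_of hS (by linarith)
  have h4 : ‖y‖ ^ 2 = 0 := by
    rw [← real_inner_self_eq_norm_sq]
    conv_lhs => rw [hy, inner_sub_right]
    rw [real_inner_comm, real_inner_comm (S x) y, ]
    rw [hS'.inner_left_eq_inner_right, hS.inner_left_eq_inner_right, e1, e2]
    simp
  have : y = 0 := by simpa using h4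
  exact sub_eq_zero.1 this

theorem posSqrt_spec {B : H →L[ℝ] H} (hB : B.IsPositive) :
    (posSqrt B).IsPositive ∧ posSqrt B ∘L posSqrt B = B := by
  obtain ⟨S, h1, h2, -⟩ := exists_isPositive_sqrt hB (c := ‖B‖ + 1) (by positivity) (by linarith)
  have h : ∃ S : H →L[ℝ] H, S.IsPositive ∧ S ∘L S = B := ⟨S, h1, h2⟩
  rw [posSqrt, dif_pos h]
  exact h.choose_spec

/-- The root is defined by choice, which says nothing about how it depends on B. Being a limit of
explicit polynomials in B is what gives measurability for a field of operators. -/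
theorem tendsto_posSqrt {B : H →L[ℝ] H} (hB : B.IsPositive) {c : ℝ} (hc : 0 < c)
    (hBc : ‖B‖ ≤ c) :
    Tendsto (fun n => √c • (1 - rootIter ((1 : H →L[ℝ] H) - c⁻¹ • B) n)) atTop
      (𝓝 (posSqrt B)) := by
  obtain ⟨S, h1, h2, h3, h4⟩ := exists_isPositive_sqrt hB hc hBc
  rwa [isPositive_sqrt_unique h1 h2 h3 (posSqrt_spec hB).1 (posSqrt_spec hB).2]

theorem inner_posSqrt {B : H →L[ℝ] H} (hB : B.IsPositive) (x y : H) :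
    inner ℝ (posSqrt B x) (posSqrt B y) = inner ℝ (B x) y := by
  obtain ⟨h1, h2⟩ := posSqrt_spec hB
  have h3 : posSqrt B (posSqrt B x) = B x := congrArg (fun X : H →L[ℝ] H => X x) h2
  rw [← h3, ← h1.inner_left_eq_inner_right]

end SquareRoot

/-! ### Measurability of the square root of an operator field. -/

section Measurability

variable {E H : Type*} [MeasurableSpace E] [NormedAddCommGroup H] [InnerProductSpace ℝ H]
  [CompleteSpace H] [SecondCountableTopology H] [MeasurableSpace H] [BorelSpace H]

/-- A bound ‖Ax‖ ≤ r‖x‖ is a closed condition on x, so countably many vectors of a dense sequence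
decide it. -/
theorem measurable_opNorm {A : E → H →L[ℝ] H} (hA : ∀ h : H, Measurable fun z => A z h) :
    Measurable fun z => ‖A z‖ := by
  refine measurable_of_Iic fun r => ?_
  rcases lt_or_ge r 0 with hr | hr
  · convert MeasurableSet.empty
    ext z
    simpa using hr.trans_le (norm_nonneg _)
  · have h1 : (fun z => ‖A z‖) ⁻¹' Iic r =
        ⋂ n : ℕ, {z | ‖A z (TopologicalSpace.denseSeq H n)‖ ≤
          r * ‖TopologicalSpace.denseSeq H n‖} := by
      ext z
      simp only [mem_preimage, mem_Iic, mem_iInter, mem_ofPred_eq]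
      rw [ContinuousLinearMap.opNorm_le_iff hr]
      refine ⟨fun h n => h _, fun h x => ?_⟩
      have hcl : IsClosed {x : H | ‖A z x‖ ≤ r * ‖x‖} :=
        isClosed_le (by fun_prop) (by fun_prop)
      exact (hcl.closure_subset_iff.2 (by rintro _ ⟨n, rfl⟩; exact h n))
        (TopologicalSpace.denseRange_denseSeq H x)
    rw [h1]
    exact MeasurableSet.iInter fun n => measurableSet_le (hA _).norm measurable_const

theorem measurable_apply {A : E → H →L[ℝ] H} (hA : ∀ h : H, Measurable fun z => A z h)
    {w : E → H} (hw : Measurable w) : Measurable fun z => A z (w z) := by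
  have h := measurable_uncurry_of_continuous_of_measurable (u := fun (h : H) (z : E) => A z h)
    (fun z => (A z).continuous) hA
  exact h.comp (hw.prodMk measurable_id)

theorem measurable_posSqrt {A : E → H →L[ℝ] H} (hA : ∀ h : H, Measurable fun z => A z h)
    (hpos : ∀ z, (A z).IsPositive) (k : H) : Measurable fun z => posSqrt (A z) k := by
  have hc : Measurable fun z => ‖A z‖ + 1 := (measurable_opNorm hA).add_const 1
  -- The vector must be allowed to vary with z: the square of an iterate acts on w as the iterate
  -- acting on its own, z-dependent, value.
  have hiter (n : ℕ) : ∀ w : E → H, Measurable w → Measurable fun z =>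
      rootIter ((1 : H →L[ℝ] H) - (‖A z‖ + 1)⁻¹ • A z) n (w z) := by
    induction n with
    | zero => intro w hw; simp [rootIter]
    | succ n ih =>
      intro w hw
      have h1 := ih _ (ih w hw)
      have h2 : Measurable fun z => w z - (‖A z‖ + 1)⁻¹ • A z (w z) :=
        hw.sub (hc.inv.smul (measurable_apply hA hw))
      exact (h2.add h1).const_smul (2⁻¹ : ℝ)
  refine measurable_of_tendsto_metrizable (f := fun n z => √(‖A z‖ + 1) • (k -
    rootIter ((1 : H →L[ℝ] H) - (‖A z‖ + 1)⁻¹ • A z) n k)) (fun n => ?_) ?_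
  · exact hc.sqrt.smul (measurable_const.sub (hiter n _ measurable_const))
  · rw [tendsto_pi_nhds]
    intro z
    have h1 := tendsto_posSqrt (hpos z) (c := ‖A z‖ + 1) (by positivity) (by linarith)
    exact ((ContinuousLinearMap.apply ℝ H k).continuous.tendsto _).comp h1

end Measurability

end LinearEq
end

noncomputable section
namespace LinearEq

/-! ### Strongly continuous semigroups and right derivatives of orbits. -/

section Semigroup

variable {X : Type*} [NormedAddCommGroup X] [NormedSpace ℝ X]

/-- A strongly continuous semigroup; only the values at times `t ≥ 0` matter. -/
structure IsC0 (S : ℝ → X →L[ℝ] X) : Prop where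
  zero : S 0 = ContinuousLinearMap.id ℝ X
  add : ∀ s t : ℝ, 0 ≤ s → 0 ≤ t → S (s + t) = S s ∘L S t
  cont_zero : ∀ x, Tendsto (fun t => S t x) (𝓝[>] 0) (𝓝 x)

/-- `g` is the right derivative at `0` of the orbit of `x`. -/
def HasGen (S : ℝ → X →L[ℝ] X) (x g : X) : Prop :=
  Tendsto (fun t : ℝ => t⁻¹ • (S t x - x)) (𝓝[>] 0) (𝓝 g)

namespace IsC0

variable {S : ℝ → X →L[ℝ] X}

theorem add_apply (hS : IsC0 S) {s t : ℝ} (hs : 0 ≤ s) (ht : 0 ≤ t) (x : X) :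
    S (s + t) x = S s (S t x) := by rw [hS.add s t hs ht]; rfl

theorem zero_apply (hS : IsC0 S) (x : X) : S 0 x = x := by rw [hS.zero]; rfl

theorem tendsto_zero_ge (hS : IsC0 S) (x : X) : Tendsto (fun t => S t x) (𝓝[≥] 0) (𝓝 x) := by
  have h := hS.cont_zero x
  have h2 : ContinuousWithinAt (fun t => S t x) (Ioi 0) 0 := by
    simpa [ContinuousWithinAt, hS.zero_apply] using h
  have h3 := continuousWithinAt_Ioi_iff_Ici.1 h2
  simpa [ContinuousWithinAt, hS.zero_apply] using h3

theorem hasGen_apply (hS : IsC0 S) {x g : X} (h : HasGen S x g) {t : ℝ} (ht : 0 ≤ t) :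
    HasGen S (S t x) (S t g) := by
  refine (((S t).continuous.tendsto g).comp h).congr' ?_
  filter_upwards [self_mem_nhdsWithin] with r hr
  have hr' : (0 : ℝ) ≤ r := le_of_lt hr
  simp only [Function.comp_apply, map_smul, map_sub]
  rw [← hS.add_apply ht hr', ← hS.add_apply hr' ht, add_comm]

variable [CompleteSpace X]

/-- Otherwise some sequence tₙ → 0 has ‖S tₙ‖ unbounded, although every orbit converges along it,
against the uniform boundedness principle. -/
theorem exists_bound_near_zero (hS : IsC0 S) : ∃ δ > 0, ∃ M : ℝ, 1 ≤ M ∧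
    ∀ t ∈ Icc (0 : ℝ) δ, ‖S t‖ ≤ M := by
  by_contra! hcon
  have h1 (n : ℕ) : ∃ t ∈ Icc (0 : ℝ) (1 / ((n : ℝ) + 1)), (n : ℝ) + 1 < ‖S t‖ :=
    hcon _ (by positivity) _ (by have : (0 : ℝ) ≤ n := n.cast_nonneg; linarith)
  choose t ht hbig using h1
  have ht0 : Tendsto t atTop (𝓝[≥] 0) := by
    refine tendsto_nhdsWithin_iff.2 ⟨?_, .of_forall fun n => (ht n).1⟩
    exact tendsto_of_tendsto_of_tendsto_of_le_of_le tendsto_const_nhds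
      tendsto_one_div_add_atTop_nhds_zero_nat (fun n => (ht n).1) fun n => (ht n).2
  obtain ⟨C, hC⟩ := banach_steinhaus (g := fun n => S (t n)) fun x => by
    have h2 := ((hS.tendsto_zero_ge x).comp ht0).norm.bddAbove_range
    obtain ⟨C, hC⟩ := h2
    exact ⟨C, fun n => hC ⟨n, rfl⟩⟩
  obtain ⟨n, hn⟩ := exists_nat_gt C
  linarith [hC n, hbig n]

theorem exists_bound (hS : IsC0 S) (R : ℝ) : ∃ M : ℝ, 0 ≤ M ∧ ∀ t ∈ Icc (0 : ℝ) R, ‖S t‖ ≤ M := by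
  obtain ⟨δ, hδ, M, hM, hb⟩ := hS.exists_bound_near_zero
  have h (n : ℕ) : ∀ t ∈ Icc (0 : ℝ) (n * δ), ‖S t‖ ≤ M ^ (n + 1) := by
    induction n with
    | zero =>
      intro t ht
      simp only [Nat.cast_zero, zero_mul] at ht
      simpa using hb t ⟨ht.1, ht.2.trans hδ.le⟩
    | succ n ih =>
      intro t ht
      push_cast at ht
      rcases le_or_gt t δ with h1 | h1
      · exact (hb t ⟨ht.1, h1⟩).trans (le_self_pow₀ hM (by omega))
      · have h2 : S t = S δ ∘L S (t - δ) := by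
          rw [← hS.add _ _ hδ.le (by linarith)]; congr 1; ring
        rw [h2, pow_succ' M (n + 1)]
        refine (ContinuousLinearMap.opNorm_comp_le _ _).trans ?_
        exact mul_le_mul (hb δ ⟨hδ.le, le_rfl⟩) (ih _ ⟨by linarith, by linarith [ht.2]⟩)
          (norm_nonneg _) (by linarith)
  obtain ⟨n, hn⟩ := exists_nat_gt (R / δ)
  refine ⟨M ^ (n + 1), by positivity, fun t ht => h n t ⟨ht.1, ht.2.trans ?_⟩⟩
  exact ((div_lt_iff₀ hδ).1 hn).le

omit [CompleteSpace X] in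
theorem norm_sub_le (hS : IsC0 S) {R M : ℝ} (hM : ∀ t ∈ Icc (0 : ℝ) R, ‖S t‖ ≤ M) (x : X)
    {s t : ℝ} (hs : s ∈ Icc (0 : ℝ) R) (ht : t ∈ Icc (0 : ℝ) R) :
    ‖S t x - S s x‖ ≤ M * ‖S |t - s| x - x‖ := by
  wlog hst : s ≤ t generalizing s t
  · rw [norm_sub_rev, abs_sub_comm]
    exact this ht hs (le_of_not_ge hst)
  have h1 : S t x = S s (S (t - s) x) := by
    rw [← hS.add_apply hs.1 (by linarith)]; congr 2; ring
  rw [h1, abs_of_nonneg (by linarith), ← map_sub]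
  exact (S s).le_of_opNorm_le (hM s hs) _

/-- The local norm bound controls the change of the vector uniformly in time, which leaves the
continuity of a single orbit. The cut at time 0 makes the map total, since nothing is known at
negative times. -/
theorem continuous_uncurry (hS : IsC0 S) :
    Continuous fun p : ℝ × X => S (max p.1 0) p.2 := by
  rw [continuous_iff_continuousAt]
  rintro ⟨t, x⟩
  obtain ⟨M, hM0, hM⟩ := hS.exists_bound (|t| + 1)
  have hloc : ∀ᶠ p : ℝ × X in 𝓝 (t, x), max p.1 0 ∈ Icc (0 : ℝ) (|t| + 1) := by
    have h1 : ∀ᶠ p : ℝ × X in 𝓝 (t, x), p.1 < |t| + 1 :=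
      continuous_fst.continuousAt.eventually_lt continuousAt_const (by simp; linarith [le_abs_self t])
    filter_upwards [h1] with p hp
    exact ⟨le_max_right _ _, max_le hp.le (by positivity)⟩
  have ht : max t 0 ∈ Icc (0 : ℝ) (|t| + 1) := hloc.self_of_nhds
  rw [ContinuousAt, tendsto_iff_norm_sub_tendsto_zero]
  have hlim : Tendsto (fun p : ℝ × X => M * ‖p.2 - x‖ + M * ‖S |max p.1 0 - max t 0| x - x‖)
      (𝓝 (t, x)) (𝓝 0) := by
    have h1 : Tendsto (fun p : ℝ × X => |max p.1 0 - max t 0|) (𝓝 (t, x)) (𝓝[≥] 0) := by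
      refine tendsto_nhdsWithin_iff.2 ⟨?_, .of_forall fun p => mem_Ici.2 (abs_nonneg _)⟩
      have : Continuous fun p : ℝ × X => |max p.1 0 - max t 0| := by fun_prop
      simpa using this.tendsto (t, x)
    have h2 := ((hS.tendsto_zero_ge x).comp h1).sub_const x |>.norm.const_mul M
    have h3 : Continuous fun p : ℝ × X => M * ‖p.2 - x‖ := by fun_prop
    simpa using (h3.tendsto (t, x)).add h2
  refine squeeze_zero' (.of_forall fun _ => norm_nonneg _) ?_ hlim
  filter_upwards [hloc] with p hp
  have h1 : S (max p.1 0) p.2 - S (max t 0) x =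
      S (max p.1 0) (p.2 - x) + (S (max p.1 0) x - S (max t 0) x) := by rw [map_sub]; abel
  rw [h1]
  exact (norm_add_le _ _).trans (add_le_add ((S _).le_of_opNorm_le (hM _ hp) _)
    (hS.norm_sub_le hM x ht hp))

theorem continuous_orbit (hS : IsC0 S) (x : X) : Continuous fun t : ℝ => S (max t 0) x :=
  hS.continuous_uncurry.comp (continuous_id.prodMk continuous_const)

theorem continuousOn_apply (hS : IsC0 S) {t : ℝ} {s : Set ℝ} (hs : ∀ r ∈ s, t ≤ r) {y : ℝ → X}
    (hy : ContinuousOn y s) : ContinuousOn (fun r => S (r - t) (y r)) s := by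
  have h : ContinuousOn (fun r => S (max (r - t) 0) (y r)) s :=
    hS.continuous_uncurry.comp_continuousOn
      (ContinuousOn.prodMk (by fun_prop) hy)
  exact h.congr fun r hr => by
    simp only [max_eq_left (sub_nonneg.2 (hs r hr))]

theorem intervalIntegrable_apply (hS : IsC0 S) {t T : ℝ} (ht : t ≤ T) {g : ℝ → X}
    (hg : IntervalIntegrable g volume t T) :
    IntervalIntegrable (fun s => S (s - t) (g s)) volume t T := by
  obtain ⟨M, hM0, hM⟩ := hS.exists_bound (T - t)
  rw [intervalIntegrable_iff_integrableOn_Ioc_of_le ht] at hg ⊢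
  have hmeas : AEStronglyMeasurable (fun s => S (s - t) (g s)) (volume.restrict (Ioc t T)) := by
    have h1 : AEStronglyMeasurable (fun s => S (max (s - t) 0) (g s))
        (volume.restrict (Ioc t T)) :=
      hS.continuous_uncurry.comp_aestronglyMeasurable
        (AEStronglyMeasurable.prodMk (by fun_prop) hg.1)
    refine h1.congr ?_
    filter_upwards [ae_restrict_mem measurableSet_Ioc] with s hs
    rw [max_eq_left (by linarith [hs.1])]
  refine (hg.norm.const_mul M).mono' hmeas ?_
  filter_upwards [ae_restrict_mem measurableSet_Ioc] with s hs
  exact (S _).le_of_opNorm_le (hM _ ⟨by linarith [hs.1], by linarith [hs.2]⟩) _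

theorem intervalIntegrable_orbit (hS : IsC0 S) (x : X) {a b : ℝ} (ha : 0 ≤ a) (hb : 0 ≤ b) :
    IntervalIntegrable (fun s => S s x) volume a b := by
  refine ((hS.continuous_orbit x).intervalIntegrable a b).congr fun s hs => ?_
  have hs' := uIoc_subset_uIcc hs
  have : 0 ≤ s := (le_min ha hb).trans hs'.1
  simp [max_eq_left this]

omit [CompleteSpace X] in
theorem norm_integral_apply_le {t T M : ℝ} (ht : t ≤ T)
    (hM : ∀ r ∈ Icc (0 : ℝ) (T - t), ‖S r‖ ≤ M) {g : ℝ → X}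
    (hg : IntervalIntegrable g volume t T) :
    ‖∫ s in t..T, S (s - t) (g s)‖ ≤ M * ∫ s in t..T, ‖g s‖ := by
  rw [← intervalIntegral.integral_const_mul]
  refine intervalIntegral.norm_integral_le_of_norm_le ht ?_ (hg.norm.const_mul M)
  refine .of_forall fun s hs => ?_
  exact (S _).le_of_opNorm_le (hM _ ⟨by linarith [hs.1], by linarith [hs.2]⟩) _

/-- The average of an orbit lies in the domain of the generator. -/
theorem hasGen_integral (hS : IsC0 S) (x : X) {τ : ℝ} (hτ : 0 ≤ τ) :
    HasGen S (∫ s in (0 : ℝ)..τ, S s x) (S τ x - x) := by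
  set c : ℝ → X := fun t => S (max t 0) x with hc
  have hcc : Continuous c := hS.continuous_orbit x
  have hder (a : ℝ) : Tendsto (fun t : ℝ => t⁻¹ • ∫ s in a..(a + t), c s) (𝓝[>] 0) (𝓝 (c a)) := by
    have h1 : HasDerivAt (fun r => ∫ s in a..r, c s) (c a) a :=
      intervalIntegral.integral_hasDerivAt_right (hcc.intervalIntegrable _ _)
        (hcc.stronglyMeasurableAtFilter _ _) hcc.continuousAt
    have h2 := hasDerivAt_iff_tendsto_slope_zero.1 h1
    simp only [intervalIntegral.integral_same, sub_zero] at h2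
    exact h2.mono_left (nhdsWithin_mono _ fun t ht => ne_of_gt ht)
  -- S_t moves the integral over [0, τ] to [t, t + τ]; the difference is the integral over [τ, τ +
  -- t] minus that over [0, t].
  have hlim := (hder τ).sub (hder 0)
  have h0 : c 0 = x := by simp [hc, hS.zero_apply]
  have h1 : c τ = S τ x := by simp [hc, max_eq_left hτ]
  rw [h0, h1] at hlim
  refine hlim.congr' ?_
  filter_upwards [self_mem_nhdsWithin] with t ht
  have ht' : (0 : ℝ) ≤ t := le_of_lt ht
  have e1 : ∫ s in (0 : ℝ)..τ, S s x = ∫ s in (0 : ℝ)..τ, c s := by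
    refine intervalIntegral.integral_congr fun s hs => ?_
    rw [uIcc_of_le hτ] at hs
    simp [hc, max_eq_left hs.1]
  have e2 : S t (∫ s in (0 : ℝ)..τ, S s x) = ∫ s in t..(t + τ), c s := by
    rw [e1, ← ContinuousLinearMap.intervalIntegral_comp_comm _ (hcc.intervalIntegrable _ _)]
    have : ∫ s in (0 : ℝ)..τ, S t (c s) = ∫ s in (0 : ℝ)..τ, c (t + s) := by
      refine intervalIntegral.integral_congr fun s hs => ?_
      rw [uIcc_of_le hτ] at hs
      simp only [hc]
      rw [max_eq_left hs.1, max_eq_left (add_nonneg ht' hs.1), hS.add_apply ht' hs.1]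
    rw [this, intervalIntegral.integral_comp_add_left]
    simp
  rw [e2, e1, ← smul_sub, zero_add]
  congr 1
  have i (a b : ℝ) := hcc.intervalIntegrable (μ := volume) a b
  rw [add_comm t τ]
  have a1 := intervalIntegral.integral_add_adjacent_intervals (i 0 t) (i t (τ + t))
  have a2 := intervalIntegral.integral_add_adjacent_intervals (i 0 τ) (i τ (τ + t))
  rw [← a2] at a1
  rw [sub_eq_sub_iff_add_eq_add, add_comm, ← a1]
  abel

/-- Rescaling a semigroup by an exponential. -/
theorem scale (hS : IsC0 S) (c : ℝ) : IsC0 fun t => Real.exp (-c * t) • S t where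
  zero := by simp [hS.zero]
  add s t hs ht := by
    rw [hS.add s t hs ht, mul_add, Real.exp_add]
    ext x
    simp [smul_smul, mul_comm]
  cont_zero x := by
    have h1 : Tendsto (fun t : ℝ => Real.exp (-c * t)) (𝓝[>] 0) (𝓝 1) := by
      have : Continuous fun t : ℝ => Real.exp (-c * t) := by fun_prop
      simpa using (this.tendsto 0).mono_left nhdsWithin_le_nhds
    simpa using h1.smul (hS.cont_zero x)

/-- The product rule for e^{ct} · (e^{-ct} S_t x); it undoes the shift made to obtain exponential
decay. -/
theorem hasGen_of_scale {c : ℝ} {x g : X}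
    (h : HasGen (fun t => Real.exp (-c * t) • S t) x g) : HasGen S x (g + c • x) := by
  have h1 : Tendsto (fun t : ℝ => Real.exp (c * t)) (𝓝[>] 0) (𝓝 1) := by
    have : Continuous fun t : ℝ => Real.exp (c * t) := by fun_prop
    simpa using (this.tendsto 0).mono_left nhdsWithin_le_nhds
  have h2 : Tendsto (fun t : ℝ => t⁻¹ * (Real.exp (c * t) - 1)) (𝓝[>] 0) (𝓝 c) := by
    have h3 : HasDerivAt (fun t : ℝ => Real.exp (c * t)) c 0 := by
      have := ((hasDerivAt_id (0 : ℝ)).const_mul c).exp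
      simpa using this
    have h4 := hasDerivAt_iff_tendsto_slope_zero.1 h3
    simp only [zero_add, mul_zero, Real.exp_zero, smul_eq_mul] at h4
    exact h4.mono_left (nhdsWithin_mono _ fun t ht => ne_of_gt ht)
  have h5 := (h1.smul h).add (h2.smul_const x)
  rw [one_smul] at h5
  refine h5.congr fun t => ?_
  have h6 : Real.exp (c * t) * Real.exp (-c * t) = 1 := by
    rw [← Real.exp_add]; simp
  have h7 : Real.exp (c * t) * (t⁻¹ * Real.exp (-c * t)) = t⁻¹ := by
    rw [mul_left_comm, h6, mul_one]
  simp only [_root_.smul_apply, smul_sub, smul_smul, sub_smul, mul_sub]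
  rw [h7, mul_comm (Real.exp (c * t)) t⁻¹]
  simp

/-- The increment from s to r is S(s-t) applied to S(r-s)(y r - y s) + (S(r-s) y s - y s). Joint
continuity handles the first term, so only y s itself has to lie in the domain of the generator. -/
theorem hasDerivWithinAt_apply (hS : IsC0 S) {t s : ℝ} (hts : t ≤ s) {y : ℝ → X} {y' g : X}
    (hy : HasDerivWithinAt y y' (Ioi s) s) (hg : HasGen S (y s) g) :
    HasDerivWithinAt (fun r => S (r - t) (y r)) (S (s - t) (y' + g)) (Ioi s) s := by
  rw [hasDerivWithinAt_iff_tendsto_slope' (by simp)] at hy ⊢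
  have hsub : Tendsto (fun r : ℝ => r - s) (𝓝[>] s) (𝓝[>] 0) := by
    refine tendsto_nhdsWithin_iff.2 ⟨?_, ?_⟩
    · have : Continuous fun r : ℝ => r - s := by fun_prop
      simpa using (this.tendsto s).mono_left nhdsWithin_le_nhds
    · filter_upwards [self_mem_nhdsWithin] with r hr
      exact mem_Ioi.2 (sub_pos.2 (mem_Ioi.1 hr))
  have h1 : Tendsto (fun r => S (max (r - s) 0) (slope y s r)) (𝓝[>] s) (𝓝 y') := by
    have := (hS.continuous_uncurry.tendsto (0, y')).comp
      ((hsub.mono_right nhdsWithin_le_nhds).prodMk_nhds hy)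
    simpa [hS.zero_apply, Function.comp_def] using this
  have h2 := ((S (s - t)).continuous.tendsto _).comp (h1.add (hg.comp hsub))
  refine h2.congr' ?_
  filter_upwards [self_mem_nhdsWithin] with r hr
  have hr' : 0 ≤ r - s := by linarith [mem_Ioi.1 hr]
  have e : r - t = (s - t) + (r - s) := by ring
  simp only [Function.comp_apply, slope_def_module, max_eq_left hr']
  rw [e, hS.add_apply (by linarith) hr', ← map_sub, ← map_smul]
  congr 1
  rw [map_smul, ← smul_add, map_sub]
  congr 1
  abel

theorem hasDerivWithinAt_orbit (hS : IsC0 S) {x g : X} (h : HasGen S x g) {t : ℝ} (ht : 0 ≤ t) :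
    HasDerivWithinAt (fun r => S r x) (S t g) (Ioi t) t := by
  have h1 := hS.hasDerivWithinAt_apply (t := t) le_rfl (s := t) (y := fun r => S t x) (y' := 0)
    (hasDerivWithinAt_const _ _ _) (hS.hasGen_apply h ht)
  rw [zero_add, sub_self, hS.zero_apply] at h1
  refine h1.congr_of_eventuallyEq ?_ ?_
  · filter_upwards [self_mem_nhdsWithin] with r hr
    rw [← hS.add_apply (by linarith [mem_Ioi.1 hr]) ht]
    congr 2; ring
  · rw [sub_self, hS.zero_apply]

end IsC0

end Semigroup

end LinearEq
end

noncomputable section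
namespace LinearEq

/-! ### Smooth functions of finitely many real variables. -/

section Coordinates

variable {κ : Type*} [Fintype κ]

open Classical in
/-- The partial derivative of `Φ` in the coordinate `i`. -/
def pd (Φ : (κ → ℝ) → ℝ) (i : κ) (x : κ → ℝ) : ℝ := fderiv ℝ Φ x (Pi.single i 1)

theorem fderiv_apply_eq_sum (Φ : (κ → ℝ) → ℝ) (x d : κ → ℝ) :
    fderiv ℝ Φ x d = ∑ i, pd Φ i x * d i := by
  classical
  conv_lhs => rw [pi_eq_sum_univ' d, map_sum]
  refine Finset.sum_congr rfl fun i _ => ?_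
  rw [map_smul, smul_eq_mul, mul_comm, pd]

theorem contDiff_pd {Φ : (κ → ℝ) → ℝ} (h : ContDiff ℝ ∞ Φ) (i : κ) : ContDiff ℝ ∞ (pd Φ i) := by
  classical
  exact (h.fderiv_right (m := ∞) (by simp)).clm_apply contDiff_const

/-- Lipschitz functions of the coordinates. -/
def LC (Φ : (κ → ℝ) → ℝ) : Prop :=
  ∃ C, 0 ≤ C ∧ ∀ x y, |Φ x - Φ y| ≤ C * ∑ i, |x i - y i|

/-- Bounded continuous functions of the coordinates. -/
structure BC (g : (κ → ℝ) → ℝ) : Prop where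
  cont : Continuous g
  bdd : ∃ C, 0 ≤ C ∧ ∀ x, |g x| ≤ C

/-- Smooth functions with bounded first derivatives. -/
structure Smooth1 (Φ : (κ → ℝ) → ℝ) : Prop where
  smooth : ContDiff ℝ ∞ Φ
  bdd : ∀ i, ∃ C, ∀ x, |pd Φ i x| ≤ C

/-- Smooth functions with bounded first and second derivatives. -/
structure Smooth2 (Φ : (κ → ℝ) → ℝ) : Prop extends Smooth1 Φ where
  bdd2 : ∀ i j, ∃ C, ∀ x, |pd (pd Φ i) j x| ≤ C

theorem LC.continuous {Φ : (κ → ℝ) → ℝ} (h : LC Φ) : Continuous Φ := by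
  obtain ⟨C, hC, h⟩ := h
  rw [continuous_iff_continuousAt]
  intro x
  rw [ContinuousAt, tendsto_iff_norm_sub_tendsto_zero]
  have h1 : Continuous fun y : κ → ℝ => C * ∑ i, |y i - x i| := by fun_prop
  refine squeeze_zero (fun _ => norm_nonneg _) (fun y => h y x) ?_
  simpa using h1.tendsto x

theorem Smooth1.bc_pd {Φ : (κ → ℝ) → ℝ} (h : Smooth1 Φ) (i : κ) : BC (pd Φ i) where
  cont := (contDiff_pd h.smooth i).continuous
  bdd := by
    obtain ⟨C, hC⟩ := h.bdd i
    exact ⟨|C|, abs_nonneg C, fun x => (hC x).trans (le_abs_self C)⟩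

theorem Smooth2.smooth1_pd {Φ : (κ → ℝ) → ℝ} (h : Smooth2 Φ) (i : κ) : Smooth1 (pd Φ i) :=
  ⟨contDiff_pd h.smooth i, h.bdd2 i⟩

theorem hasDerivAt_line {Φ : (κ → ℝ) → ℝ} (h : ContDiff ℝ ∞ Φ) (x d : κ → ℝ) (t : ℝ) :
    HasDerivAt (fun t : ℝ => Φ (x + t • d)) (∑ i, pd Φ i (x + t • d) * d i) t := by
  have h1 : HasFDerivAt Φ (fderiv ℝ Φ (x + t • d)) (x + t • d) :=
    (h.differentiable (by simp) _).hasFDerivAt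
  have h2 : HasDerivAt (fun t : ℝ => x + t • d) d t := by
    simpa using ((hasDerivAt_id t).smul_const d).const_add x
  rw [← fderiv_apply_eq_sum]
  exact h1.comp_hasDerivAt t h2

theorem Smooth1.lc {Φ : (κ → ℝ) → ℝ} (h : Smooth1 Φ) : LC Φ := by
  choose C hC using h.bdd
  refine ⟨∑ i, |C i|, Finset.sum_nonneg fun _ _ => abs_nonneg _, fun x y => ?_⟩
  have h1 := norm_image_sub_le_of_norm_deriv_le_segment_01'
    (f := fun t : ℝ => Φ (y + t • (x - y))) (C := (∑ i, |C i|) * ∑ i, |x i - y i|)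
    (fun t _ => (hasDerivAt_line h.smooth y (x - y) t).hasDerivWithinAt) fun t _ => ?_
  · simpa using h1
  · rw [Real.norm_eq_abs, Finset.sum_mul]
    refine (Finset.abs_sum_le_sum_abs _ _).trans (Finset.sum_le_sum fun i _ => ?_)
    rw [abs_mul]
    refine mul_le_mul ((hC i _).trans (le_abs_self _)) ?_ (abs_nonneg _) (abs_nonneg _)
    exact Finset.single_le_sum (f := fun i => |x i - y i|) (fun _ _ => abs_nonneg _)
      (Finset.mem_univ i)

/-- Along the segment from y to x, the linear term is subtracted and the mean value inequality
applied; the first partial derivatives are Lipschitz because the second ones are bounded. -/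
theorem Smooth2.taylor {Φ : (κ → ℝ) → ℝ} (h : Smooth2 Φ) : ∃ C, 0 ≤ C ∧ ∀ x y,
    |Φ x - Φ y - ∑ i, pd Φ i y * (x i - y i)| ≤ C * (∑ i, |x i - y i|) ^ 2 := by
  choose C hC0 hC using fun i => (h.smooth1_pd i).lc
  refine ⟨∑ i, C i, Finset.sum_nonneg fun i _ => hC0 i, fun x y => ?_⟩
  set d := x - y with hd
  have hder (t : ℝ) : HasDerivAt (fun t : ℝ => Φ (y + t • d) - t * ∑ i, pd Φ i y * d i)
      (∑ i, pd Φ i (y + t • d) * d i - ∑ i, pd Φ i y * d i) t := by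
    have h2 := (hasDerivAt_line h.smooth y d t).fun_sub
      ((hasDerivAt_id t).mul_const (∑ i, pd Φ i y * d i))
    simpa only [one_mul, id_eq] using h2
  have h1 := norm_image_sub_le_of_norm_deriv_le_segment_01'
    (C := (∑ i, C i) * (∑ i, |x i - y i|) ^ 2)
    (fun t _ => (hder t).hasDerivWithinAt) fun t ht => ?_
  · have e : y + d = x := by simp [hd]
    simp only [one_smul, one_mul, zero_smul, zero_mul, add_zero, sub_zero, e] at h1
    rw [Real.norm_eq_abs] at h1
    convert h1 using 2
    simp only [hd, Pi.sub_apply]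
    ring
  · rw [← Finset.sum_sub_distrib, Real.norm_eq_abs, Finset.sum_mul]
    refine (Finset.abs_sum_le_sum_abs _ _).trans (Finset.sum_le_sum fun i _ => ?_)
    have hs : 0 ≤ ∑ i, |x i - y i| := Finset.sum_nonneg fun _ _ => abs_nonneg _
    rw [← sub_mul, abs_mul, sq, ← mul_assoc]
    refine mul_le_mul ((hC i _ _).trans ?_) ?_ (abs_nonneg _) (mul_nonneg (hC0 i) hs)
    · refine mul_le_mul_of_nonneg_left (Finset.sum_le_sum fun j _ => ?_) (hC0 i)
      simp only [Pi.add_apply, Pi.smul_apply, add_sub_cancel_left, smul_eq_mul, abs_mul, hd,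
        Pi.sub_apply]
      exact mul_le_of_le_one_left (abs_nonneg _) (by rw [abs_of_nonneg ht.1]; exact ht.2.le)
    · exact Finset.single_le_sum (f := fun i => |x i - y i|) (fun _ _ => abs_nonneg _)
        (Finset.mem_univ i)

end Coordinates

/-! ### Dominated convergence in the norm of Lᵖ. -/

section Convergence

variable {Ω : Type*} [MeasurableSpace Ω] {μ : Measure Ω} {G : Type*} [NormedAddCommGroup G]

theorem tendsto_Lp_of_dominated {p : ℝ≥0∞} [hp1 : Fact (1 ≤ p)] (hp : p ≠ ⊤)
    {F : ℕ → Lp G p μ} {f : Lp G p μ} {b : Ω → ℝ} (hb : MemLp b p μ)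
    (hFb : ∀ n, ∀ᵐ z ∂μ, ‖F n z‖ ≤ b z)
    (hF : ∀ᵐ z ∂μ, Tendsto (fun n => F n z) atTop (𝓝 (f z))) :
    Tendsto F atTop (𝓝 f) := by
  have hp0 : p ≠ 0 := (zero_lt_one.trans_le hp1.1).ne'
  have hpr : 0 < p.toReal := ENNReal.toReal_pos hp0 hp
  rw [Lp.tendsto_Lp_iff_tendsto_eLpNorm']
  have hfb : ∀ᵐ z ∂μ, ‖f z‖ ≤ b z := by
    filter_upwards [ae_all_iff.2 hFb, hF] with z h1 h2
    exact le_of_tendsto h2.norm (.of_forall h1)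
  have key : Tendsto (fun n => ∫⁻ z, ‖F n z - f z‖ₑ ^ p.toReal ∂μ) atTop (𝓝 0) := by
    have h1 := tendsto_lintegral_of_dominated_convergence' (μ := μ)
      (F := fun n z => ‖F n z - f z‖ₑ ^ p.toReal) (f := fun _ => 0)
      (fun z => ‖2 * b z‖ₑ ^ p.toReal) (fun n => ?_) (fun n => ?_) ?_ ?_
    · simpa using h1
    · exact (((Lp.aestronglyMeasurable _).sub (Lp.aestronglyMeasurable _)).enorm).pow_const _
    · filter_upwards [hFb n, hfb] with z h1 h2
      refine ENNReal.rpow_le_rpow ?_ hpr.le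
      rw [enorm_le_iff_norm_le]
      refine (norm_sub_le _ _).trans ((add_le_add h1 h2).trans ?_)
      rw [Real.norm_eq_abs, two_mul]
      exact le_abs_self _
    · exact (lintegral_rpow_enorm_lt_top_of_eLpNorm_lt_top hp0 hp (hb.const_mul 2).2).ne
    · filter_upwards [hF] with z hz
      have h2 : Tendsto (fun n => ‖F n z - f z‖ₑ) atTop (𝓝 0) := by
        have := (tendsto_sub_nhds_zero_iff.2 hz).enorm
        simpa using this
      have h3 := (ENNReal.continuous_rpow_const (y := p.toReal)).tendsto 0 |>.comp h2
      simpa [ENNReal.zero_rpow_of_pos hpr, Function.comp_def] using h3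
  have h2 := (ENNReal.continuous_rpow_const (y := 1 / p.toReal)).tendsto 0 |>.comp key
  rw [ENNReal.zero_rpow_of_pos (by positivity)] at h2
  refine h2.congr fun n => ?_
  rw [eLpNorm_eq_lintegral_rpow_enorm_toReal hp0 hp]
  rfl

end Convergence

/-! ### Composition and multiplication operators on Lᵖ. -/

section Nemytskii

variable {Ω : Type*} [MeasurableSpace Ω] {μ : Measure Ω} {κ : Type*} [Fintype κ]
  {G : Type*} [NormedAddCommGroup G] [NormedSpace ℝ G] {p : ℝ≥0∞}

/-- Multiplication of `X` by the function `g (u₁, …, u_k)`. -/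
def mulN (g : (κ → ℝ) → ℝ) (u : κ → Lp ℝ 2 μ) (X : Lp G p μ) : Lp G p μ :=
  open Classical in
  if h : MemLp (fun z => g (fun i => u i z) • X z) p μ then h.toLp _ else 0

/-- Composition with a function of the coordinates. -/
def compN (Φ : (κ → ℝ) → ℝ) (u : κ → Lp ℝ 2 μ) : Lp ℝ 2 μ :=
  open Classical in
  if h : MemLp (fun z => Φ (fun i => u i z)) 2 μ then h.toLp _ else 0

theorem aestronglyMeasurable_coords (u : κ → Lp ℝ 2 μ) :
    AEStronglyMeasurable (fun z => fun i => u i z) μ :=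
  (aemeasurable_pi_iff.2 fun i => (Lp.aestronglyMeasurable (u i)).aemeasurable).aestronglyMeasurable

theorem BC.coeFn_mulN {g : (κ → ℝ) → ℝ} (hg : BC g) (u : κ → Lp ℝ 2 μ) (X : Lp G p μ) :
    mulN g u X =ᵐ[μ] fun z => g (fun i => u i z) • X z := by
  obtain ⟨C, -, hC⟩ := hg.bdd
  have h : MemLp (fun z => g (fun i => u i z) • X z) p μ := by
    refine (Lp.memLp X).of_le_mul (c := C) ?_ (.of_forall fun z => ?_)
    · exact (hg.cont.comp_aestronglyMeasurable (aestronglyMeasurable_coords u)).smul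
        (Lp.aestronglyMeasurable X)
    · rw [norm_smul]
      exact mul_le_mul_of_nonneg_right (hC _) (norm_nonneg _)
  rw [mulN, dif_pos h]
  exact h.coeFn_toLp

attribute [irreducible] mulN

theorem BC.norm_mulN_le {g : (κ → ℝ) → ℝ} (hg : BC g) {C : ℝ} (hC : ∀ x, |g x| ≤ C)
    (u : κ → Lp ℝ 2 μ) (X : Lp G p μ) : ‖mulN g u X‖ ≤ C * ‖X‖ := by
  refine Lp.norm_le_mul_norm_of_ae_le_mul ?_
  filter_upwards [hg.coeFn_mulN u X] with z hz
  rw [hz, norm_smul]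
  exact mul_le_mul_of_nonneg_right (hC _) (norm_nonneg _)

theorem BC.mulN_add {g : (κ → ℝ) → ℝ} (hg : BC g) (u : κ → Lp ℝ 2 μ) (X Y : Lp G p μ) :
    mulN g u (X + Y) = mulN g u X + mulN g u Y := by
  refine Lp.ext ?_
  filter_upwards [hg.coeFn_mulN u (X + Y), hg.coeFn_mulN u X, hg.coeFn_mulN u Y,
    Lp.coeFn_add X Y, Lp.coeFn_add (mulN g u X) (mulN g u Y)] with z h1 h2 h3 h4 h5
  rw [h1, h5, h4, Pi.add_apply, Pi.add_apply, h2, h3, smul_add]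

theorem BC.mulN_smul {g : (κ → ℝ) → ℝ} (hg : BC g) (u : κ → Lp ℝ 2 μ) (c : ℝ) (X : Lp G p μ) :
    mulN g u (c • X) = c • mulN g u X := by
  refine Lp.ext ?_
  filter_upwards [hg.coeFn_mulN u (c • X), hg.coeFn_mulN u X,
    Lp.coeFn_smul c X, Lp.coeFn_smul c (mulN g u X)] with z h1 h2 h3 h4
  rw [h1, h4, h3, Pi.smul_apply, Pi.smul_apply, h2, smul_comm]

/-- Multiplication by `g (u₁, …, u_k)` as a continuous linear map. -/
def BC.mulL [Fact (1 ≤ p)] {g : (κ → ℝ) → ℝ} (hg : BC g) (u : κ → Lp ℝ 2 μ) :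
    Lp G p μ →L[ℝ] Lp G p μ :=
  LinearMap.mkContinuous
    { toFun := mulN g u
      map_add' := hg.mulN_add u
      map_smul' := hg.mulN_smul u } hg.bdd.choose
    (hg.norm_mulN_le hg.bdd.choose_spec.2 u)

@[simp] theorem BC.mulL_apply [Fact (1 ≤ p)] {g : (κ → ℝ) → ℝ} (hg : BC g) (u : κ → Lp ℝ 2 μ)
    (X : Lp G p μ) : hg.mulL u X = mulN g u X := rfl

theorem eLpNorm_coords_sub_le (u v : κ → Lp ℝ 2 μ) :
    eLpNorm (fun z => (fun i => u i z) - (fun i => v i z)) 2 μ ≤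
      ∑ i, ENNReal.ofReal ‖u i - v i‖ := by
  have h1 : eLpNorm (fun z => (fun i => u i z) - (fun i => v i z)) 2 μ ≤
      eLpNorm (∑ i, fun z => ‖u i z - v i z‖) 2 μ := by
    refine eLpNorm_mono_real fun z => ?_
    rw [Finset.sum_apply]
    refine (pi_norm_le_iff_of_nonneg (Finset.sum_nonneg fun _ _ => norm_nonneg _)).2 fun i => ?_
    exact Finset.single_le_sum (f := fun i => ‖u i z - v i z‖) (fun _ _ => norm_nonneg _)
      (Finset.mem_univ i)
  refine h1.trans ((eLpNorm_sum_le (fun i _ => ?_) (by norm_num)).trans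
    (Finset.sum_le_sum fun i _ => ?_))
  · exact ((Lp.aestronglyMeasurable _).sub (Lp.aestronglyMeasurable _)).norm
  · rw [eLpNorm_norm, ofReal_norm, Lp.enorm_def]
    refine (eLpNorm_congr_ae ?_).le
    exact (Lp.coeFn_sub _ _).symm

/-- Along a subsequence, `L²` convergence of the coordinates is convergence almost everywhere. -/
theorem exists_subseq_coords {u : ℕ → κ → Lp ℝ 2 μ} {v : κ → Lp ℝ 2 μ}
    (h : Tendsto u atTop (𝓝 v)) : ∃ ns : ℕ → ℕ, StrictMono ns ∧
      ∀ᵐ z ∂μ, Tendsto (fun n => fun i => u (ns n) i z) atTop (𝓝 fun i => v i z) := by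
  have h1 : TendstoInMeasure μ (fun n z => fun i => u n i z) atTop (fun z => fun i => v i z) := by
    refine tendstoInMeasure_of_tendsto_eLpNorm (p := 2) (by norm_num)
      (fun n => aestronglyMeasurable_coords _) (aestronglyMeasurable_coords _) ?_
    have h2 : Tendsto (fun n => ∑ i, ENNReal.ofReal ‖u n i - v i‖) atTop (𝓝 0) := by
      have h3 : Tendsto (fun n => ∑ i, ENNReal.ofReal ‖u n i - v i‖) atTop
          (𝓝 (∑ _i : κ, ENNReal.ofReal 0)) := by
        refine tendsto_finsetSum _ fun i _ => ENNReal.tendsto_ofReal ?_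
        exact tendsto_iff_norm_sub_tendsto_zero.1 (tendsto_pi_nhds.1 h i)
      simpa using h3
    exact tendsto_of_tendsto_of_tendsto_of_le_of_le tendsto_const_nhds h2 (fun _ => zero_le)
      fun n => eLpNorm_coords_sub_le _ _
  exact h1.exists_seq_tendsto_ae

/-- For fixed X, every subsequence has a further one along which the coordinates converge almost
everywhere, and C‖X‖ dominates. The change in X is controlled uniformly in u by the bound C of g. -/
theorem BC.continuous_mulN [Fact (1 ≤ p)] (hp : p ≠ ⊤) {g : (κ → ℝ) → ℝ} (hg : BC g) :
    Continuous fun q : (κ → Lp ℝ 2 μ) × Lp G p μ => mulN g q.1 q.2 := by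
  obtain ⟨C, hC0, hC⟩ := hg.bdd
  have hfix (X : Lp G p μ) (u : ℕ → κ → Lp ℝ 2 μ) (v : κ → Lp ℝ 2 μ)
      (h : Tendsto u atTop (𝓝 v)) :
      Tendsto (fun n => mulN g (u n) X) atTop (𝓝 (mulN g v X)) := by
    refine tendsto_of_subseq_tendsto fun ns hns => ?_
    obtain ⟨ms, -, hms⟩ := exists_subseq_coords (h.comp hns)
    refine ⟨ms, tendsto_Lp_of_dominated hp (b := fun z => C * ‖X z‖)
      ((Lp.memLp X).norm.const_mul C) (fun n => ?_) ?_⟩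
    · filter_upwards [hg.coeFn_mulN (u (ns (ms n))) X] with z hz
      rw [hz, norm_smul]
      exact mul_le_mul_of_nonneg_right (hC _) (norm_nonneg _)
    · filter_upwards [hms, hg.coeFn_mulN v X,
        ae_all_iff.2 fun n => hg.coeFn_mulN (u (ns (ms n))) X] with z h1 h2 h3
      rw [h2]
      simp only [h3]
      exact ((hg.cont.tendsto _).comp h1).smul_const _
  refine continuous_iff_seqContinuous.2 fun q q0 hq => ?_
  have h1 := (continuous_fst.tendsto q0).comp hq
  have h2 := (continuous_snd.tendsto q0).comp hq
  have h3 := hfix q0.2 _ _ h1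
  have h4 : Tendsto (fun n => mulN g (q n).1 ((q n).2 - q0.2)) atTop (𝓝 0) := by
    refine squeeze_zero_norm (fun n => hg.norm_mulN_le hC _ _) ?_
    simpa using (tendsto_iff_norm_sub_tendsto_zero.1 h2).const_mul C
  have h5 := h4.add h3
  rw [zero_add] at h5
  refine h5.congr fun n => ?_
  simp only [Function.comp_apply]
  rw [← hg.mulN_add, sub_add_cancel]

theorem BC.tendsto_mulN [Fact (1 ≤ p)] (hp : p ≠ ⊤) {g : (κ → ℝ) → ℝ} (hg : BC g) {α : Type*}
    {l : Filter α} {u : α → κ → Lp ℝ 2 μ} {v : κ → Lp ℝ 2 μ} {X : α → Lp G p μ} {Y : Lp G p μ}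
    (hu : Tendsto u l (𝓝 v)) (hX : Tendsto X l (𝓝 Y)) :
    Tendsto (fun a => mulN g (u a) (X a)) l (𝓝 (mulN g v Y)) := by
  have h1 := (hg.continuous_mulN (G := G) (μ := μ) hp).tendsto (v, Y)
  have h2 : Tendsto (fun a => (u a, X a)) l (𝓝 (v, Y)) := hu.prodMk_nhds hX
  exact h1.comp h2

variable [IsFiniteMeasure μ]

theorem LC.coeFn_compN {Φ : (κ → ℝ) → ℝ} (hΦ : LC Φ) (u : κ → Lp ℝ 2 μ) :
    compN Φ u =ᵐ[μ] fun z => Φ (fun i => u i z) := by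
  have hcont := hΦ.continuous
  obtain ⟨C, -, hC⟩ := hΦ
  have h : MemLp (fun z => Φ (fun i => u i z)) 2 μ := by
    have h0 : MemLp (fun z => ∑ i, |u i z|) 2 μ :=
      memLp_finsetSum _ fun i _ => (Lp.memLp (u i)).abs
    have hb : MemLp (fun z => |Φ 0| + C * ∑ i, |u i z|) 2 μ :=
      (memLp_const |Φ 0|).add (h0.const_mul C)
    refine hb.mono' (hcont.comp_aestronglyMeasurable (aestronglyMeasurable_coords u))
      (.of_forall fun z => ?_)
    have h1 := hC (fun i => u i z) 0
    simp only [Pi.zero_apply, sub_zero] at h1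
    rw [Real.norm_eq_abs]
    linarith [abs_sub_abs_le_abs_sub (Φ fun i => u i z) (Φ 0)]
  rw [compN, dif_pos h]
  exact h.coeFn_toLp

attribute [irreducible] compN

/-- The sum of the moduli of the coordinates. -/
def absSum (u : κ → Lp ℝ 2 μ) : Lp ℝ 2 μ := ∑ i, |u i|

omit [IsFiniteMeasure μ] in
theorem coeFn_absSum (u : κ → Lp ℝ 2 μ) : absSum u =ᵐ[μ] fun z => ∑ i, |u i z| := by
  have h1 : absSum u =ᵐ[μ] fun z => ∑ i, (|u i| : Lp ℝ 2 μ) z := by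
    refine (Lp.coeFn_finsetSum _ _).trans (.of_forall fun z => ?_)
    simp
  filter_upwards [h1, ae_all_iff.2 fun i => Lp.coeFn_abs (u i)] with z h1 h2
  rw [h1]
  exact Finset.sum_congr rfl fun i _ => h2 i

omit [IsFiniteMeasure μ] in
theorem norm_absSum_le (u : κ → Lp ℝ 2 μ) : ‖absSum u‖ ≤ ∑ i, ‖u i‖ :=
  (norm_sum_le _ _).trans (Finset.sum_le_sum fun i _ => (norm_abs_eq_norm (u i)).le)

theorem LC.continuous_compN {Φ : (κ → ℝ) → ℝ} (hΦ : LC Φ) :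
    Continuous (compN Φ : (κ → Lp ℝ 2 μ) → Lp ℝ 2 μ) := by
  obtain ⟨C, hC0, hC⟩ := id hΦ
  rw [continuous_iff_continuousAt]
  intro u
  rw [ContinuousAt, tendsto_iff_norm_sub_tendsto_zero]
  have h1 : Continuous fun v : κ → Lp ℝ 2 μ => C * ∑ i, ‖v i - u i‖ := by fun_prop
  refine squeeze_zero (fun _ => norm_nonneg _) (fun v => ?_)
    (by simpa using h1.tendsto u)
  refine (Lp.norm_le_mul_norm_of_ae_le_mul (g := absSum (v - u)) ?_).trans
    (mul_le_mul_of_nonneg_left (norm_absSum_le _) hC0)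
  filter_upwards [Lp.coeFn_sub (compN Φ v) (compN Φ u), hΦ.coeFn_compN v, hΦ.coeFn_compN u,
    coeFn_absSum (v - u), ae_all_iff.2 fun i => Lp.coeFn_sub (v i) (u i)] with z h1 h2 h3 h4 h5
  rw [h1, Pi.sub_apply, h2, h3, h4, Real.norm_eq_abs, Real.norm_eq_abs]
  refine (hC _ _).trans (mul_le_mul_of_nonneg_left (le_trans (Finset.sum_le_sum fun i _ => ?_)
    (le_abs_self _)) hC0)
  have := h5 i
  rw [Pi.sub_apply, this, Pi.sub_apply]

/-- The inclusion of `L²(μ)` into `L¹(μ)` as a continuous linear map. -/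
def toL1L : Lp ℝ 2 μ →L[ℝ] Lp ℝ 1 μ :=
  LinearMap.mkContinuous
    { toFun := toL1
      map_add' := fun u v => by
        refine Lp.ext ?_
        filter_upwards [MemLp.coeFn_toLp (MemLp.mono_exponent (p := 1) (Lp.memLp (u + v))
            (by norm_num)), MemLp.coeFn_toLp (MemLp.mono_exponent (p := 1) (Lp.memLp u)
            (by norm_num)), MemLp.coeFn_toLp (MemLp.mono_exponent (p := 1) (Lp.memLp v)
            (by norm_num)), Lp.coeFn_add u v, Lp.coeFn_add (toL1 u) (toL1 v)] with z h1 h2 h3 h4 h5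
        rw [toL1, h1, h5, Pi.add_apply, h4, Pi.add_apply, toL1, toL1, h2, h3]
      map_smul' := fun c u => by
        refine Lp.ext ?_
        filter_upwards [MemLp.coeFn_toLp (MemLp.mono_exponent (p := 1) (Lp.memLp (c • u))
            (by norm_num)), MemLp.coeFn_toLp (MemLp.mono_exponent (p := 1) (Lp.memLp u)
            (by norm_num)), Lp.coeFn_smul c u, Lp.coeFn_smul c (toL1 u)] with z h1 h2 h4 h5
        rw [toL1, h1, RingHom.id_apply, h5, Pi.smul_apply, h4, Pi.smul_apply, toL1, h2] }
    ((μ univ) ^ (1 / (1 : ℝ) - 1 / 2)).toReal fun u => by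
      change ‖toL1 u‖ ≤ _
      have h := eLpNorm_le_eLpNorm_mul_rpow_measure_univ (p := 1) (q := 2) (by norm_num)
        (Lp.aestronglyMeasurable u)
      rw [toL1, Lp.norm_toLp, Lp.norm_def, mul_comm, ← ENNReal.toReal_mul]
      refine ENNReal.toReal_mono (ENNReal.mul_ne_top (Lp.eLpNorm_ne_top u) ?_) (by simpa using h)
      exact ENNReal.rpow_ne_top_of_nonneg (by norm_num) (measure_ne_top _ _)

@[simp] theorem toL1L_apply (u : Lp ℝ 2 μ) : toL1L u = toL1 u := rfl

theorem coeFn_toL1 (u : Lp ℝ 2 μ) : toL1 u =ᵐ[μ] u := MemLp.coeFn_toLp _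

omit [IsFiniteMeasure μ] in
theorem norm_L1_le_of_ae_le_sq {F : Lp ℝ 1 μ} {s : Lp ℝ 2 μ} {C : ℝ}
    (h : ∀ᵐ z ∂μ, |F z| ≤ C * s z ^ 2) : ‖F‖ ≤ C * ‖s‖ ^ 2 := by
  have h1 : ‖s‖ ^ 2 = ∫ z, s z ^ 2 ∂μ := by
    rw [← real_inner_self_eq_norm_sq, L2.inner_def]
    refine integral_congr_ae (.of_forall fun z => ?_)
    simp [sq]
  rw [L1.norm_eq_integral_norm, h1, ← integral_const_mul]
  exact integral_mono_ae (L1.integrable_coeFn F).norm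
    ((Lp.memLp s).integrable_sq.const_mul C) h

/-- The pointwise Taylor remainder is quadratic in v - u, and the square of an L² function has L¹
norm equal to its squared L² norm. The target has to be L¹: as a map into L² such a composition is
in general not differentiable. -/
theorem Smooth2.hasFDerivAt_toL1_compN {Φ : (κ → ℝ) → ℝ} (hΦ : Smooth2 Φ) (u : κ → Lp ℝ 2 μ) :
    HasFDerivAt (fun v : κ → Lp ℝ 2 μ => toL1 (compN Φ v))
      (∑ i, (toL1L ∘L (hΦ.bc_pd i).mulL u) ∘L ContinuousLinearMap.proj i) u := by
  obtain ⟨C, hC0, hC⟩ := hΦ.taylor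
  refine HasFDerivAt.of_isLittleO (Asymptotics.IsBigO.trans_isLittleO (g := fun v => ‖v - u‖ ^ 2)
    (Asymptotics.IsBigO.of_bound (C * (Fintype.card κ : ℝ) ^ 2) (.of_forall fun v => ?_)) ?_)
  · have hs : ‖absSum (v - u)‖ ≤ Fintype.card κ * ‖v - u‖ := by
      refine (norm_absSum_le _).trans ?_
      refine (Finset.sum_le_sum fun i _ => norm_le_pi_norm (v - u) i).trans ?_
      simp
    have h0 : ‖absSum (v - u)‖ ^ 2 ≤ (Fintype.card κ : ℝ) ^ 2 * ‖‖v - u‖ ^ 2‖ := by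
      rw [norm_pow, norm_norm, ← mul_pow]
      exact pow_le_pow_left₀ (norm_nonneg _) hs 2
    rw [mul_assoc]
    refine le_trans (norm_L1_le_of_ae_le_sq (s := absSum (v - u)) (C := C) ?_)
      (mul_le_mul_of_nonneg_left h0 hC0)
    have hL : (∑ i, (toL1L ∘L (hΦ.bc_pd i).mulL u) ∘L ContinuousLinearMap.proj i :
        (κ → Lp ℝ 2 μ) →L[ℝ] Lp ℝ 1 μ) (v - u) =
        toL1L (∑ i, mulN (pd Φ i) u (v i - u i)) := by
      rw [map_sum]
      simp [_root_.sum_apply]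
    rw [hL]
    change ∀ᵐ z ∂μ, |(toL1L (compN Φ v) - toL1L (compN Φ u) -
      toL1L (∑ i, mulN (pd Φ i) u (v i - u i)) : Lp ℝ 1 μ) z| ≤ _
    rw [← map_sub, ← map_sub]
    filter_upwards [coeFn_toL1 (compN Φ v - compN Φ u - ∑ i, mulN (pd Φ i) u (v i - u i)),
      Lp.coeFn_sub (compN Φ v - compN Φ u) (∑ i, mulN (pd Φ i) u (v i - u i)),
      Lp.coeFn_sub (compN Φ v) (compN Φ u), hΦ.lc.coeFn_compN v, hΦ.lc.coeFn_compN u,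
      coeFn_absSum (v - u), ae_all_iff.2 fun i => Lp.coeFn_sub (v i) (u i),
      ae_all_iff.2 fun i => (hΦ.bc_pd i).coeFn_mulN u (v i - u i),
      Lp.coeFn_finsetSum Finset.univ fun i => mulN (pd Φ i) u (v i - u i)]
      with z h1 h2 h3 h4 h5 h6 h7 h8 h9
    simp only [toL1L_apply]
    rw [h1, h2, Pi.sub_apply, h3, Pi.sub_apply, h4, h5, h9, h6, Finset.sum_apply]
    simp only [h8, h7, Pi.sub_apply, smul_eq_mul]
    exact hC _ _
  · have h1 : Tendsto (fun v => ‖v - u‖) (𝓝 u) (𝓝 0) := by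
      have : Continuous fun v : κ → Lp ℝ 2 μ => ‖v - u‖ := by fun_prop
      simpa using this.tendsto u
    have h2 : (fun v => ‖v - u‖ ^ 2) =o[𝓝 u] fun v => ‖v - u‖ := by
      have h3 := (Asymptotics.isLittleO_one_iff ℝ).2 h1 |>.mul_isBigO
        (Asymptotics.isBigO_refl (fun v => ‖v - u‖) (𝓝 u))
      simpa [sq] using h3
    exact (Asymptotics.isLittleO_norm_right (g' := fun v => v - u)).1 h2

theorem Smooth2.hasDerivWithinAt_toL1_compN {Φ : (κ → ℝ) → ℝ} (hΦ : Smooth2 Φ)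
    {y : ℝ → κ → Lp ℝ 2 μ} {y' : κ → Lp ℝ 2 μ} {s : Set ℝ} {t : ℝ}
    (hy : ∀ i, HasDerivWithinAt (fun r => y r i) (y' i) s t) :
    HasDerivWithinAt (fun r => toL1 (compN Φ (y r)))
      (∑ i, toL1 (mulN (pd Φ i) (y t) (y' i))) s t := by
  have h := (hΦ.hasFDerivAt_toL1_compN (y t)).comp_hasDerivWithinAt t (hasDerivWithinAt_pi.2 hy)
  refine h.congr_deriv ?_
  simp only [_root_.sum_apply, ContinuousLinearMap.comp_apply, ContinuousLinearMap.proj_apply,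
    BC.mulL_apply, toL1L_apply]

end Nemytskii

/-! ### The pointwise inner product of L² functions, with values in L¹. -/

section InnerProduct

variable {Ω : Type*} [MeasurableSpace Ω] {μ : Measure Ω} {G : Type*} [NormedAddCommGroup G]
  [InnerProductSpace ℝ G]

theorem coeFn_innerL1 (v w : Lp G 2 μ) : innerL1 v w =ᵐ[μ] fun z => inner ℝ (v z) (w z) :=
  MemLp.coeFn_toLp _

/-- Bilinearity, continuity and the norm bound are read off from the Hölder pairing. -/
theorem innerL1_eq_holder (v w : Lp G 2 μ) :
    innerL1 v w = (innerSL ℝ : G →L[ℝ] G →L[ℝ] ℝ).holderL μ 2 2 1 v w := by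
  refine Lp.ext ((coeFn_innerL1 v w).trans ?_)
  exact ((innerSL ℝ : G →L[ℝ] G →L[ℝ] ℝ).coeFn_holder v w).symm

theorem continuous_innerL1 :
    Continuous fun q : Lp G 2 μ × Lp G 2 μ => innerL1 q.1 q.2 := by
  simp only [innerL1_eq_holder]
  fun_prop

theorem norm_innerL1_le (v w : Lp G 2 μ) : ‖innerL1 v w‖ ≤ ‖v‖ * ‖w‖ := by
  have h1 : ‖(innerSL ℝ : G →L[ℝ] G →L[ℝ] ℝ)‖ ≤ 1 := norm_innerSL_le (𝕜 := ℝ) (E := G)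
  have h2 := (innerSL ℝ : G →L[ℝ] G →L[ℝ] ℝ).norm_holder_apply_apply_le (r := 1) v w
  rw [innerL1_eq_holder]
  refine h2.trans ?_
  have := mul_nonneg (norm_nonneg v) (norm_nonneg w)
  nlinarith

theorem innerL1_sub_left (v v' w : Lp G 2 μ) :
    innerL1 (v - v') w = innerL1 v w - innerL1 v' w := by
  simp only [innerL1_eq_holder, map_sub, _root_.sub_apply]

theorem innerL1_sub_right (v w w' : Lp G 2 μ) :
    innerL1 v (w - w') = innerL1 v w - innerL1 v w' := by
  simp only [innerL1_eq_holder, map_sub]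

end InnerProduct

end LinearEq
end

noncomputable section
namespace LinearEq

/-! ### Functions with bounded derivatives of all orders. -/

section BoundedDerivatives

variable {V W U : Type*} [NormedAddCommGroup V] [NormedSpace ℝ V] [NormedAddCommGroup W]
  [NormedSpace ℝ W] [NormedAddCommGroup U] [NormedSpace ℝ U]

/-- Smooth functions all of whose derivatives, including the function itself, are bounded. -/
structure BddDeriv (g : V → W) : Prop where
  smooth : ContDiff ℝ ∞ g
  bdd : ∀ k : ℕ, ∃ C : ℝ, ∀ x, ‖iteratedFDeriv ℝ k g x‖ ≤ C

theorem BddDeriv.comp_clm {g : V → W} (hg : BddDeriv g) (L : U →L[ℝ] V) :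
    BddDeriv fun x => g (L x) where
  smooth := hg.smooth.comp L.contDiff
  bdd k := by
    obtain ⟨C, hC⟩ := hg.bdd k
    refine ⟨C * ∏ _i : Fin k, ‖L‖, fun x => ?_⟩
    have h := L.iteratedFDeriv_comp_right hg.smooth x (i := k) (by exact_mod_cast le_top)
    change ‖iteratedFDeriv ℝ k (g ∘ L) x‖ ≤ _
    rw [h]
    refine (ContinuousMultilinearMap.norm_compContinuousLinearMap_le _ _).trans ?_
    exact mul_le_mul_of_nonneg_right (hC _) (Finset.prod_nonneg fun _ _ => norm_nonneg _)

theorem BddDeriv.clm_comp {g : V → W} (hg : BddDeriv g) (L : W →L[ℝ] U) :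
    BddDeriv fun x => L (g x) where
  smooth := L.contDiff.comp hg.smooth
  bdd k := by
    obtain ⟨C, hC⟩ := hg.bdd k
    refine ⟨‖L‖ * C, fun x => ?_⟩
    refine (L.norm_iteratedFDeriv_comp_left (N := (∞ : WithTop ℕ∞)) hg.smooth.contDiffAt
      (by exact_mod_cast le_top)).trans ?_
    exact mul_le_mul_of_nonneg_left (hC x) (norm_nonneg _)

theorem BddDeriv.sum {κ : Type*} (s : Finset κ) {g : κ → V → W} (hg : ∀ i, BddDeriv (g i)) :
    BddDeriv fun x => ∑ i ∈ s, g i x where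
  smooth := ContDiff.sum fun i _ => (hg i).smooth
  bdd k := by
    choose C hC using fun i => (hg i).bdd k
    refine ⟨∑ i ∈ s, C i, fun x => ?_⟩
    rw [iteratedFDeriv_fun_sum_apply fun i _ =>
      ((hg i).smooth.of_le (by exact_mod_cast le_top)).contDiffAt]
    exact (norm_sum_le _ _).trans (Finset.sum_le_sum fun i _ => hC i x)

theorem BddDeriv.pi {κ : Type*} [Fintype κ] {g : κ → V → ℝ} (hg : ∀ i, BddDeriv (g i)) :
    BddDeriv fun x i => g i x := by
  classical
  have h := BddDeriv.sum Finset.univ fun i =>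
    (hg i).clm_comp (ContinuousLinearMap.single ℝ (fun _ : κ => ℝ) i)
  convert h using 1
  ext x i
  simp [Finset.sum_apply, Pi.single_apply]

/-- The inner function is bounded, so its values stay in a compact ball, on which each derivative of
Φ is bounded. No global bounds on Φ are needed, and cylinder functions may be composed with any
smooth function. -/
theorem BddDeriv.comp_smooth [ProperSpace W] {g : V → W} (hg : BddDeriv g) {Φ : W → U}
    (hΦ : ContDiff ℝ ∞ Φ) : BddDeriv fun x => Φ (g x) where
  smooth := hΦ.comp hg.smooth
  bdd n := by
    choose D hD using hg.bdd
    have hball (x : V) : g x ∈ Metric.closedBall (0 : W) (D 0) := by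
      have := hD 0 x
      rw [norm_iteratedFDeriv_zero] at this
      simpa using this
    have hC (i : ℕ) : ∃ C, ∀ y ∈ Metric.closedBall (0 : W) (D 0),
        ‖iteratedFDeriv ℝ i Φ y‖ ≤ C :=
      (isCompact_closedBall _ _).exists_bound_of_continuousOn
        (hΦ.continuous_iteratedFDeriv (by exact_mod_cast le_top)).continuousOn
    choose C hC using hC
    -- The Faà di Bruno estimate wants one constant for Φ and a bound Dⁱ for the i-th derivative of
    -- g; adding 1 makes the base at least 1, so its powers dominate it.
    refine ⟨n.factorial * (∑ i ∈ Finset.range (n + 1), |C i|) *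
      (1 + ∑ i ∈ Finset.range (n + 1), |D i|) ^ n, fun x => ?_⟩
    refine norm_iteratedFDeriv_comp_le (N := ∞) hΦ hg.smooth (by exact_mod_cast le_top) x
      (fun i hi => ?_) fun i h1 hi => ?_
    · refine ((hC i _ (hball x)).trans (le_abs_self _)).trans ?_
      exact Finset.single_le_sum (f := fun i => |C i|) (fun _ _ => abs_nonneg _)
        (Finset.mem_range.2 (by omega))
    · have h2 : |D i| ≤ ∑ i ∈ Finset.range (n + 1), |D i| :=
        Finset.single_le_sum (f := fun i => |D i|) (fun _ _ => abs_nonneg _)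
          (Finset.mem_range.2 (by omega))
      have h3 : (1 : ℝ) ≤ 1 + ∑ i ∈ Finset.range (n + 1), |D i| := by linarith [abs_nonneg (D i)]
      calc ‖iteratedFDeriv ℝ i g x‖ ≤ |D i| := (hD i x).trans (le_abs_self _)
        _ ≤ 1 + ∑ i ∈ Finset.range (n + 1), |D i| := by linarith
        _ ≤ _ := le_self_pow₀ h3 (by omega)

end BoundedDerivatives

theorem abs_pd_le {κ : Type*} [Fintype κ] (Φ : (κ → ℝ) → ℝ) (i : κ) (x : κ → ℝ) :
    |pd Φ i x| ≤ ‖fderiv ℝ Φ x‖ := by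
  classical
  refine ((fderiv ℝ Φ x).le_opNorm _).trans_eq ?_
  rw [Pi.norm_single, norm_one, mul_one]

/-! ### Finitely based functions and their gradients. -/

section Cylinder

variable {E H : Type*} [NormedAddCommGroup E] [NormedSpace ℝ E]
  [NormedAddCommGroup H] [InnerProductSpace ℝ H] [CompleteSpace H]

theorem hasGradientAt_comp {κ : Type*} [Fintype κ] {Φ : (κ → ℝ) → ℝ} {v : κ → H → ℝ} {G : κ → H}
    {x : H} (hΦ : DifferentiableAt ℝ Φ fun i => v i x) (hv : ∀ i, HasGradientAt (v i) (G i) x) :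
    HasGradientAt (fun h => Φ fun i => v i h) (∑ i, pd Φ i (fun i => v i x) • G i) x := by
  rw [hasGradientAt_iff_hasFDerivAt, map_sum]
  have h1 := hΦ.hasFDerivAt.comp x (hasFDerivAt_pi.2 fun i => (hv i).hasFDerivAt)
  refine h1.congr_fderiv ?_
  ext d
  simp only [ContinuousLinearMap.comp_apply, fderiv_apply_eq_sum, _root_.sum_apply, map_smul,
    _root_.smul_apply, smul_eq_mul]
  rfl

theorem hasGradientAt_clm (ι : H →L[ℝ] E) (l : E →L[ℝ] ℝ) (z : E) (x : H) :
    HasGradientAt (fun h => l (z + ι h)) ((InnerProductSpace.toDual ℝ H).symm (l ∘L ι)) x := by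
  rw [hasGradientAt_iff_hasFDerivAt, LinearIsometryEquiv.apply_symm_apply]
  have h := (l ∘L ι).hasFDerivAt (x := x) |>.const_add (l z)
  simpa using h

/-- The fixed vectors are the Riesz representatives of the functionals lᵢ ∘ ι. Measurability and
square integrability of A^{1/2}∇v thereby reduce to those of A^{1/2}k for single vectors k. -/
theorem IsCyl.exists_hGrad (ι : H →L[ℝ] E) {v : E → ℝ} (hv : IsCyl v) :
    ∃ (m : ℕ) (c : Fin m → E → ℝ) (k : Fin m → H),
      (∀ i, Continuous (c i)) ∧ (∀ i, ∃ C, ∀ z, |c i z| ≤ C) ∧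
      ∀ z, HasGradientAt (fun h => v (z + ι h)) (∑ i, c i z • k i) 0 := by
  obtain ⟨m, g, l, hg, hb, rfl⟩ := hv
  refine ⟨m, fun i z => pd g i fun i => l i z,
    fun i => (InnerProductSpace.toDual ℝ H).symm (l i ∘L ι), fun i => ?_, fun i => ?_, fun z => ?_⟩
  · exact (contDiff_pd hg i).continuous.comp (by fun_prop)
  · obtain ⟨C, hC⟩ := hb 1
    refine ⟨C, fun z => ?_⟩
    have h1 : ‖fderiv ℝ g fun i => l i z‖ ≤ C := by
      rw [← norm_iteratedFDeriv_one]; exact hC _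
    exact (abs_pd_le g i _).trans h1
  · have h := hasGradientAt_comp (Φ := g) (v := fun i h => l i (z + ι h)) (x := (0 : H))
      ((hg.differentiable (by simp)) _) fun i => hasGradientAt_clm ι (l i) z 0
    simpa using h

theorem IsCyl.hasGradientAt (ι : H →L[ℝ] E) {v : E → ℝ} (hv : IsCyl v) (z : E) :
    HasGradientAt (fun h => v (z + ι h)) (hGrad ι v z) 0 := by
  obtain ⟨m, c, k, -, -, h⟩ := hv.exists_hGrad ι
  exact (h z).differentiableAt.hasGradientAt

omit [CompleteSpace H] [InnerProductSpace ℝ H] [NormedAddCommGroup H] in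
theorem IsCyl.continuous {v : E → ℝ} (hv : IsCyl v) : Continuous v := by
  obtain ⟨m, g, l, hg, hb, rfl⟩ := hv
  exact hg.continuous.comp (by fun_prop)

omit [CompleteSpace H] [InnerProductSpace ℝ H] [NormedAddCommGroup H] in
theorem IsCyl.exists_bound {v : E → ℝ} (hv : IsCyl v) : ∃ C, ∀ z, |v z| ≤ C := by
  obtain ⟨m, g, l, hg, hb, rfl⟩ := hv
  obtain ⟨C, hC⟩ := hb 0
  exact ⟨C, fun z => by simpa using hC fun i => l i z⟩

/-- The functionals of all the vᵢ are listed together, indexed by a sigma type, and each inner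
function reads its own block of coordinates. -/
theorem IsCyl.comp {κ : Type*} [Fintype κ] {Φ : (κ → ℝ) → ℝ} (hΦ : ContDiff ℝ ∞ Φ)
    {v : κ → E → ℝ} (hv : ∀ i, IsCyl (v i)) : IsCyl fun z => Φ fun i => v i z := by
  choose m g l hg hb hv using hv
  let e := Fintype.equivFin (Σ i, Fin (m i))
  have hG : BddDeriv fun (x : Fin (Fintype.card (Σ i, Fin (m i))) → ℝ) (i : κ) =>
      g i (fun j => x (e ⟨i, j⟩)) := by
    refine BddDeriv.pi fun i => ?_
    exact BddDeriv.comp_clm (g := g i) ⟨hg i, hb i⟩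
      (ContinuousLinearMap.pi fun j => ContinuousLinearMap.proj (R := ℝ) (φ := fun _ => ℝ) (e ⟨i, j⟩))
  have hΦG := hG.comp_smooth hΦ
  refine ⟨_, _, fun n => l (e.symm n).1 (e.symm n).2, hΦG.smooth, hΦG.bdd, ?_⟩
  ext z
  refine congrArg Φ (funext fun i => ?_)
  rw [hv i]
  refine congrArg (g i) (funext fun j => ?_)
  exact (congrArg (fun p : Σ i, Fin (m i) => l p.1 p.2 z) (e.symm_apply_apply ⟨i, j⟩)).symm

theorem IsCyl.hGrad_comp (ι : H →L[ℝ] E) {κ : Type*} [Fintype κ] {Φ : (κ → ℝ) → ℝ}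
    (hΦ : ContDiff ℝ ∞ Φ) {v : κ → E → ℝ} (hv : ∀ i, IsCyl (v i)) (z : E) :
    hGrad ι (fun z => Φ fun i => v i z) z =
      ∑ i, pd Φ i (fun i => v i z) • hGrad ι (v i) z := by
  have h := hasGradientAt_comp (Φ := Φ) (v := fun i h => v i (z + ι h)) (x := (0 : H))
      ((hΦ.differentiable (by simp)) _) fun i => (hv i).hasGradientAt ι z
  have h2 := h.gradient
  simp only [map_zero, add_zero] at h2
  exact h2

theorem pd_proj_add {κ : Type*} [Fintype κ] (L : (κ → ℝ) →L[ℝ] ℝ) (i : κ) (x : κ → ℝ) :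
    pd L i x = open Classical in L (Pi.single i 1) := by
  rw [pd, ContinuousLinearMap.fderiv]

/-- Cylinder functions form a vector space, on which the gradient is linear. -/
theorem IsCyl.linComb (ι : H →L[ℝ] E) {v w : E → ℝ} (hv : IsCyl v) (hw : IsCyl w) (a b : ℝ) :
    IsCyl (a • v + b • w) ∧
      ∀ z, hGrad ι (a • v + b • w) z = a • hGrad ι v z + b • hGrad ι w z := by
  let L : (Fin 2 → ℝ) →L[ℝ] ℝ :=
    a • ContinuousLinearMap.proj 0 + b • ContinuousLinearMap.proj 1
  have hc : ∀ i : Fin 2, IsCyl ((![v, w] : Fin 2 → E → ℝ) i) := by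
    intro i; fin_cases i <;> simpa
  have e : (fun z => L fun i => (![v, w] : Fin 2 → E → ℝ) i z) = a • v + b • w := by
    ext z; simp [L]
  refine ⟨e ▸ IsCyl.comp L.contDiff hc, fun z => ?_⟩
  have h := IsCyl.hGrad_comp ι (Φ := L) L.contDiff hc z
  rw [e] at h
  rw [h]
  simp only [pd_proj_add]
  simp [L]

omit [CompleteSpace H] [InnerProductSpace ℝ H] [NormedAddCommGroup H] in
theorem IsCyl.const (a : ℝ) : IsCyl fun _ : E => a :=
  IsCyl.comp (κ := Empty) (Φ := fun _ => a) contDiff_const (v := fun i => i.elim) fun i => i.elim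

theorem hGrad_const (ι : H →L[ℝ] E) (a : ℝ) (z : E) : hGrad ι (fun _ : E => a) z = 0 := by
  rw [hGrad]
  exact (hasGradientAt_const (0 : H) a).gradient

end Cylinder

end LinearEq
end

noncomputable section
namespace LinearEq

/-! ### The closed gradient as a closed subspace of L²(μ) × L²(μ; H). -/

section Graph

variable {E H : Type*} [NormedAddCommGroup E] [NormedSpace ℝ E]
  [MeasurableSpace E] [BorelSpace E]
  [NormedAddCommGroup H] [InnerProductSpace ℝ H] [CompleteSpace H] [SecondCountableTopology H]
  [MeasurableSpace H] [BorelSpace H]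
  {ι : H →L[ℝ] E} {μ : Measure E} {A : E → H →L[ℝ] H}

/-- `A^{1/2} ∇v`. -/
def sqrtGrad (ι : H →L[ℝ] E) (A : E → H →L[ℝ] H) (v : E → ℝ) (z : E) : H :=
  posSqrt (A z) (hGrad ι v z)

/-- A measurable field of positive operators whose form is closable. -/
structure IsDiffusion (ι : H →L[ℝ] E) (μ : Measure E) (A : E → H →L[ℝ] H) : Prop where
  meas : ∀ h : H, Measurable fun z => A z h
  pos : ∀ z, (A z).IsPositive
  condA1 : CondA1 ι μ A

theorem IsCyl.memLp [IsFiniteMeasure μ] {v : E → ℝ} (hv : IsCyl v) : MemLp v 2 μ := by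
  obtain ⟨C, hC⟩ := hv.exists_bound
  exact MemLp.of_bound hv.continuous.aestronglyMeasurable C (.of_forall hC)

omit [BorelSpace E] in
theorem IsDiffusion.memLp_posSqrt (hA : IsDiffusion ι μ A) (k : H) :
    MemLp (fun z => posSqrt (A z) k) 2 μ := by
  rw [memLp_two_iff_integrable_sq_norm (measurable_posSqrt hA.meas hA.pos k).aestronglyMeasurable]
  refine (hA.condA1.integrable k).congr (.of_forall fun z => ?_)
  simp only
  rw [← real_inner_self_eq_norm_sq, inner_posSqrt (hA.pos z)]

theorem IsDiffusion.memLp_sqrtGrad (hA : IsDiffusion ι μ A) {v : E → ℝ} (hv : IsCyl v) :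
    MemLp (sqrtGrad ι A v) 2 μ := by
  obtain ⟨m, c, k, hc, hb, hg⟩ := hv.exists_hGrad ι
  have h1 : sqrtGrad ι A v = fun z => ∑ i, c i z • posSqrt (A z) (k i) := by
    ext z
    rw [sqrtGrad, hGrad, (hg z).gradient, map_sum]
    simp
  rw [h1]
  refine memLp_finsetSum _ fun i _ => ?_
  obtain ⟨C, hC⟩ := hb i
  refine (hA.memLp_posSqrt (k i)).of_le_mul (c := C) ?_ (.of_forall fun z => ?_)
  · exact (hc i).aestronglyMeasurable.smul (hA.memLp_posSqrt (k i)).1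
  · rw [norm_smul]
    exact mul_le_mul_of_nonneg_right (hC z) (norm_nonneg _)

omit [MeasurableSpace E] [BorelSpace E] [SecondCountableTopology H] [MeasurableSpace H]
  [BorelSpace H] in
theorem sqrtGrad_linComb {v w : E → ℝ} (hv : IsCyl v) (hw : IsCyl w) (a b : ℝ) (z : E) :
    sqrtGrad ι A (a • v + b • w) z = a • sqrtGrad ι A v z + b • sqrtGrad ι A w z := by
  simp only [sqrtGrad, (hv.linComb ι hw a b).2, map_add, map_smul]

/-- The graph of `A^{1/2} ∇` on finitely based smooth functions. -/
def cylGraph (ι : H →L[ℝ] E) (μ : Measure E) (A : E → H →L[ℝ] H) :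
    Submodule ℝ (Lp ℝ 2 μ × Lp H 2 μ) where
  carrier := {p | ∃ v, IsCyl v ∧ p.1 =ᵐ[μ] v ∧ p.2 =ᵐ[μ] sqrtGrad ι A v}
  add_mem' := by
    rintro p q ⟨v, hv, h1, h2⟩ ⟨w, hw, h3, h4⟩
    refine ⟨(1 : ℝ) • v + (1 : ℝ) • w, (hv.linComb ι hw 1 1).1, ?_, ?_⟩
    · filter_upwards [Lp.coeFn_add p.1 q.1, h1, h3] with z e1 e2 e3
      rw [Prod.fst_add, e1, Pi.add_apply, e2, e3]
      simp
    · filter_upwards [Lp.coeFn_add p.2 q.2, h2, h4] with z e1 e2 e3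
      rw [sqrtGrad_linComb hv hw, Prod.snd_add, e1, Pi.add_apply, e2, e3]
      simp
  zero_mem' := by
    refine ⟨fun _ => 0, IsCyl.const 0, ?_, ?_⟩
    · exact Lp.coeFn_zero _ _ _
    · filter_upwards [Lp.coeFn_zero H 2 μ] with z hz
      simpa [sqrtGrad, hGrad_const] using hz
  smul_mem' := by
    rintro c p ⟨v, hv, h1, h2⟩
    refine ⟨c • v + (0 : ℝ) • v, (hv.linComb ι hv c 0).1, ?_, ?_⟩
    · filter_upwards [Lp.coeFn_smul c p.1, h1] with z e1 e2
      rw [Prod.smul_fst, e1, Pi.smul_apply, e2]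
      simp
    · filter_upwards [Lp.coeFn_smul c p.2, h2] with z e1 e2
      rw [sqrtGrad_linComb hv hv, Prod.smul_snd, e1, Pi.smul_apply, e2]
      simp

/-- The graph of `D_{A^{1/2}}`. -/
def graph (ι : H →L[ℝ] E) (μ : Measure E) (A : E → H →L[ℝ] H) :
    Submodule ℝ (Lp ℝ 2 μ × Lp H 2 μ) :=
  (cylGraph ι μ A).topologicalClosure

omit [BorelSpace E] [SecondCountableTopology H] [MeasurableSpace H] [BorelSpace H] in
theorem isClosed_graph : IsClosed (graph ι μ A : Set (Lp ℝ 2 μ × Lp H 2 μ)) :=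
  Submodule.isClosed_topologicalClosure _

omit [BorelSpace E] [SecondCountableTopology H] [MeasurableSpace H] [BorelSpace H] in
theorem mem_graph_iff {p : Lp ℝ 2 μ × Lp H 2 μ} : p ∈ graph ι μ A ↔
    ∃ q : ℕ → Lp ℝ 2 μ × Lp H 2 μ, (∀ n, q n ∈ cylGraph ι μ A) ∧ Tendsto q atTop (𝓝 p) := by
  rw [graph, ← SetLike.mem_coe, Submodule.topologicalClosure_coe, mem_closure_iff_seq_limit]
  rfl

/-- Replaces approximating sequences of functions by membership in a closed subspace, so that sums,
limits and time averages of elements of F and their gradients come for free. -/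
theorem IsDiffusion.isSqrtGrad_iff [IsFiniteMeasure μ] (hA : IsDiffusion ι μ A) {u : Lp ℝ 2 μ}
    {w : Lp H 2 μ} : IsSqrtGrad ι μ A u w ↔ (u, w) ∈ graph ι μ A := by
  rw [mem_graph_iff]
  constructor
  · rintro ⟨v, hv, h1, h2⟩
    refine ⟨fun n => ((hv n).memLp.toLp _, (hA.memLp_sqrtGrad (hv n)).toLp _),
      fun n => ⟨v n, hv n, (hv n).memLp.coeFn_toLp, (hA.memLp_sqrtGrad (hv n)).coeFn_toLp⟩, ?_⟩
    refine Tendsto.prodMk_nhds ?_ ?_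
    · rw [Lp.tendsto_Lp_iff_tendsto_eLpNorm']
      refine h1.congr fun n => eLpNorm_congr_ae ?_
      filter_upwards [(hv n).memLp.coeFn_toLp (μ := μ)] with z hz
      simp [hz]
    · rw [Lp.tendsto_Lp_iff_tendsto_eLpNorm']
      refine h2.congr fun n => eLpNorm_congr_ae ?_
      filter_upwards [(hA.memLp_sqrtGrad (hv n)).coeFn_toLp] with z hz
      simp [hz, sqrtGrad]
  · rintro ⟨q, hq, hlim⟩
    choose v hv h1 h2 using hq
    refine ⟨v, hv, ?_, ?_⟩
    · have h := (continuous_fst.tendsto _).comp hlim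
      rw [Lp.tendsto_Lp_iff_tendsto_eLpNorm'] at h
      refine h.congr fun n => eLpNorm_congr_ae ?_
      filter_upwards [h1 n] with z hz
      simp [hz]
    · have h := (continuous_snd.tendsto _).comp hlim
      rw [Lp.tendsto_Lp_iff_tendsto_eLpNorm'] at h
      refine h.congr fun n => eLpNorm_congr_ae ?_
      filter_upwards [h2 n] with z hz
      simp [hz, sqrtGrad]

omit [BorelSpace E] [SecondCountableTopology H] [MeasurableSpace H] [BorelSpace H] in
theorem preForm_eq_norm_sq (hpos : ∀ z, (A z).IsPositive) {v : E → ℝ} {w : Lp H 2 μ}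
    (h : w =ᵐ[μ] sqrtGrad ι A v) : preForm ι μ A v v = ‖w‖ ^ 2 := by
  rw [preForm, ← real_inner_self_eq_norm_sq, L2.inner_def]
  refine integral_congr_ae ?_
  filter_upwards [h] with z hz
  rw [hz, sqrtGrad, inner_posSqrt (hpos z)]

omit [BorelSpace E] [SecondCountableTopology H] [MeasurableSpace H] [BorelSpace H] in
-- The form of a cylinder function is ‖A^{1/2}∇v‖², so closability says that gradients of a sequence
-- vₙ → 0, once Cauchy, tend to 0. The closure of the graph is therefore again a graph.
theorem eq_zero_of_mem_graph (hpos : ∀ z, (A z).IsPositive) (hA1 : CondA1 ι μ A) {w : Lp H 2 μ}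
    (h : (0, w) ∈ graph ι μ A) : w = 0 := by
  obtain ⟨q, hq, hlim⟩ := mem_graph_iff.1 h
  choose v hv h1 h2 using hq
  have hq1 : Tendsto (fun n => (q n).1) atTop (𝓝 0) := (continuous_fst.tendsto _).comp hlim
  have hq2 : Tendsto (fun n => (q n).2) atTop (𝓝 w) := (continuous_snd.tendsto _).comp hlim
  have hform (n : ℕ) : preForm ι μ A (v n) (v n) = ‖(q n).2‖ ^ 2 :=
    preForm_eq_norm_sq hpos (h2 n)
  have h3 := hA1.closable v hv ?_ ?_
  · have h4 : Tendsto (fun n => ‖(q n).2‖ ^ 2) atTop (𝓝 (‖w‖ ^ 2)) := hq2.norm.pow 2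
    have h5 := tendsto_nhds_unique (h3.congr hform) h4
    simpa using h5.symm
  · rw [Lp.tendsto_Lp_iff_tendsto_eLpNorm'] at hq1
    refine hq1.congr fun n => eLpNorm_congr_ae ?_
    filter_upwards [h1 n, Lp.coeFn_zero ℝ 2 μ] with z e1 e2
    rw [Pi.sub_apply, e1, e2, Pi.zero_apply, sub_zero]
  · intro ε hε
    obtain ⟨N, hN⟩ := Metric.cauchySeq_iff.1 hq2.cauchySeq (√ε) (Real.sqrt_pos.2 hε)
    refine ⟨N, fun m hm n hn => ?_⟩
    have e : v m - v n = (1 : ℝ) • v m + (-1 : ℝ) • v n := by simp [sub_eq_add_neg]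
    have h4 : preForm ι μ A (v m - v n) (v m - v n) = ‖(q m).2 - (q n).2‖ ^ 2 := by
      refine preForm_eq_norm_sq hpos ?_
      filter_upwards [Lp.coeFn_sub (q m).2 (q n).2, h2 m, h2 n] with z e1 e2 e3
      rw [e, sqrtGrad_linComb (hv m) (hv n), e1, Pi.sub_apply, e2, e3]
      simp [sub_eq_add_neg]
    rw [h4]
    have h5 := hN m hm n hn
    rw [dist_eq_norm] at h5
    exact (Real.lt_sqrt (norm_nonneg _)).1 h5

theorem IsDiffusion.memF_of_mem [IsFiniteMeasure μ] (hA : IsDiffusion ι μ A) {u : Lp ℝ 2 μ}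
    {w : Lp H 2 μ} (h : (u, w) ∈ graph ι μ A) : MemF ι μ A u :=
  ⟨w, hA.isSqrtGrad_iff.2 h⟩

theorem IsDiffusion.mem_graph_D [IsFiniteMeasure μ] (hA : IsDiffusion ι μ A) {u : Lp ℝ 2 μ}
    (h : MemF ι μ A u) : (u, D ι μ A u) ∈ graph ι μ A := by
  rw [D, dif_pos h]
  exact hA.isSqrtGrad_iff.1 h.choose_spec

theorem IsDiffusion.D_eq [IsFiniteMeasure μ] (hA : IsDiffusion ι μ A) {u : Lp ℝ 2 μ}
    {w : Lp H 2 μ} (h : (u, w) ∈ graph ι μ A) : D ι μ A u = w := by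
  have h1 := (graph ι μ A).sub_mem (hA.mem_graph_D (hA.memF_of_mem h)) h
  rw [Prod.mk_sub_mk, sub_self] at h1
  exact sub_eq_zero.1 (eq_zero_of_mem_graph hA.pos hA.condA1 h1)

variable [IsFiniteMeasure μ]

omit [BorelSpace E] [SecondCountableTopology H] [MeasurableSpace H] [BorelSpace H] in
/-- The chain rule. -/
theorem mem_graph_compN {κ : Type*} [Fintype κ] {Φ : (κ → ℝ) → ℝ} (hΦ : Smooth1 Φ)
    {u : κ → Lp ℝ 2 μ} {w : κ → Lp H 2 μ} (h : ∀ i, (u i, w i) ∈ graph ι μ A) :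
    (compN Φ u, ∑ i, mulN (pd Φ i) u (w i)) ∈ graph ι μ A := by
  choose q hq hlim using fun i => mem_graph_iff.1 (h i)
  have hu : Tendsto (fun n i => (q i n).1) atTop (𝓝 u) :=
    tendsto_pi_nhds.2 fun i => (continuous_fst.tendsto _).comp (hlim i)
  have hw (i : κ) : Tendsto (fun n => (q i n).2) atTop (𝓝 (w i)) :=
    (continuous_snd.tendsto _).comp (hlim i)
  refine mem_graph_iff.2 ⟨fun n => (compN Φ fun i => (q i n).1,
    ∑ i, mulN (pd Φ i) (fun i => (q i n).1) (q i n).2), fun n => ?_, Tendsto.prodMk_nhds ?_ ?_⟩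
  · choose v hv h1 h2 using hq
    refine ⟨_, IsCyl.comp hΦ.smooth fun i => hv i n, ?_, ?_⟩
    · filter_upwards [hΦ.lc.coeFn_compN fun i => (q i n).1, ae_all_iff.2 fun i => h1 i n]
        with z e1 e2
      rw [e1]
      simp only [e2]
    · filter_upwards [Lp.coeFn_finsetSum Finset.univ
          fun i => mulN (pd Φ i) (fun i => (q i n).1) (q i n).2,
        ae_all_iff.2 fun i => (hΦ.bc_pd i).coeFn_mulN (fun i => (q i n).1) (q i n).2,
        ae_all_iff.2 fun i => h1 i n, ae_all_iff.2 fun i => h2 i n] with z e1 e2 e3 e4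
      rw [e1, Finset.sum_apply, sqrtGrad, IsCyl.hGrad_comp ι hΦ.smooth fun i => hv i n, map_sum]
      refine Finset.sum_congr rfl fun i _ => ?_
      rw [e2, map_smul, e4]
      simp only [e3]
      rfl
  · exact (hΦ.lc.continuous_compN.tendsto u).comp hu
  · refine tendsto_finsetSum _ fun i _ => ?_
    exact (hΦ.bc_pd i).tendsto_mulN (by norm_num) hu (hw i)

end Graph

/-! ### One-variable functions and cut-offs. -/

section OneVariable

/-- A function of one variable as a function of one coordinate. -/
def lift1 (θ : ℝ → ℝ) (x : Unit → ℝ) : ℝ := θ (x ())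

theorem pd_lift1 {θ : ℝ → ℝ} (h : Differentiable ℝ θ) (x : Unit → ℝ) :
    pd (lift1 θ) () x = deriv θ (x ()) := by
  have h1 : HasFDerivAt (lift1 θ)
      ((fderiv ℝ θ (x ())).comp (ContinuousLinearMap.proj (R := ℝ) (φ := fun _ : Unit => ℝ) ())) x :=
    (h (x ())).hasFDerivAt.comp x (ContinuousLinearMap.proj (R := ℝ)
      (φ := fun _ : Unit => ℝ) ()).hasFDerivAt
  rw [pd, h1.fderiv]
  simp

theorem smooth1_lift1 {θ : ℝ → ℝ} (h : ContDiff ℝ ∞ θ) {C : ℝ} (hC : ∀ x, |deriv θ x| ≤ C) :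
    Smooth1 (lift1 θ) where
  smooth := h.comp (contDiff_apply (𝕜 := ℝ) (E := ℝ) ())
  bdd i := ⟨C, fun x => by rw [pd_lift1 (h.differentiable (by simp))]; exact hC _⟩

theorem pd_lift1_eq {θ : ℝ → ℝ} (h : Differentiable ℝ θ) :
    pd (lift1 θ) () = lift1 (deriv θ) := funext fun x => pd_lift1 h x

theorem smooth2_lift1 {θ : ℝ → ℝ} (h : ContDiff ℝ ∞ θ) {C : ℝ} (hC : ∀ x, |deriv θ x| ≤ C)
    {C' : ℝ} (hC' : ∀ x, |deriv (deriv θ) x| ≤ C') : Smooth2 (lift1 θ) where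
  toSmooth1 := smooth1_lift1 h hC
  bdd2 i j := ⟨C', fun x => by
    have h2 : ContDiff ℝ ∞ (deriv θ) := (contDiff_infty_iff_deriv.1 h).2
    rw [pd_lift1_eq (h.differentiable (by simp)), pd_lift1 (h2.differentiable (by simp))]
    exact hC' _⟩

/-- A smooth function with bounded derivative agreeing with a given one near `[-K, K]`. -/
theorem exists_cutoff {θ : ℝ → ℝ} (h : ContDiff ℝ ∞ θ) (K : ℝ) : ∃ χ : ℝ → ℝ,
    ContDiff ℝ ∞ χ ∧ (∃ C, ∀ x, |deriv χ x| ≤ C) ∧ (∃ C, ∀ x, |χ x| ≤ C) ∧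
      ∀ x, |x| ≤ K → χ x = θ x ∧ deriv χ x = deriv θ x := by
  let β : ContDiffBump (0 : ℝ) := ⟨|K| + 1, |K| + 2, by positivity, by linarith⟩
  have hs : ContDiff ℝ ∞ fun x => β x * θ x := β.contDiff.mul h
  have hcs : HasCompactSupport fun x => β x * θ x := β.hasCompactSupport.mul_right
  have hd : HasCompactSupport (deriv fun x => β x * θ x) := hcs.deriv
  have hdc : Continuous (deriv fun x => β x * θ x) := hs.continuous_deriv (by simp)
  refine ⟨fun x => β x * θ x, hs, ?_, ?_, fun x hx => ?_⟩
  · exact hdc.bounded_above_of_compact_support hd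
  · exact hs.continuous.bounded_above_of_compact_support hcs
  · have hev : (fun x => β x * θ x) =ᶠ[𝓝 x] θ := by
      have hopen : Metric.ball (0 : ℝ) (|K| + 1) ∈ 𝓝 x := by
        refine Metric.isOpen_ball.mem_nhds ?_
        rw [mem_ball_zero_iff, Real.norm_eq_abs]
        linarith [le_abs_self K]
      filter_upwards [hopen] with y hy
      rw [β.one_of_mem_closedBall (Metric.ball_subset_closedBall hy), one_mul]
    exact ⟨hev.eq_of_nhds, hev.deriv_eq⟩

end OneVariable

/-! ### Chain and product rules for bounded elements of the form domain. -/

section Products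

variable {E H : Type*} [NormedAddCommGroup E] [NormedSpace ℝ E]
  [MeasurableSpace E]
  [NormedAddCommGroup H] [InnerProductSpace ℝ H] [CompleteSpace H]
  {ι : H →L[ℝ] E} {μ : Measure E} {A : E → H →L[ℝ] H} [IsFiniteMeasure μ]

/-- The chain rule for a bounded function. -/
theorem exists_mem_graph_comp {θ : ℝ → ℝ} (hθ : ContDiff ℝ ∞ θ) {u : Lp ℝ 2 μ} {w : Lp H 2 μ}
    (h : (u, w) ∈ graph ι μ A) {K : ℝ} (hK : BddBy K u) :
    ∃ p ∈ graph ι μ A, p.1 =ᵐ[μ] (fun z => θ (u z)) ∧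
      p.2 =ᵐ[μ] fun z => deriv θ (u z) • w z := by
  -- The derivative of θ may be unbounded; as |u| ≤ K, only the values of θ and its derivative on
  -- [-K, K] matter.
  obtain ⟨χ, hχ, ⟨C, hC⟩, -, heq⟩ := exists_cutoff hθ K
  have hs := smooth1_lift1 hχ hC
  refine ⟨_, mem_graph_compN hs (u := fun _ => u) (w := fun _ => w) fun _ => h, ?_, ?_⟩
  · filter_upwards [hs.lc.coeFn_compN fun _ => u, hK] with z h1 h2
    rw [h1, lift1, (heq _ h2).1]
  · simp only [Finset.univ_unique, Finset.sum_singleton]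
    filter_upwards [(hs.bc_pd ()).coeFn_mulN (fun _ => u) w, hK] with z h1 h2
    rw [show (default : Unit) = () from rfl, h1, pd_lift1 (hχ.differentiable (by simp)),
      (heq _ h2).2]

/-- The product rule for bounded functions. -/
theorem exists_mem_graph_mul {u v : Lp ℝ 2 μ} {w x : Lp H 2 μ}
    (hu : (u, w) ∈ graph ι μ A) (hv : (v, x) ∈ graph ι μ A) {K K' : ℝ} (hK : BddBy K u)
    (hK' : BddBy K' v) :
    ∃ p ∈ graph ι μ A, p.1 =ᵐ[μ] (fun z => u z * v z) ∧
      p.2 =ᵐ[μ] fun z => u z • x z + v z • w z := by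
  have hsq : ContDiff ℝ ∞ fun x : ℝ => x ^ 2 := by fun_prop
  have hd (y : ℝ) : deriv (fun x : ℝ => x ^ 2) y = 2 * y := by simp
  have h1 : BddBy (K + K') (u + v) := by
    filter_upwards [hK, hK', Lp.coeFn_add u v] with z e1 e2 e3
    rw [e3]
    exact (abs_add_le _ _).trans (add_le_add e1 e2)
  have h2 : BddBy (K + K') (u - v) := by
    filter_upwards [hK, hK', Lp.coeFn_sub u v] with z e1 e2 e3
    rw [e3]
    exact (abs_sub _ _).trans (add_le_add e1 e2)
  obtain ⟨p, hp, hp1, hp2⟩ := exists_mem_graph_comp hsq ((graph ι μ A).add_mem hu hv) h1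
  obtain ⟨q, hq, hq1, hq2⟩ := exists_mem_graph_comp hsq ((graph ι μ A).sub_mem hu hv) h2
  -- Polarisation: 4uv = (u + v)² - (u - v)², so the chain rule for the square suffices.
  refine ⟨(4⁻¹ : ℝ) • (p - q), (graph ι μ A).smul_mem _ ((graph ι μ A).sub_mem hp hq), ?_, ?_⟩
  · filter_upwards [hp1, hq1, Lp.coeFn_smul (4⁻¹ : ℝ) (p - q).1, Lp.coeFn_sub p.1 q.1,
      Lp.coeFn_add u v, Lp.coeFn_sub u v] with z e1 e2 e3 e4 e5 e6
    rw [Prod.smul_fst, e3, Pi.smul_apply, Prod.fst_sub, e4, Pi.sub_apply, e1, e2, e5, e6]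
    simp only [Pi.add_apply, Pi.sub_apply, smul_eq_mul]
    ring
  · filter_upwards [hp2, hq2, Lp.coeFn_smul (4⁻¹ : ℝ) (p - q).2, Lp.coeFn_sub p.2 q.2,
      Lp.coeFn_add u v, Lp.coeFn_sub u v, Lp.coeFn_add w x, Lp.coeFn_sub w x]
      with z e1 e2 e3 e4 e5 e6 e7 e8
    rw [Prod.smul_snd, e3, Pi.smul_apply, Prod.snd_sub, e4, Pi.sub_apply, e1, e2, hd, hd, e5, e6,
      e7, e8]
    simp only [Pi.add_apply, Pi.sub_apply]
    module

end Products

end LinearEq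
end

noncomputable section
namespace LinearEq

/-! ### Smooth approximations of the modulus and of the sign. -/

section SmoothModulus

/-- The smooth convex function `√(x² + δ)`, an approximation of `|x|`. -/
def smoothAbs (δ x : ℝ) : ℝ := √(x ^ 2 + δ)

/-- The derivative of `smoothAbs`, an approximation of the sign. -/
def smoothSign (δ x : ℝ) : ℝ := x / √(x ^ 2 + δ)

variable {δ : ℝ} (hδ : 0 < δ)
include hδ

theorem smoothAbs_pos (x : ℝ) : 0 < smoothAbs δ x := Real.sqrt_pos.2 (by positivity)

theorem contDiff_smoothAbs : ContDiff ℝ ∞ (smoothAbs δ) :=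
  ContDiff.sqrt (by fun_prop) fun x => (by positivity : (0 : ℝ) < x ^ 2 + δ).ne'

theorem contDiff_smoothSign : ContDiff ℝ ∞ (smoothSign δ) :=
  contDiff_id.div (contDiff_smoothAbs hδ) fun x => (smoothAbs_pos hδ x).ne'

theorem hasDerivAt_smoothAbs (x : ℝ) : HasDerivAt (smoothAbs δ) (smoothSign δ x) x := by
  have h1 : HasDerivAt (fun x : ℝ => x ^ 2 + δ) (2 * x) x := by
    simpa using (hasDerivAt_pow 2 x).add_const δ
  have h2 := h1.sqrt (by positivity)
  refine h2.congr_deriv ?_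
  rw [mul_div_mul_left _ _ (by norm_num)]
  rfl

theorem deriv_smoothAbs : deriv (smoothAbs δ) = smoothSign δ :=
  funext fun x => (hasDerivAt_smoothAbs hδ x).deriv

theorem sq_smoothAbs (x : ℝ) : smoothAbs δ x ^ 2 = x ^ 2 + δ :=
  Real.sq_sqrt (by positivity)

theorem hasDerivAt_smoothSign (x : ℝ) :
    HasDerivAt (smoothSign δ) (δ / smoothAbs δ x ^ 3) x := by
  have hp := smoothAbs_pos hδ x
  have h := (hasDerivAt_id x).div (hasDerivAt_smoothAbs hδ x) hp.ne'
  refine (h.congr_deriv ?_)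
  have h1 : smoothSign δ x = x / smoothAbs δ x := rfl
  have h2 := sq_smoothAbs hδ x
  rw [h1, id_eq]
  field_simp
  linarith

theorem deriv_smoothSign (x : ℝ) : deriv (smoothSign δ) x = δ / smoothAbs δ x ^ 3 :=
  (hasDerivAt_smoothSign hδ x).deriv

theorem abs_le_smoothAbs (x : ℝ) : |x| ≤ smoothAbs δ x :=
  Real.abs_le_sqrt (by linarith)

theorem sqrt_le_smoothAbs (x : ℝ) : √δ ≤ smoothAbs δ x :=
  Real.sqrt_le_sqrt (by nlinarith [sq_nonneg x])

theorem smoothAbs_le (x : ℝ) : smoothAbs δ x ≤ |x| + √δ := by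
  refine Real.sqrt_le_iff.2 ⟨by positivity, ?_⟩
  have h1 := Real.sq_sqrt hδ.le
  have h2 : 0 ≤ |x| * √δ := by positivity
  nlinarith [sq_abs x]

theorem abs_smoothSign_le (x : ℝ) : |smoothSign δ x| ≤ 1 := by
  have hp := smoothAbs_pos hδ x
  change |x / smoothAbs δ x| ≤ 1
  rw [abs_div, abs_of_pos hp]
  exact div_le_one_of_le₀ (abs_le_smoothAbs hδ x) hp.le

theorem le_mul_smoothSign (x : ℝ) : |x| - √δ ≤ x * smoothSign δ x := by
  have hp := smoothAbs_pos hδ x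
  have h1 : x * smoothSign δ x = smoothAbs δ x - δ / smoothAbs δ x := by
    change x * (x / smoothAbs δ x) = _
    have := sq_smoothAbs hδ x
    field_simp
    linarith
  have h2 : δ / smoothAbs δ x ≤ √δ := by
    rw [div_le_iff₀ hp]
    calc δ = √δ * √δ := (Real.mul_self_sqrt hδ.le).symm
      _ ≤ √δ * smoothAbs δ x :=
        mul_le_mul_of_nonneg_left (sqrt_le_smoothAbs hδ x) (Real.sqrt_nonneg _)
  linarith [abs_le_smoothAbs hδ x]

theorem deriv_smoothSign_nonneg (x : ℝ) : 0 ≤ deriv (smoothSign δ) x := by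
  rw [deriv_smoothSign hδ]
  have := smoothAbs_pos hδ x
  positivity

theorem abs_deriv_smoothSign_le (x : ℝ) : |deriv (smoothSign δ) x| ≤ δ / √δ ^ 3 := by
  rw [abs_of_nonneg (deriv_smoothSign_nonneg hδ x), deriv_smoothSign hδ]
  have h1 : 0 < √δ := Real.sqrt_pos.2 hδ
  gcongr
  exact sqrt_le_smoothAbs hδ x

theorem abs_deriv_smoothAbs_le (x : ℝ) : |deriv (smoothAbs δ) x| ≤ 1 := by
  rw [deriv_smoothAbs hδ]; exact abs_smoothSign_le hδ x

theorem smooth2_smoothAbs : Smooth2 (lift1 (smoothAbs δ)) :=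
  smooth2_lift1 (contDiff_smoothAbs hδ) (abs_deriv_smoothAbs_le hδ)
    (C' := δ / √δ ^ 3) fun x => by rw [deriv_smoothAbs hδ]; exact abs_deriv_smoothSign_le hδ x

theorem smooth1_smoothSign : Smooth1 (lift1 (smoothSign δ)) :=
  smooth1_lift1 (contDiff_smoothSign hδ) (abs_deriv_smoothSign_le hδ)

theorem pd_smoothAbs : pd (lift1 (smoothAbs δ)) () = lift1 (smoothSign δ) := by
  rw [pd_lift1_eq ((contDiff_smoothAbs hδ).differentiable (by simp)), deriv_smoothAbs hδ]

theorem bc_smoothSign : BC (lift1 (smoothSign δ)) :=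
  pd_smoothAbs hδ ▸ (smooth2_smoothAbs hδ).bc_pd ()

end SmoothModulus

/-! ### Integrals of L² functions over a finite measure. -/

section Integrals

variable {Ω : Type*} [MeasurableSpace Ω] {μ : Measure Ω} [IsFiniteMeasure μ]

theorem integrable_Lp_two (u : Lp ℝ 2 μ) : Integrable u μ :=
  (Lp.memLp u).integrable (by norm_num)

theorem continuous_integral_Lp_two : Continuous fun u : Lp ℝ 2 μ => ∫ z, u z ∂μ := by
  have h : (fun u : Lp ℝ 2 μ => ∫ z, u z ∂μ) = fun u => ∫ z, (toL1L u : Lp ℝ 1 μ) z ∂μ := by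
    ext u
    exact (integral_congr_ae (coeFn_toL1 u)).symm
  rw [h]
  exact continuous_integral.comp toL1L.continuous

omit [IsFiniteMeasure μ] in
theorem inner_eq_integral_mul (u v : Lp ℝ 2 μ) : inner ℝ u v = ∫ z, u z * v z ∂μ := by
  rw [L2.inner_def]
  refine integral_congr_ae (.of_forall fun z => ?_)
  simp [mul_comm]

theorem norm_toL1 (u : Lp ℝ 2 μ) : ‖toL1 u‖ = ∫ z, |u z| ∂μ := by
  rw [L1.norm_eq_integral_norm]
  refine integral_congr_ae ?_
  filter_upwards [coeFn_toL1 u] with z hz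
  rw [hz, Real.norm_eq_abs]

end Integrals

/-! ### The form with drift and its accretivity in L¹. -/

section Form

variable {E H : Type*} [NormedAddCommGroup E] [NormedSpace ℝ E]
  [MeasurableSpace E]
  [NormedAddCommGroup H] [InnerProductSpace ℝ H] [CompleteSpace H]
  {ι : H →L[ℝ] E} {μ : Measure E} {A : E → H →L[ℝ] H}

/-- The form `∫ ⟪W, V⟫ + ∫ ⟪β, W⟫ v`, where `W`, `V` are the gradients. -/
def bform (β W : Lp H 2 μ) (v : Lp ℝ 2 μ) (V : Lp H 2 μ) : ℝ :=
  inner ℝ W V + ∫ z, inner ℝ (β z) (W z) * v z ∂μ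

/-- Bounded elements of the form domain, together with their gradients. -/
structure IsBddTest (ι : H →L[ℝ] E) (μ : Measure E) (A : E → H →L[ℝ] H) (v : Lp ℝ 2 μ)
    (V : Lp H 2 μ) : Prop where
  mem : (v, V) ∈ graph ι μ A
  bdd : ∃ K, BddBy K v

omit [CompleteSpace H] in
theorem exists_smul_bdd (β : Lp H 2 μ) {v : Lp ℝ 2 μ} (hv : ∃ K, BddBy K v) :
    ∃ k : Lp H 2 μ, k =ᵐ[μ] fun z => v z • β z := by
  obtain ⟨K, hK⟩ := hv
  have h : MemLp (fun z => v z • β z) 2 μ := by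
    refine (Lp.memLp β).of_le_mul (c := K)
      ((Lp.aestronglyMeasurable v).smul (Lp.aestronglyMeasurable β)) ?_
    filter_upwards [hK] with z hz
    rw [norm_smul]
    exact mul_le_mul_of_nonneg_right hz (norm_nonneg _)
  exact ⟨h.toLp _, h.coeFn_toLp⟩

omit [CompleteSpace H] in
-- For bounded v the field vβ lies in L²(μ; H), which makes the form a bounded linear functional of
-- the gradient W. Limits, sums and time integrals pass through it for this reason.
theorem bform_eq_inner {β : Lp H 2 μ} {v : Lp ℝ 2 μ} {k : Lp H 2 μ}
    (hk : k =ᵐ[μ] fun z => v z • β z) (W V : Lp H 2 μ) : bform β W v V = inner ℝ (V + k) W := by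
  rw [bform, inner_add_left, real_inner_comm]
  congr 1
  rw [L2.inner_def]
  refine integral_congr_ae ?_
  filter_upwards [hk] with z hz
  rw [hz, real_inner_smul_left, mul_comm]

/-- The constant `α` bounds the divergence of `A b` from below. -/
def IsLowerBound (ι : H →L[ℝ] E) (A : E → H →L[ℝ] H) (β : Lp H 2 μ) (α : ℝ) : Prop :=
  ∀ δ > 0, ∀ (h : Lp ℝ 2 μ) (W : Lp H 2 μ), (h, W) ∈ graph ι μ A →
    0 ≤ inner ℝ (mulN (lift1 (smoothSign δ)) (fun _ => h) β) W +
      α * ∫ z, (compN (lift1 (smoothAbs δ)) (fun _ => h) : Lp ℝ 2 μ) z ∂μ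

variable [IsFiniteMeasure μ]

/-- (A2) concerns squares, so it is applied to the square root of √(v² + δ), still a finitely based
function because √(v² + δ) is strictly positive. The gradient of its square is the smoothed sign of
v times ∇v. Both sides are continuous along the graph, so the bound extends from cylinder functions
to F. -/
theorem exists_isLowerBound {b : E → H} (hpos : ∀ z, (A z).IsPositive) (h2 : CondA2 ι μ A b) :
    ∃ α, 0 ≤ α ∧ IsLowerBound ι A (h2.memLp.toLp _) α := by
  obtain ⟨α, hα, hlow⟩ := h2.lower
  refine ⟨α, hα, fun δ hδ => ?_⟩
  set β : Lp H 2 μ := h2.memLp.toLp _ with hβ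
  have hs2 := smooth2_smoothAbs hδ
  have hbc := bc_smoothSign hδ
  intro h W hmem
  obtain ⟨q, hq, hlim⟩ := mem_graph_iff.1 hmem
  have hq1 : Tendsto (fun n => (q n).1) atTop (𝓝 h) := (continuous_fst.tendsto _).comp hlim
  have hq2 : Tendsto (fun n => (q n).2) atTop (𝓝 W) := (continuous_snd.tendsto _).comp hlim
  have hq3 : Tendsto (fun n => fun _ : Unit => (q n).1) atTop (𝓝 fun _ => h) :=
    tendsto_pi_nhds.2 fun _ => hq1
  have l1 : Tendsto (fun n => inner ℝ (mulN (lift1 (smoothSign δ)) (fun _ => (q n).1) β) (q n).2)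
      atTop (𝓝 (inner ℝ (mulN (lift1 (smoothSign δ)) (fun _ => h) β) W)) :=
    (hbc.tendsto_mulN (by norm_num) hq3 tendsto_const_nhds).inner hq2
  have l2 := ((continuous_integral_Lp_two.comp hs2.lc.continuous_compN).tendsto _).comp hq3
  refine ge_of_tendsto' (l1.add (l2.const_mul α)) fun n => ?_
  obtain ⟨v, hv, e1, e2⟩ := hq n
  let r : ℝ → ℝ := fun x => √(smoothAbs δ x)
  have hr : ContDiff ℝ ∞ (lift1 r) :=
    ((contDiff_smoothAbs hδ).sqrt fun x => (smoothAbs_pos hδ x).ne').comp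
      (contDiff_apply (𝕜 := ℝ) (E := ℝ) ())
  have hcyl : IsCyl fun z => r (v z) := IsCyl.comp hr (v := fun _ => v) fun _ => hv
  have hsq : (fun z => r (v z) ^ 2) = fun z => lift1 (smoothAbs δ) fun _ => v z := by
    ext z
    exact Real.sq_sqrt (smoothAbs_pos hδ _).le
  have key := hlow _ hcyl fun z => Real.sqrt_nonneg _
  rw [hsq] at key
  have i1 : ∫ z, inner ℝ (A z (b z)) (hGrad ι (fun z => lift1 (smoothAbs δ) fun _ => v z) z) ∂μ
      = inner ℝ (mulN (lift1 (smoothSign δ)) (fun _ => (q n).1) β) (q n).2 := by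
    rw [L2.inner_def]
    refine integral_congr_ae ?_
    filter_upwards [hbc.coeFn_mulN (fun _ => (q n).1) β, e1, e2, h2.memLp.coeFn_toLp]
      with z f1 f2 f3 f4
    rw [f1, f3, hβ, f4, IsCyl.hGrad_comp ι hs2.smooth fun _ => hv]
    simp only [Finset.univ_unique, Finset.sum_singleton]
    rw [show (default : Unit) = () from rfl, pd_smoothAbs hδ, real_inner_smul_left,
      real_inner_smul_right, sqrtGrad, inner_posSqrt (hpos z)]
    simp only [lift1, f2]
  have i2 : ∫ z, lift1 (smoothAbs δ) (fun _ => v z) ∂μ =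
      ∫ z, (compN (lift1 (smoothAbs δ)) (fun _ => (q n).1) : Lp ℝ 2 μ) z ∂μ := by
    refine integral_congr_ae ?_
    filter_upwards [hs2.lc.coeFn_compN fun _ => (q n).1, e1] with z f1 f2
    rw [f1]
    simp only [lift1, f2]
  rw [i1, i2] at key
  simp only [Function.comp_apply]
  linarith

variable {β : Lp H 2 μ} {α : ℝ}

/-- The smoothed sign of an element of the form domain is a bounded test function. -/
theorem isBddTest_smoothSign {δ : ℝ} (hδ : 0 < δ) {h : Lp ℝ 2 μ} {W : Lp H 2 μ}
    (hmem : (h, W) ∈ graph ι μ A) :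
    IsBddTest ι μ A (compN (lift1 (smoothSign δ)) fun _ => h)
      (mulN (pd (lift1 (smoothSign δ)) ()) (fun _ => h) W) where
  mem := by
    have := mem_graph_compN (smooth1_smoothSign hδ) (u := fun _ => h) (w := fun _ => W)
      fun _ => hmem
    simpa using this
  bdd := by
    refine ⟨1, ?_⟩
    filter_upwards [(smooth1_smoothSign hδ).lc.coeFn_compN fun _ => h] with z hz
    rw [hz]
    exact abs_smoothSign_le hδ _

/-- The smoothed sign is nondecreasing, so the symmetric part, the integral of its derivative at h
times |W|², is nonnegative and may be dropped. -/
theorem IsLowerBound.le_bform (hlow : IsLowerBound ι A β α) {δ : ℝ} (hδ : 0 < δ) {h : Lp ℝ 2 μ}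
    {W : Lp H 2 μ} (hmem : (h, W) ∈ graph ι μ A) :
    -(α * ∫ z, (compN (lift1 (smoothAbs δ)) (fun _ => h) : Lp ℝ 2 μ) z ∂μ) ≤
      bform β W (compN (lift1 (smoothSign δ)) fun _ => h)
        (mulN (pd (lift1 (smoothSign δ)) ()) (fun _ => h) W) := by
  have hs1 := smooth1_smoothSign hδ
  have h1 := hlow δ hδ h W hmem
  have hk : mulN (lift1 (smoothSign δ)) (fun _ => h) β =ᵐ[μ]
      fun z => (compN (lift1 (smoothSign δ)) (fun _ => h) : Lp ℝ 2 μ) z • β z := by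
    filter_upwards [(bc_smoothSign hδ).coeFn_mulN (fun _ => h) β,
      hs1.lc.coeFn_compN fun _ => h] with z e1 e2
    rw [e1, e2]
  rw [bform_eq_inner hk, inner_add_left]
  have h2 : 0 ≤ inner ℝ (mulN (pd (lift1 (smoothSign δ)) ()) (fun _ => h) W) W := by
    rw [L2.inner_def]
    refine integral_nonneg_of_ae ?_
    filter_upwards [(hs1.bc_pd ()).coeFn_mulN (fun _ => h) W] with z hz
    rw [hz, real_inner_smul_left, pd_lift1 ((contDiff_smoothSign hδ).differentiable (by simp))]
    exact mul_nonneg (deriv_smoothSign_nonneg hδ _) real_inner_self_nonneg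
  linarith

theorem integral_smoothAbs_le {δ : ℝ} (hδ : 0 < δ) (h : Lp ℝ 2 μ) :
    ∫ z, (compN (lift1 (smoothAbs δ)) (fun _ => h) : Lp ℝ 2 μ) z ∂μ ≤
      ‖toL1 h‖ + √δ * μ.real univ := by
  rw [norm_toL1]
  have : ∫ z, (|h z| + √δ) ∂μ = ∫ z, |h z| ∂μ + √δ * μ.real univ := by
    rw [integral_add (integrable_Lp_two h).abs (integrable_const _)]
    simp [mul_comm]
  rw [← this]
  refine integral_mono_ae (integrable_Lp_two _)
    ((integrable_Lp_two h).abs.add (integrable_const _)) ?_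
  filter_upwards [(smooth2_smoothAbs hδ).lc.coeFn_compN fun _ => h] with z hz
  rw [hz]
  exact smoothAbs_le hδ _

theorem norm_toL1_le_integral_smoothAbs {δ : ℝ} (hδ : 0 < δ) (h : Lp ℝ 2 μ) :
    ‖toL1 h‖ ≤ ∫ z, (compN (lift1 (smoothAbs δ)) (fun _ => h) : Lp ℝ 2 μ) z ∂μ := by
  rw [norm_toL1]
  refine integral_mono_ae (integrable_Lp_two h).abs (integrable_Lp_two _) ?_
  filter_upwards [(smooth2_smoothAbs hδ).lc.coeFn_compN fun _ => h] with z hz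
  rw [hz]
  exact abs_le_smoothAbs hδ _

theorem le_of_forall_sqrt {a b c : ℝ} (hc : 0 ≤ c) (h : ∀ δ > 0, a ≤ b + √δ * c) : a ≤ b := by
  refine le_of_forall_pos_le_add fun ε hε => ?_
  have h1 := h ((ε / (c + 1)) ^ 2) (by positivity)
  rw [Real.sqrt_sq (by positivity)] at h1
  have h2 : ε / (c + 1) * c ≤ ε := by
    rw [div_mul_eq_mul_div, div_le_iff₀ (by linarith)]
    nlinarith
  linarith

/-- The `L¹` estimate for weak solutions of the resolvent equation. -/
theorem IsLowerBound.norm_toL1_le (hlow : IsLowerBound ι A β α) (hα : 0 ≤ α) {c : ℝ} (hc : 0 ≤ c)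
    {h : Lp ℝ 2 μ} {W : Lp H 2 μ} (hmem : (h, W) ∈ graph ι μ A) {k : Lp ℝ 1 μ}
    (heq : ∀ v V, IsBddTest ι μ A v V → bform β W v V + c * inner ℝ h v = ∫ z, k z * v z ∂μ) :
    (c - α) * ‖toL1 h‖ ≤ ‖k‖ := by
  refine le_of_forall_sqrt (c := (c + α) * μ.real univ)
    (mul_nonneg (by linarith) measureReal_nonneg) fun δ hδ => ?_
  -- Tested with the smoothed sign of h: the pairing with k is at most ‖k‖, the zero order term is
  -- at least c times the integral of |h| - √δ, and the form loses at most α times that of |h| + √δ.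
  have h1 := heq _ _ (isBddTest_smoothSign hδ hmem)
  have h2 := hlow.le_bform hδ hmem
  have h3 := mul_le_mul_of_nonneg_left (integral_smoothAbs_le hδ h) hα
  have hcoe := (smooth1_smoothSign hδ).lc.coeFn_compN (μ := μ) fun _ => h
  have h4 : ‖toL1 h‖ - √δ * μ.real univ ≤
      inner ℝ h (compN (lift1 (smoothSign δ)) fun _ => h) := by
    have : ∫ z, (|h z| - √δ) ∂μ = ‖toL1 h‖ - √δ * μ.real univ := by
      rw [norm_toL1, integral_sub (integrable_Lp_two h).abs (integrable_const _)]
      simp [mul_comm]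
    rw [← this, inner_eq_integral_mul]
    refine integral_mono_ae ((integrable_Lp_two h).abs.sub (integrable_const _))
      ((Lp.memLp h).integrable_mul (Lp.memLp _)) ?_
    filter_upwards [hcoe] with z hz
    rw [hz]
    exact le_mul_smoothSign hδ _
  have h5 : ∫ z, k z * (compN (lift1 (smoothSign δ)) (fun _ => h) : Lp ℝ 2 μ) z ∂μ ≤ ‖k‖ := by
    rw [L1.norm_eq_integral_norm]
    refine (le_abs_self _).trans ((Real.norm_eq_abs _).symm.le.trans
      ((norm_integral_le_integral_norm _).trans ?_))
    refine integral_mono_of_nonneg (.of_forall fun _ => norm_nonneg _)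
      (L1.integrable_coeFn k).norm ?_
    filter_upwards [hcoe] with z hz
    rw [hz, norm_mul]
    exact mul_le_of_le_one_right (norm_nonneg _) (abs_smoothSign_le hδ _)
  have h6 := mul_le_mul_of_nonneg_left h4 hc
  linarith

end Form

end LinearEq
end

noncomputable section
namespace LinearEq

/-! ### Truncation, bounded functions and the pairing of L¹ with them. -/

section Truncation

variable {Ω : Type*} [MeasurableSpace Ω] {μ : Measure Ω}

/-- Truncation at the levels `±K`. -/
def clip (K x : ℝ) : ℝ := max (-K) (min K x)

theorem abs_clip_le {K : ℝ} (hK : 0 ≤ K) (x : ℝ) : |clip K x| ≤ K := by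
  rw [abs_le]
  exact ⟨le_max_left _ _, max_le (by linarith) (min_le_left _ _)⟩

theorem clip_eq {K x : ℝ} (h : |x| ≤ K) : clip K x = x := by
  rw [abs_le] at h
  rw [clip, min_eq_right h.2, max_eq_right h.1]

theorem abs_clip_le_abs {K : ℝ} (hK : 0 ≤ K) (x : ℝ) : |clip K x| ≤ |x| := by
  rcases le_total |x| K with h | h
  · rw [clip_eq h]
  · exact (abs_clip_le hK x).trans h

theorem continuous_clip (K : ℝ) : Continuous (clip K) := by unfold clip; fun_prop

theorem bc_clip {K : ℝ} (hK : 0 ≤ K) : BC (lift1 (clip K)) where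
  cont := (continuous_clip K).comp (continuous_apply ())
  bdd := ⟨K, hK, fun _ => abs_clip_le hK _⟩

theorem lc_clip (K : ℝ) : LC (lift1 (clip K)) := by
  refine ⟨1, zero_le_one, fun x y => ?_⟩
  simp only [lift1, clip, Finset.univ_unique, Finset.sum_singleton, one_mul]
  have h1 := abs_max_sub_max_le_max (-K) (min K (x ())) (-K) (min K (y ()))
  have h2 := abs_min_sub_min_le_max K (x ()) K (y ())
  simp only [sub_self, abs_zero, abs_nonneg, sup_of_le_right] at h1 h2
  exact h1.trans h2

theorem tendsto_clip (x : ℝ) : Tendsto (fun n : ℕ => clip n x) atTop (𝓝 x) := by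
  obtain ⟨N, hN⟩ := exists_nat_ge |x|
  refine tendsto_const_nhds.congr' ?_
  filter_upwards [eventually_ge_atTop N] with n hn
  exact (clip_eq (hN.trans (by exact_mod_cast hn))).symm

theorem BddBy.mono {K K' : ℝ} {u : Lp ℝ 2 μ} (h : BddBy K u) (hK : K ≤ K') : BddBy K' u := by
  filter_upwards [h] with z hz using hz.trans hK

theorem BddBy.add {K K' : ℝ} {u v : Lp ℝ 2 μ} (hu : BddBy K u) (hv : BddBy K' v) :
    BddBy (K + K') (u + v) := by
  filter_upwards [hu, hv, Lp.coeFn_add u v] with z e1 e2 e3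
  rw [e3]
  exact (abs_add_le _ _).trans (add_le_add e1 e2)

theorem BddBy.smul {K : ℝ} {u : Lp ℝ 2 μ} (hu : BddBy K u) (c : ℝ) :
    BddBy (|c| * K) (c • u) := by
  filter_upwards [hu, Lp.coeFn_smul c u] with z e1 e3
  rw [e3, Pi.smul_apply, smul_eq_mul, abs_mul]
  exact mul_le_mul_of_nonneg_left e1 (abs_nonneg c)

theorem exists_bddBy_tendsto_L1 [IsFiniteMeasure μ] (f : Lp ℝ 1 μ) : ∃ k : ℕ → Lp ℝ 2 μ,
    (∀ n : ℕ, BddBy n (k n)) ∧ Tendsto (fun n => toL1 (k n)) atTop (𝓝 f) := by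
  have hm (n : ℕ) : MemLp (fun z => clip n (f z)) 2 μ :=
    MemLp.of_bound ((continuous_clip n).comp_aestronglyMeasurable (Lp.aestronglyMeasurable f)) n
      (.of_forall fun z => abs_clip_le n.cast_nonneg _)
  refine ⟨fun n => (hm n).toLp _, fun n => ?_, ?_⟩
  · filter_upwards [(hm n).coeFn_toLp] with z hz
    rw [hz]
    exact abs_clip_le n.cast_nonneg _
  · refine tendsto_Lp_of_dominated (by norm_num) (Lp.memLp f).norm (fun n => ?_) ?_
    · filter_upwards [coeFn_toL1 ((hm n).toLp _), (hm n).coeFn_toLp] with z h1 h2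
      rw [h1, h2]
      exact abs_clip_le_abs n.cast_nonneg _
    · filter_upwards [ae_all_iff.2 fun n => coeFn_toL1 ((hm n).toLp _),
        ae_all_iff.2 fun n => (hm n).coeFn_toLp] with z h1 h2
      simp only [h1, h2]
      exact tendsto_clip _

theorem denseRange_toL1 [IsFiniteMeasure μ] : DenseRange (toL1L : Lp ℝ 2 μ →L[ℝ] Lp ℝ 1 μ) := by
  intro f
  obtain ⟨k, -, hk⟩ := exists_bddBy_tendsto_L1 f
  exact mem_closure_of_tendsto hk (.of_forall fun n => ⟨k n, rfl⟩)

theorem exists_bddBy_tendsto [IsFiniteMeasure μ] (f : Lp ℝ 2 μ) : ∃ k : ℕ → Lp ℝ 2 μ,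
    (∀ n : ℕ, BddBy n (k n)) ∧ Tendsto k atTop (𝓝 f) := by
  refine ⟨fun n => compN (lift1 (clip n)) fun _ => f, fun n => ?_, ?_⟩
  · filter_upwards [(lc_clip n).coeFn_compN fun _ => f] with z hz
    rw [hz]
    exact abs_clip_le n.cast_nonneg _
  · refine tendsto_Lp_of_dominated (by norm_num) (Lp.memLp f).norm (fun n => ?_) ?_
    · filter_upwards [(lc_clip n).coeFn_compN fun _ => f] with z hz
      rw [hz]
      exact abs_clip_le_abs n.cast_nonneg _
    · filter_upwards [ae_all_iff.2 fun n : ℕ => (lc_clip n).coeFn_compN fun _ => f] with z hz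
      simp only [hz]
      exact tendsto_clip _

/-- These functions are the fixed points of truncation at ±K, a continuous map of L². -/
theorem isClosed_bddBy [IsFiniteMeasure μ] {K : ℝ} (hK : 0 ≤ K) :
    IsClosed {u : Lp ℝ 2 μ | BddBy K u} := by
  have h : {u : Lp ℝ 2 μ | BddBy K u} = {u | compN (lift1 (clip K)) (fun _ => u) = u} := by
    ext u
    constructor
    · intro hu
      refine Lp.ext ?_
      filter_upwards [hu, (lc_clip K).coeFn_compN fun _ => u] with z h1 h2
      rw [h2, lift1, clip_eq h1]
    · intro hu
      have hu' : compN (lift1 (clip K)) (fun _ => u) = u := hu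
      have h2 := (lc_clip K).coeFn_compN fun _ => u
      rw [hu'] at h2
      filter_upwards [h2] with z hz
      rw [hz]
      exact abs_clip_le hK _
  rw [h]
  exact isClosed_eq ((lc_clip K).continuous_compN.comp (by fun_prop)) continuous_id

/-- A closed convex set contains the averages of functions with values in it. -/
theorem BddBy.integral [IsFiniteMeasure μ] {K τ : ℝ} (hK : 0 ≤ K) (hτ : 0 < τ) {c : ℝ → Lp ℝ 2 μ}
    (hc : IntervalIntegrable c volume 0 τ) (h : ∀ s ∈ Ioc 0 τ, BddBy K (c s)) :
    BddBy (τ * K) (∫ s in (0 : ℝ)..τ, c s) := by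
  have hconv : Convex ℝ {u : Lp ℝ 2 μ | BddBy K u} := by
    intro u hu v hv a b ha hb hab
    have := (BddBy.smul hu a).add (BddBy.smul hv b)
    rwa [abs_of_nonneg ha, abs_of_nonneg hb, ← add_mul, hab, one_mul] at this
  rw [intervalIntegrable_iff_integrableOn_Ioc_of_le hτ.le] at hc
  have h1 : BddBy K (⨍ s in Ioc 0 τ, c s) :=
    hconv.set_average_mem (isClosed_bddBy hK) (by simp [hτ]) (by simp)
      ((ae_restrict_mem measurableSet_Ioc).mono h) hc
  have h2 : ∫ s in (0 : ℝ)..τ, c s = τ • ⨍ s in Ioc 0 τ, c s := by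
    rw [setAverage_eq, intervalIntegral.integral_of_le hτ.le, smul_smul]
    simp [hτ.le, hτ.ne']
  rw [h2]
  simpa [abs_of_pos hτ] using h1.smul τ

theorem mulN_clip {G : Type*} [NormedAddCommGroup G] [NormedSpace ℝ G] {p : ℝ≥0∞} {K : ℝ}
    (hK : 0 ≤ K) {v : Lp ℝ 2 μ} (hv : BddBy K v) (X : Lp G p μ) :
    mulN (lift1 (clip K)) (fun _ => v) X =ᵐ[μ] fun z => v z • X z := by
  filter_upwards [(bc_clip hK).coeFn_mulN (fun _ => v) X, hv] with z h1 h2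
  rw [h1, lift1, clip_eq h2]

/-- The pairing of `L¹` with bounded functions. -/
def pair (g : Lp ℝ 1 μ) (v : Lp ℝ 2 μ) : ℝ := ∫ z, g z * v z ∂μ

theorem integrable_pair (g : Lp ℝ 1 μ) {v : Lp ℝ 2 μ} (hv : ∃ K, BddBy K v) :
    Integrable (fun z => g z * v z) μ := by
  obtain ⟨K, hK⟩ := hv
  exact (L1.integrable_coeFn g).mul_bdd (c := K) (Lp.aestronglyMeasurable v) hK

theorem pair_add (g h : Lp ℝ 1 μ) {v : Lp ℝ 2 μ} (hv : ∃ K, BddBy K v) :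
    pair (g + h) v = pair g v + pair h v := by
  rw [pair, pair, pair, ← integral_add (integrable_pair g hv) (integrable_pair h hv)]
  refine integral_congr_ae ?_
  filter_upwards [Lp.coeFn_add g h] with z hz
  rw [hz, Pi.add_apply, add_mul]

theorem pair_smul (c : ℝ) (g : Lp ℝ 1 μ) (v : Lp ℝ 2 μ) : pair (c • g) v = c * pair g v := by
  rw [pair, pair, ← integral_const_mul]
  refine integral_congr_ae ?_
  filter_upwards [Lp.coeFn_smul c g] with z hz
  rw [hz, Pi.smul_apply, smul_eq_mul, mul_assoc]

theorem pair_sub (g h : Lp ℝ 1 μ) {v : Lp ℝ 2 μ} (hv : ∃ K, BddBy K v) :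
    pair (g - h) v = pair g v - pair h v := by
  rw [sub_eq_add_neg, pair_add _ _ hv, ← neg_one_smul ℝ h, pair_smul]
  ring

theorem pair_sum {κ : Type*} (s : Finset κ) (g : κ → Lp ℝ 1 μ) {v : Lp ℝ 2 μ}
    (hv : ∃ K, BddBy K v) : pair (∑ i ∈ s, g i) v = ∑ i ∈ s, pair (g i) v := by
  classical
  induction s using Finset.induction_on with
  | empty =>
    simp only [Finset.sum_empty, pair]
    rw [integral_eq_zero_of_ae]
    filter_upwards [Lp.coeFn_zero ℝ 1 μ] with z hz
    rw [hz]
    simp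
  | insert a s ha ih => rw [Finset.sum_insert ha, Finset.sum_insert ha, pair_add _ _ hv, ih]

theorem pair_toL1 [IsFiniteMeasure μ] (u v : Lp ℝ 2 μ) : pair (toL1 u) v = inner ℝ u v := by
  rw [pair, inner_eq_integral_mul]
  refine integral_congr_ae ?_
  filter_upwards [coeFn_toL1 u] with z hz
  rw [hz]

end Truncation

/-! ### The semigroup associated with the form, and its bound in L¹. -/

section Associated

variable {E H : Type*} [NormedAddCommGroup E] [NormedSpace ℝ E]
  [MeasurableSpace E]
  [NormedAddCommGroup H] [InnerProductSpace ℝ H] [CompleteSpace H]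
  {ι : H →L[ℝ] E} {μ : Measure E} {A : E → H →L[ℝ] H} [IsFiniteMeasure μ]

/-- The semigroup `P` is associated with the form defined by the gradient and the drift `β`. -/
structure IsAssociated (ι : H →L[ℝ] E) (A : E → H →L[ℝ] H) (β : Lp H 2 μ) (α T : ℝ)
    (P : ℝ → Lp ℝ 2 μ →L[ℝ] Lp ℝ 2 μ) : Prop where
  T_pos : 0 < T
  nonneg : 0 ≤ α
  lower : IsLowerBound ι A β α
  c0 : IsC0 P
  bdd : ∃ C, 0 ≤ C ∧ ∀ t ∈ Icc (0 : ℝ) T, ∀ (u : Lp ℝ 2 μ) (K : ℝ), 0 ≤ K → BddBy K u →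
    BddBy (C * K) (P t u)
  gen : ∀ (u g : Lp ℝ 2 μ) (K : ℝ), HasGen P u g → BddBy K u → ∃ U, (u, U) ∈ graph ι μ A ∧
    ∀ v V, IsBddTest ι μ A v V → bform β U v V = -inner ℝ g v

theorem bform_sub {β W W' : Lp H 2 μ} {v : Lp ℝ 2 μ} {V : Lp H 2 μ} (hv : ∃ K, BddBy K v) :
    bform β (W - W') v V = bform β W v V - bform β W' v V := by
  obtain ⟨k, hk⟩ := exists_smul_bdd β hv
  simp only [bform_eq_inner hk, inner_sub_right]

theorem bddBy_of_eLpNorm {u v : Lp ℝ 2 μ} {C K : ℝ} (hC : 0 ≤ C) (hK : 0 ≤ K)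
    (h : eLpNorm u ⊤ μ ≤ ENNReal.ofReal C * eLpNorm v ⊤ μ) (hv : BddBy K v) :
    BddBy (C * K) u := by
  have h1 : eLpNorm v ⊤ μ ≤ ENNReal.ofReal K := by
    rw [eLpNorm_exponent_top]
    refine eLpNormEssSup_le_of_ae_bound ?_
    exact hv
  have h2 : eLpNorm u ⊤ μ ≤ ENNReal.ofReal (C * K) := by
    rw [ENNReal.ofReal_mul hC]
    exact h.trans (by gcongr)
  rw [eLpNorm_exponent_top] at h2
  filter_upwards [enorm_ae_le_eLpNormEssSup (u : E → ℝ) μ] with z hz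
  have h3 := hz.trans h2
  rwa [← ofReal_norm, ENNReal.ofReal_le_ofReal_iff (by positivity), Real.norm_eq_abs] at h3

/-- (A3) relates generator and form only for bounded test functions in the domain of L. For a
bounded v in F the approximating wₙ have a common bound M, so wₙβ → vβ in L²(μ; H) and the drift
term converges along with the gradients. -/
theorem isAssociated_of_cond [BorelSpace E] [SecondCountableTopology H] [MeasurableSpace H]
    [BorelSpace H] {b : E → H} {T : ℝ} (hT : 0 < T) {P : ℝ → Lp ℝ 2 μ →L[ℝ] Lp ℝ 2 μ}
    (hA : IsDiffusion ι μ A) (h2 : CondA2 ι μ A b) (h3 : CondA3 ι μ A b T P) :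
    ∃ α, IsAssociated ι A (h2.memLp.toLp _) α T P := by
  obtain ⟨α, hα, hlow⟩ := exists_isLowerBound hA.pos h2
  refine ⟨α, hT, hα, hlow, ⟨h3.zero, h3.add, h3.strongCont⟩, ?_, fun u g K hg hK => ?_⟩
  · obtain ⟨C, hC, h⟩ := h3.bdd
    exact ⟨C, hC.le, fun t ht u K hK hu => bddBy_of_eLpNorm hC.le hK (h t ht u) hu⟩
  · set β : Lp H 2 μ := h2.memLp.toLp _ with hβ
    have hu := hA.mem_graph_D (h3.dom_le u g K hg hK)
    refine ⟨_, hu, fun v V hv => ?_⟩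
    obtain ⟨K₀, hK₀⟩ := hv.bdd
    obtain ⟨w, C, hw, hlim⟩ := h3.dense v K₀ (hA.memF_of_mem hv.mem) hK₀
    set M := max (max C K₀) 0 with hM
    have hM0 : 0 ≤ M := le_max_right _ _
    have hwM (n : ℕ) : BddBy M (w n) :=
      (hw n).1.mono ((le_max_left _ _).trans (le_max_left _ _))
    have hvM : BddBy M v := hK₀.mono ((le_max_right _ _).trans (le_max_left _ _))
    have hwg (n : ℕ) : (w n, D ι μ A (w n)) ∈ graph ι μ A := by
      obtain ⟨g', hg'⟩ := (hw n).2
      exact hA.mem_graph_D (h3.dom_le _ _ _ hg' (hw n).1)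
    have hE (n : ℕ) : formA ι μ A (w n - v) (w n - v) = ‖D ι μ A (w n) - V‖ ^ 2 := by
      have h4 : D ι μ A (w n - v) = D ι μ A (w n) - V :=
        hA.D_eq ((graph ι μ A).sub_mem (hwg n) hv.mem)
      rw [formA, h4, ← real_inner_self_eq_norm_sq, L2.inner_def]
    simp only [hE] at hlim
    have sq_lim {x : ℕ → ℝ} (hx0 : ∀ n, 0 ≤ x n) (hx : ∀ n, x n ^ 2 ≤
        ‖D ι μ A (w n) - V‖ ^ 2 + ‖w n - v‖ ^ 2) : Tendsto x atTop (𝓝 0) := by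
      have h4 := squeeze_zero (fun n => sq_nonneg (x n)) hx hlim
      have h5 := (Real.continuous_sqrt.tendsto _).comp h4
      rw [Real.sqrt_zero] at h5
      exact h5.congr fun n => Real.sqrt_sq (hx0 n)
    have hw1 : Tendsto w atTop (𝓝 v) := tendsto_iff_norm_sub_tendsto_zero.2
      (sq_lim (fun _ => norm_nonneg _) fun n => by linarith [sq_nonneg ‖D ι μ A (w n) - V‖])
    have hw2 : Tendsto (fun n => D ι μ A (w n)) atTop (𝓝 V) := tendsto_iff_norm_sub_tendsto_zero.2
      (sq_lim (fun _ => norm_nonneg _) fun n => by linarith [sq_nonneg ‖w n - v‖])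
    have hw3 : Tendsto (fun n => mulN (lift1 (clip M)) (fun _ => w n) β) atTop
        (𝓝 (mulN (lift1 (clip M)) (fun _ => v) β)) :=
      (bc_clip hM0).tendsto_mulN (by norm_num) (tendsto_pi_nhds.2 fun _ => hw1) tendsto_const_nhds
    have l1 : Tendsto (fun n => bform β (D ι μ A u) (w n) (D ι μ A (w n))) atTop
        (𝓝 (bform β (D ι μ A u) v V)) := by
      rw [bform_eq_inner (mulN_clip hM0 hvM β)]
      refine ((hw2.add hw3).inner (tendsto_const_nhds (x := D ι μ A u))).congr fun n => ?_
      rw [bform_eq_inner (mulN_clip hM0 (hwM n) β)]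
    have l2 : Tendsto (fun n => -inner ℝ g (w n)) atTop (𝓝 (-inner ℝ g v)) :=
      (tendsto_const_nhds.inner hw1).neg
    refine tendsto_nhds_unique l1 (l2.congr fun n => ?_)
    obtain ⟨g', hg'⟩ := (hw n).2
    rw [← h3.assoc u (w n) g g' K C hg hK hg' (hw n).1, form, bform, formA, L2.inner_def]
    congr 1
    refine integral_congr_ae ?_
    filter_upwards [h2.memLp.coeFn_toLp] with z hz
    rw [hβ, hz]

namespace IsAssociated

variable {β : Lp H 2 μ} {α T : ℝ} {P : ℝ → Lp ℝ 2 μ →L[ℝ] Lp ℝ 2 μ}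

/-- The sup norm bound is assumed on [0, T] only; the semigroup law carries boundedness to all
times. -/
theorem bddBy_apply (hP : IsAssociated ι A β α T P) {u : Lp ℝ 2 μ} (hu : ∃ K, BddBy K u) {t : ℝ}
    (ht : 0 ≤ t) : ∃ K, BddBy K (P t u) := by
  obtain ⟨C, hC, h⟩ := hP.bdd
  have key (n : ℕ) : ∀ t ∈ Icc (0 : ℝ) (n * T), ∀ u : Lp ℝ 2 μ, (∃ K, BddBy K u) →
      ∃ K, BddBy K (P t u) := by
    induction n with
    | zero =>
      intro t ht u hu
      have ht0 : t = 0 := le_antisymm (by simpa using ht.2) ht.1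
      rw [ht0, hP.c0.zero_apply]
      exact hu
    | succ n ih =>
      rintro t ht u ⟨K, hu⟩
      push_cast at ht
      have hu' : BddBy |K| u := hu.mono (le_abs_self K)
      rcases le_or_gt t T with h1 | h1
      · exact ⟨_, h t ⟨ht.1, h1⟩ u _ (abs_nonneg K) hu'⟩
      · have h2 : P t u = P (t - T) (P T u) := by
          rw [← hP.c0.add_apply (by linarith) hP.T_pos.le]; congr 2; ring
        rw [h2]
        exact ih _ ⟨by linarith, by linarith [ht.2]⟩ _
          ⟨_, h T ⟨hP.T_pos.le, le_rfl⟩ u _ (abs_nonneg K) hu'⟩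
  obtain ⟨n, hn⟩ := exists_nat_gt (t / T)
  exact key n t ⟨ht, ((div_lt_iff₀ hP.T_pos).1 hn).le⟩ u hu

/-- The derivative of s ↦ ∫ √((P_s u)² + δ) is minus the form at P_s u tested with its smoothed
sign, hence at most α times the function itself. Gronwall's inequality and δ → 0 conclude.
Boundedness of u is what makes the generator and the form comparable along the orbit. -/
theorem norm_toL1_le_of_gen (hP : IsAssociated ι A β α T P) {u g : Lp ℝ 2 μ} (hg : HasGen P u g)
    (hu : ∃ K, BddBy K u) {t : ℝ} (ht : 0 ≤ t) :
    ‖toL1 (P t u)‖ ≤ Real.exp (α * t) * ‖toL1 u‖ := by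
  refine le_of_forall_sqrt (c := Real.exp (α * t) * μ.real univ) (by positivity) fun δ hδ => ?_
  have hs2 := smooth2_smoothAbs hδ
  set m : ℝ → ℝ := fun s => ∫ z, (compN (lift1 (smoothAbs δ)) (fun _ => P s u) : Lp ℝ 2 μ) z ∂μ
    with hm
  have hm' : m = fun s => ∫ z, (toL1 (compN (lift1 (smoothAbs δ)) (fun _ => P s u)) :
      Lp ℝ 1 μ) z ∂μ := by
    ext s
    exact (integral_congr_ae (coeFn_toL1 _)).symm
  have hcont : ContinuousOn m (Icc 0 t) := by
    have h1 : ContinuousOn (fun s => P s u) (Icc 0 t) := by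
      have := hP.c0.continuousOn_apply (t := 0) (s := Icc 0 t) (fun r hr => hr.1)
        (y := fun _ => u) continuousOn_const
      simpa using this
    exact (continuous_integral_Lp_two.comp hs2.lc.continuous_compN).comp_continuousOn
      (continuousOn_pi.2 fun _ => h1)
  have hder (s : ℝ) (hs : 0 ≤ s) : HasDerivWithinAt m
      (inner ℝ (P s g) (compN (lift1 (smoothSign δ)) fun _ => P s u)) (Ioi s) s := by
    have h1 := hs2.hasDerivWithinAt_toL1_compN (κ := Unit) (y := fun s _ => P s u)
      (y' := fun _ => P s g) fun _ => hP.c0.hasDerivWithinAt_orbit hg hs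
    have h2 := (L1.integralCLM (α := E) (E := ℝ) (μ := μ)).hasFDerivAt.comp_hasDerivWithinAt s h1
    rw [hm']
    have e (f : Lp ℝ 1 μ) : L1.integralCLM (α := E) (E := ℝ) (μ := μ) f = ∫ z, f z ∂μ :=
      (L1.integral_eq f).symm.trans (L1.integral_eq_integral f)
    refine (h2.congr_of_eventuallyEq (.of_forall fun r => ?_) ?_).congr_deriv ?_
    · exact (e _).symm
    · exact (e _).symm
    · rw [e, inner_eq_integral_mul]
      simp only [Finset.univ_unique, Finset.sum_singleton]
      rw [show (default : Unit) = () from rfl, pd_smoothAbs hδ]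
      refine integral_congr_ae ?_
      filter_upwards [coeFn_toL1 (mulN (lift1 (smoothSign δ)) (fun _ => P s u) (P s g)),
        (bc_smoothSign hδ).coeFn_mulN (fun _ => P s u) (P s g),
        (smooth1_smoothSign hδ).lc.coeFn_compN fun _ => P s u] with z e1 e2 e3
      rw [e1, e2, e3, smul_eq_mul, mul_comm]
  have hbound (s : ℝ) (hs : 0 ≤ s) :
      inner ℝ (P s g) (compN (lift1 (smoothSign δ)) fun _ => P s u) ≤ α * m s := by
    obtain ⟨K, hK⟩ := hP.bddBy_apply hu hs
    obtain ⟨U, hU, hform⟩ := hP.gen _ _ K (hP.c0.hasGen_apply hg hs) hK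
    have h1 := hP.lower.le_bform hδ hU
    rw [hform _ _ (isBddTest_smoothSign hδ hU)] at h1
    linarith
  have hgr := le_gronwallBound_of_liminf_deriv_right_le (f := m)
    (f' := fun s => inner ℝ (P s g) (compN (lift1 (smoothSign δ)) fun _ => P s u))
    (δ := m 0) (K := α) (ε := 0) (a := 0) (b := t) hcont
    (fun s hs r hr => (hder s hs.1).Ici_of_Ioi.liminf_right_slope_le hr) le_rfl
    (fun s hs => by simpa using hbound s hs.1) t ⟨ht, le_rfl⟩
  rw [gronwallBound_ε0, sub_zero] at hgr
  have h0 : m 0 ≤ ‖toL1 u‖ + √δ * μ.real univ := by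
    simp only [hm, hP.c0.zero_apply]
    exact integral_smoothAbs_le hδ u
  calc ‖toL1 (P t u)‖ ≤ m t := norm_toL1_le_integral_smoothAbs hδ _
    _ ≤ m 0 * Real.exp (α * t) := hgr
    _ ≤ (‖toL1 u‖ + √δ * μ.real univ) * Real.exp (α * t) := by gcongr
    _ = _ := by ring

end IsAssociated

end Associated

end LinearEq
end

noncomputable section
namespace LinearEq

/-! ### Averages of orbits. -/

section Generic

variable {X : Type*} [NormedAddCommGroup X] [NormedSpace ℝ X] [CompleteSpace X]

theorem IsC0.tendsto_average {S : ℝ → X →L[ℝ] X} (hS : IsC0 S) (x : X) :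
    Tendsto (fun t : ℝ => t⁻¹ • ∫ s in (0 : ℝ)..t, S s x) (𝓝[>] 0) (𝓝 x) := by
  have hc : Continuous fun t : ℝ => S (max t 0) x := hS.continuous_orbit x
  have h1 : HasDerivAt (fun r => ∫ s in (0 : ℝ)..r, S (max s 0) x) (S (max 0 0) x) 0 :=
    intervalIntegral.integral_hasDerivAt_right (hc.intervalIntegrable _ _)
      (hc.stronglyMeasurableAtFilter _ _) hc.continuousAt
  have h2 := hasDerivAt_iff_tendsto_slope_zero.1 h1
  simp only [intervalIntegral.integral_same, sub_zero, zero_add, max_self, hS.zero_apply] at h2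
  refine (h2.mono_left (nhdsWithin_mono _ fun t ht => ne_of_gt ht)).congr' ?_
  filter_upwards [self_mem_nhdsWithin] with t ht
  congr 1
  refine intervalIntegral.integral_congr fun s hs => ?_
  rw [uIcc_of_le (le_of_lt ht)] at hs
  simp [max_eq_left hs.1]

theorem HasGen.const_smul {S : ℝ → X →L[ℝ] X} {x g : X} (h : HasGen S x g) (c : ℝ) :
    HasGen S (c • x) (c • g) := by
  refine (Tendsto.const_smul h c).congr fun t => ?_
  rw [map_smul, ← smul_sub, smul_comm]

end Generic

/-! ### The semigroup on L¹ and its generator. -/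

section LOne

variable {E H : Type*} [NormedAddCommGroup E] [NormedSpace ℝ E]
  [MeasurableSpace E]
  [NormedAddCommGroup H] [InnerProductSpace ℝ H] [CompleteSpace H]
  {ι : H →L[ℝ] E} {μ : Measure E} {A : E → H →L[ℝ] H} [IsFiniteMeasure μ]
  {β : Lp H 2 μ} {α T : ℝ} {P : ℝ → Lp ℝ 2 μ →L[ℝ] Lp ℝ 2 μ}

namespace IsAssociated

/-- Bounded elements of the domain of the generator are dense. -/
theorem exists_tendsto_gen (hP : IsAssociated ι A β α T P) (u : Lp ℝ 2 μ) :
    ∃ w : ℕ → Lp ℝ 2 μ, (∀ n, (∃ K, BddBy K (w n)) ∧ ∃ g, HasGen P (w n) g) ∧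
      Tendsto w atTop (𝓝 u) := by
  obtain ⟨C, hC, hb⟩ := hP.bdd
  obtain ⟨k, hk, hlim⟩ := exists_bddBy_tendsto u
  have h1 (n : ℕ) : ∃ τ ∈ Ioo (0 : ℝ) T,
      ‖τ⁻¹ • (∫ s in (0 : ℝ)..τ, P s (k n)) - k n‖ < 1 / ((n : ℝ) + 1) := by
    have h2 := tendsto_iff_norm_sub_tendsto_zero.1 (hP.c0.tendsto_average (k n))
    have h3 := (h2.eventually_lt_const (show (0 : ℝ) < 1 / ((n : ℝ) + 1) by positivity)).and
      (Ioo_mem_nhdsGT hP.T_pos)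
    obtain ⟨τ, hτ, hτ'⟩ := h3.exists
    exact ⟨τ, hτ', hτ⟩
  choose τ hτ hclose using h1
  -- Averages over short times of orbits of truncations of u: averaging puts them into the domain,
  -- and the sup norm bound on [0, T] keeps them bounded.
  refine ⟨fun n => (τ n)⁻¹ • ∫ s in (0 : ℝ)..τ n, P s (k n), fun n =>
    ⟨⟨|(τ n)⁻¹| * (τ n * (C * n)), ?_⟩, ⟨(τ n)⁻¹ • (P (τ n) (k n) - k n), ?_⟩⟩, ?_⟩
  · refine BddBy.smul (BddBy.integral (K := C * n) (by positivity) (hτ n).1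
      (hP.c0.intervalIntegrable_orbit _ le_rfl (hτ n).1.le) fun s hs => ?_) _
    exact hb s ⟨hs.1.le, hs.2.trans (hτ n).2.le⟩ _ _ n.cast_nonneg (hk n)
  · exact (hP.c0.hasGen_integral (k n) (hτ n).1.le).const_smul _
  · have h2 : Tendsto (fun n => (τ n)⁻¹ • (∫ s in (0 : ℝ)..τ n, P s (k n)) - k n) atTop (𝓝 0) :=
      squeeze_zero_norm (fun n => (hclose n).le) tendsto_one_div_add_atTop_nhds_zero_nat
    simpa using h2.add hlim

theorem norm_toL1_apply_le (hP : IsAssociated ι A β α T P) (u : Lp ℝ 2 μ) {t : ℝ} (ht : 0 ≤ t) :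
    ‖toL1 (P t u)‖ ≤ Real.exp (α * t) * ‖toL1 u‖ := by
  obtain ⟨w, hw, hlim⟩ := hP.exists_tendsto_gen u
  have h1 : Continuous fun u => ‖toL1L (P t u)‖ := by fun_prop
  have h2 : Continuous fun u => Real.exp (α * t) * ‖(toL1L u : Lp ℝ 1 μ)‖ := by fun_prop
  refine le_of_tendsto_of_tendsto' ((h1.tendsto u).comp hlim) ((h2.tendsto u).comp hlim)
    fun n => ?_
  obtain ⟨g, hg⟩ := (hw n).2
  exact hP.norm_toL1_le_of_gen hg (hw n).1 ht

theorem isL1Ext (hP : IsAssociated ι A β α T P) {t : ℝ} (ht : 0 ≤ t) :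
    IsL1Ext (P t) (l1Ext (P t)) := by
  have h : ∃ Q, IsL1Ext (P t) Q := by
    let f : Lp ℝ 2 μ →ₗ[ℝ] Lp ℝ 1 μ := (toL1L ∘L P t : Lp ℝ 2 μ →L[ℝ] Lp ℝ 1 μ)
    let e : Lp ℝ 2 μ →ₗ[ℝ] Lp ℝ 1 μ := (toL1L : Lp ℝ 2 μ →L[ℝ] Lp ℝ 1 μ)
    refine ⟨f.extendOfNorm e, fun u => ?_⟩
    exact LinearMap.extendOfNorm_eq denseRange_toL1
      ⟨Real.exp (α * t), fun u => hP.norm_toL1_apply_le u ht⟩ u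
  rw [l1Ext, dif_pos h]
  exact h.choose_spec

theorem l1Ext_toL1 (hP : IsAssociated ι A β α T P) {t : ℝ} (ht : 0 ≤ t) (u : Lp ℝ 2 μ) :
    l1Ext (P t) (toL1 u) = toL1 (P t u) := hP.isL1Ext ht u

theorem norm_l1Ext_apply_le (hP : IsAssociated ι A β α T P) {t : ℝ} (ht : 0 ≤ t) (f : Lp ℝ 1 μ) :
    ‖l1Ext (P t) f‖ ≤ Real.exp (α * t) * ‖f‖ := by
  obtain ⟨k, -, hlim⟩ := exists_bddBy_tendsto_L1 f
  refine le_of_tendsto_of_tendsto' (((l1Ext (P t)).continuous.tendsto f).comp hlim).norm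
    (hlim.norm.const_mul _) fun n => ?_
  simp only [Function.comp_apply]
  rw [hP.l1Ext_toL1 ht]
  exact hP.norm_toL1_apply_le _ ht

theorem norm_l1Ext_le (hP : IsAssociated ι A β α T P) {t : ℝ} (ht : 0 ≤ t) :
    ‖l1Ext (P t)‖ ≤ Real.exp (α * t) :=
  ContinuousLinearMap.opNorm_le_bound _ (by positivity) fun f => hP.norm_l1Ext_apply_le ht f

omit [NormedAddCommGroup E] [NormedSpace ℝ E] in
theorem ext_toL1 {F G : Lp ℝ 1 μ →L[ℝ] Lp ℝ 1 μ} (h : ∀ u, F (toL1 u) = G (toL1 u)) : F = G := by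
  ext1 f
  exact congrFun (denseRange_toL1.equalizer F.continuous G.continuous (funext h)) f

theorem c0_l1Ext (hP : IsAssociated ι A β α T P) : IsC0 fun t => l1Ext (P t) where
  zero := by
    refine ext_toL1 fun u => ?_
    rw [hP.l1Ext_toL1 le_rfl, hP.c0.zero_apply]
    rfl
  add s t hs ht := by
    refine ext_toL1 fun u => ?_
    rw [ContinuousLinearMap.comp_apply, hP.l1Ext_toL1 (add_nonneg hs ht), hP.l1Ext_toL1 ht,
      hP.l1Ext_toL1 hs, hP.c0.add_apply hs ht]
  cont_zero f := by
    rw [Metric.tendsto_nhds]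
    intro ε hε
    obtain ⟨k, -, hlim⟩ := exists_bddBy_tendsto_L1 f
    have hM : 0 < Real.exp α + 1 := by positivity
    obtain ⟨n, hn⟩ := (Metric.tendsto_nhds.1 hlim (ε / 2 / (Real.exp α + 1))
      (by positivity)).exists
    have h1 : Tendsto (fun t => toL1L (P t (k n)) : ℝ → Lp ℝ 1 μ) (𝓝[>] 0) (𝓝 (toL1L (k n))) :=
      (toL1L.continuous.tendsto _).comp (hP.c0.cont_zero (k n))
    filter_upwards [Metric.tendsto_nhds.1 h1 (ε / 2) (by positivity),
      Ioo_mem_nhdsGT (zero_lt_one' ℝ)] with t ht1 ht2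
    have h2 : l1Ext (P t) f - f = l1Ext (P t) (f - toL1 (k n)) +
        (toL1 (P t (k n)) - toL1 (k n)) + (toL1 (k n) - f) := by
      rw [map_sub, hP.l1Ext_toL1 ht2.1.le]; abel
    rw [dist_eq_norm] at hn ht1 ⊢
    rw [h2]
    have h3 : ‖l1Ext (P t) (f - toL1 (k n))‖ ≤ Real.exp α * ‖toL1 (k n) - f‖ := by
      rw [norm_sub_rev (toL1 (k n))]
      refine (hP.norm_l1Ext_apply_le ht2.1.le _).trans ?_
      gcongr
      exact mul_le_of_le_one_right hP.nonneg ht2.2.le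
    have h4 : (Real.exp α + 1) * ‖toL1 (k n) - f‖ < ε / 2 := by
      rw [mul_comm]
      exact (lt_div_iff₀ hM).1 hn
    have h5 : ‖toL1 (P t (k n)) - toL1 (k n)‖ < ε / 2 := ht1
    calc _ ≤ ‖l1Ext (P t) (f - toL1 (k n))‖ + ‖toL1 (P t (k n)) - toL1 (k n)‖
          + ‖toL1 (k n) - f‖ := norm_add₃_le
      _ < ε := by linarith

/-- An element of the form domain solving the weak equation with an `L¹` right-hand side belongs to
the domain of the generator in `L¹`. -/
theorem hasGen_of_weak (hP : IsAssociated ι A β α T P) {w : Lp ℝ 2 μ} {W : Lp H 2 μ}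
    (hw : (w, W) ∈ graph ι μ A) {g : Lp ℝ 1 μ}
    (heq : ∀ v V, IsBddTest ι μ A v V → bform β W v V = pair g v) :
    HasGen (fun t => l1Ext (P t)) (toL1 w) (-g) := by
  -- With this shift e^{-ct}P_t has L¹ norm at most e^{-t}, and the constant c - α of the L¹
  -- estimate is 1.
  set c : ℝ := α + 1 with hc
  have hc0 : 0 ≤ c := by linarith [hP.nonneg]
  have hT := hP.T_pos
  set Q : ℝ → Lp ℝ 1 μ →L[ℝ] Lp ℝ 1 μ := fun t => l1Ext (P t) with hQ
  have hQ0 : IsC0 Q := hP.c0_l1Ext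
  set S : ℝ → Lp ℝ 2 μ →L[ℝ] Lp ℝ 2 μ := fun t => Real.exp (-c * t) • P t with hS
  set S₁ : ℝ → Lp ℝ 1 μ →L[ℝ] Lp ℝ 1 μ := fun t => Real.exp (-c * t) • Q t with hS₁
  have hS0 : IsC0 S := hP.c0.scale c
  have hS10 : IsC0 S₁ := hQ0.scale c
  have hSS (t : ℝ) (ht : 0 ≤ t) (u : Lp ℝ 2 μ) : S₁ t (toL1 u) = toL1 (S t u) := by
    have h1 : Q t (toL1 u) = toL1L (P t u) := hP.l1Ext_toL1 ht u
    change Real.exp (-c * t) • Q t (toL1 u) = toL1L (Real.exp (-c * t) • P t u)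
    rw [h1, map_smul]
  have hS1n (t : ℝ) (ht : 0 ≤ t) : ‖S₁ t‖ ≤ Real.exp (-t) := by
    rw [hS₁, norm_smul, Real.norm_of_nonneg (by positivity)]
    calc Real.exp (-c * t) * ‖Q t‖ ≤ Real.exp (-c * t) * Real.exp (α * t) := by
          gcongr; exact hP.norm_l1Ext_le ht
      _ = Real.exp (-t) := by rw [← Real.exp_add, hc]; congr 1; ring
  have hlt : ‖S₁ T‖ < 1 := (hS1n T hT.le).trans_lt (by simpa using hT)
  let R : (Lp ℝ 1 μ →L[ℝ] Lp ℝ 1 μ)ˣ := Units.oneSub (S₁ T) hlt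
  -- The integral of S_s κ over [0, T] is sent by c - L to κ - S_T κ, so this κ, available by a
  -- Neumann series, makes it the resolvent of cw + g. The finite horizon keeps all integrals within
  -- the range of the sup norm bound.
  set κ : Lp ℝ 1 μ := (↑R⁻¹ : Lp ℝ 1 μ →L[ℝ] Lp ℝ 1 μ) (c • toL1 w + g) with hκ
  have hRκ : κ - S₁ T κ = c • toL1 w + g := by
    have h1 : (R : Lp ℝ 1 μ →L[ℝ] Lp ℝ 1 μ) κ = c • toL1 w + g := by
      exact congrArg (fun F : Lp ℝ 1 μ →L[ℝ] Lp ℝ 1 μ => F (c • toL1 w + g)) R.mul_inv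
    rw [← h1]
    rfl
  obtain ⟨k, hk, hlim⟩ := exists_bddBy_tendsto_L1 κ
  obtain ⟨C, hC, hb⟩ := hP.bdd
  set J : ℕ → Lp ℝ 2 μ := fun n => ∫ s in (0 : ℝ)..T, S s (k n) with hJ
  have hJbdd (n : ℕ) : BddBy (T * (C * n)) (J n) := by
    refine BddBy.integral (by positivity) hT (hS0.intervalIntegrable_orbit _ le_rfl hT.le)
      fun s hs => ?_
    have h1 := (hb s ⟨hs.1.le, hs.2⟩ _ _ n.cast_nonneg (hk n)).smul (Real.exp (-c * s))
    refine BddBy.mono h1 ?_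
    rw [abs_of_pos (by positivity)]
    refine mul_le_of_le_one_left (by positivity) ?_
    rw [Real.exp_le_one_iff]
    nlinarith [hs.1]
  have hJgen (n : ℕ) : HasGen P (J n) (S T (k n) - k n + c • J n) :=
    IsC0.hasGen_of_scale (hS0.hasGen_integral (k n) hT.le)
  -- Since k n is bounded, J n is a bounded element of the domain and so satisfies the weak
  -- equation. The difference w - J n solves the resolvent equation with the defect on the right,
  -- and the L¹ estimate applies to it.
  have hJest (n : ℕ) : ‖toL1 (w - J n)‖ ≤ ‖(c • toL1 w + g) - (toL1 (k n) - S₁ T (toL1 (k n)))‖ := by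
    obtain ⟨U, hU, hform⟩ := hP.gen _ _ _ (hJgen n) (hJbdd n)
    have h1 := hP.lower.norm_toL1_le hP.nonneg hc0 ((graph ι μ A).sub_mem hw hU)
      (k := (c • toL1 w + g) - (toL1 (k n) - S₁ T (toL1 (k n)))) fun v V hv => ?_
    · rwa [hc, add_sub_cancel_left, one_mul] at h1
    · change _ = pair _ v
      rw [bform_sub hv.bdd, heq v V hv, hform v V hv, pair_sub _ _ hv.bdd, pair_add _ _ hv.bdd,
        pair_sub _ _ hv.bdd, pair_smul, hSS T hT.le, pair_toL1, pair_toL1, pair_toL1]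
      simp only [inner_add_left, inner_sub_left, real_inner_smul_left]
      ring
  have hJw : Tendsto (fun n => toL1 (J n)) atTop (𝓝 (toL1 w)) := by
    have h1 : Continuous fun f : Lp ℝ 1 μ => ‖(c • toL1 w + g) - (f - S₁ T f)‖ := by fun_prop
    have h2 := (h1.tendsto κ).comp hlim
    rw [hRκ, sub_self, norm_zero] at h2
    have h3 : Tendsto (fun n => ‖toL1 (w - J n)‖) atTop (𝓝 0) :=
      squeeze_zero (fun _ => norm_nonneg _) hJest h2
    refine tendsto_iff_norm_sub_tendsto_zero.2 (h3.congr fun n => ?_)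
    rw [norm_sub_rev]
    change ‖toL1L (w - J n)‖ = ‖toL1L w - toL1L (J n)‖
    rw [map_sub]
  have hJ1 (n : ℕ) : toL1 (J n) = ∫ s in (0 : ℝ)..T, S₁ s (toL1 (k n)) := by
    change toL1L (J n) = _
    rw [hJ, ← ContinuousLinearMap.intervalIntegral_comp_comm _
      (hS0.intervalIntegrable_orbit _ le_rfl hT.le)]
    refine intervalIntegral.integral_congr fun s hs => ?_
    rw [uIcc_of_le hT.le] at hs
    exact (hSS s hs.1 _).symm
  have hJκ : Tendsto (fun n => toL1 (J n)) atTop (𝓝 (∫ s in (0 : ℝ)..T, S₁ s κ)) := by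
    rw [tendsto_iff_norm_sub_tendsto_zero]
    have h1 : Tendsto (fun n => ‖toL1 (k n) - κ‖ * |T - 0|) atTop (𝓝 0) := by
      simpa using (tendsto_iff_norm_sub_tendsto_zero.1 hlim).mul_const |T - 0|
    refine squeeze_zero (fun _ => norm_nonneg _) (fun n => ?_) h1
    rw [hJ1, ← intervalIntegral.integral_sub (hS10.intervalIntegrable_orbit _ le_rfl hT.le)
      (hS10.intervalIntegrable_orbit _ le_rfl hT.le)]
    refine intervalIntegral.norm_integral_le_of_norm_le_const fun s hs => ?_
    rw [uIoc_of_le hT.le] at hs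
    rw [← map_sub]
    refine ((S₁ s).le_of_opNorm_le (hS1n s hs.1.le) _).trans (mul_le_of_le_one_left
      (norm_nonneg _) ?_)
    rw [Real.exp_le_one_iff]
    linarith [hs.1]
  -- Thus w is itself the integral of an L¹ orbit, and such integrals lie in the domain of the
  -- generator.
  have hweq := tendsto_nhds_unique hJw hJκ
  have h1 := IsC0.hasGen_of_scale (hS10.hasGen_integral κ hT.le)
  rw [← hweq] at h1
  have h2 : S₁ T κ - κ + c • toL1 w = -g := by
    rw [← neg_sub, hRκ]
    abel
  rwa [h2] at h1

end IsAssociated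

end LOne

end LinearEq
end

noncomputable section
namespace LinearEq

/-! ### From weak solutions to an equation integrated in time. -/

/-- A weak form of the fundamental lemma of the calculus of variations with a right endpoint. -/
theorem eq_sub_integral_of_weak {c a : ℝ → ℝ} {κ T : ℝ} (hT : 0 < T) (hc : ContinuousOn c (Icc 0 T))
    (ha : IntervalIntegrable a volume 0 T)
    (h : ∀ η ζ : ℝ → ℝ, Continuous ζ → (∀ t, HasDerivAt η (ζ t) t) → η 0 = 0 →
      ∫ t in (0 : ℝ)..T, (c t * ζ t + a t * η t) = κ * η T) {s : ℝ} (hs : s ∈ Icc 0 T) :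
    c s = κ - ∫ r in s..T, a r := by
  set G : ℝ → ℝ := fun s => ∫ r in (0 : ℝ)..s, a r with hG
  have hGac : AbsolutelyContinuousOnInterval G 0 T :=
    ha.absolutelyContinuousOnInterval_intervalIntegral (by simp)
  have hGc : ContinuousOn G (Icc 0 T) := by
    have := hGac.continuousOn
    rwa [uIcc_of_le hT.le] at this
  -- This is c(s) - κ plus the integral of a over [s, T], the quantity to be shown zero. It is used
  -- as its own test function: ζ extends e constantly outside [0, T], η is its primitive, and
  -- integration by parts turns the hypothesis into ∫ e² = 0.
  set e : ℝ → ℝ := fun s => c s - G s + (G T - κ) with he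
  have hec : ContinuousOn e (Icc 0 T) := (hc.sub hGc).add continuousOn_const
  set ζ : ℝ → ℝ := IccExtend hT.le ((Icc 0 T).domRestrict e) with hζ
  have hζc : Continuous ζ := hec.domRestrict.Icc_extend'
  have hζe {t : ℝ} (ht : t ∈ Icc 0 T) : ζ t = e t := IccExtend_of_mem _ _ ht
  set η : ℝ → ℝ := fun s => ∫ r in (0 : ℝ)..s, ζ r with hη
  have hηd (t : ℝ) : HasDerivAt η (ζ t) t :=
    intervalIntegral.integral_hasDerivAt_right (hζc.intervalIntegrable _ _)
      (hζc.stronglyMeasurableAtFilter _ _) hζc.continuousAt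
  have hηc : Continuous η := continuous_iff_continuousAt.2 fun t => (hηd t).continuousAt
  have hη0 : η 0 = 0 := intervalIntegral.integral_same
  have hηac : AbsolutelyContinuousOnInterval η 0 T :=
    (hζc.intervalIntegrable _ _).absolutelyContinuousOnInterval_intervalIntegral (by simp)
  have hparts := hηac.integral_mul_deriv_eq_deriv_mul hGac
  have h1 : ∫ x in (0 : ℝ)..T, η x * deriv G x = ∫ x in (0 : ℝ)..T, a x * η x := by
    refine intervalIntegral.integral_congr_ae ?_
    filter_upwards [ha.ae_hasDerivAt_integral] with x hx hx'
    rw [(hx (uIoc_subset_uIcc hx') 0 (by simp)).deriv, mul_comm]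
  have h2 : ∫ x in (0 : ℝ)..T, deriv η x * G x = ∫ x in (0 : ℝ)..T, ζ x * G x := by
    refine intervalIntegral.integral_congr fun x _ => ?_
    simp only [(hηd x).deriv]
  rw [h1, h2, hη0, zero_mul, sub_zero] at hparts
  have hcu : ContinuousOn c (uIcc 0 T) := by rwa [uIcc_of_le hT.le]
  have hGu : ContinuousOn G (uIcc 0 T) := hGac.continuousOn
  have i1 : IntervalIntegrable (fun t => c t * ζ t) volume 0 T :=
    (hcu.mul hζc.continuousOn).intervalIntegrable
  have i2 : IntervalIntegrable (fun t => a t * η t) volume 0 T :=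
    ha.mul_continuousOn hηc.continuousOn
  have i3 : IntervalIntegrable (fun t => ζ t * G t) volume 0 T :=
    (hζc.continuousOn.mul hGu).intervalIntegrable
  have h3 := h η ζ hζc hηd hη0
  rw [intervalIntegral.integral_add i1 i2, hparts] at h3
  have h4 : ∫ t in (0 : ℝ)..T, ζ t ^ 2 = 0 := by
    have h5 : ∫ t in (0 : ℝ)..T, ζ t ^ 2 =
        ∫ t in (0 : ℝ)..T, (c t * ζ t - ζ t * G t + (G T - κ) * ζ t) := by
      refine intervalIntegral.integral_congr fun t ht => ?_
      rw [uIcc_of_le hT.le] at ht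
      simp only [sq]
      nth_rw 1 [hζe ht]
      simp only [he]
      ring
    rw [h5, intervalIntegral.integral_add (i1.sub i3) ((hζc.intervalIntegrable _ _).const_mul _),
      intervalIntegral.integral_sub i1 i3, intervalIntegral.integral_const_mul]
    change _ + (G T - κ) * η T = 0
    linarith
  rw [intervalIntegral.integral_eq_zero_iff_of_le_of_nonneg_ae hT.le
    (.of_forall fun t => sq_nonneg _) ((hζc.pow 2).intervalIntegrable _ _)] at h4
  have h5 : EqOn (fun t => ζ t ^ 2) (fun _ => 0) (Icc 0 T) := by
    refine Measure.eqOn_Icc_of_ae_eq volume hT.ne ?_ (hζc.pow 2).continuousOn continuousOn_const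
    rw [← restrict_Ioc_eq_restrict_Icc]
    exact h4
  have h6 : ζ s = 0 := by simpa using h5 hs
  rw [hζe hs] at h6
  have h7 : ∫ r in s..T, a r = G T - G s :=
    (intervalIntegral.integral_interval_sub_left ha (ha.mono_set (by
      rw [uIcc_of_le hs.1, uIcc_of_le hT.le]; exact Icc_subset_Icc_right hs.2))).symm
  simp only [he] at h6
  linarith

/-! ### Integrated form of the weak equation. -/

section Weak

variable {E H : Type*} [NormedAddCommGroup E] [NormedSpace ℝ E]
  [MeasurableSpace E] [BorelSpace E]
  [NormedAddCommGroup H] [InnerProductSpace ℝ H] [CompleteSpace H] [SecondCountableTopology H]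
  [MeasurableSpace H] [BorelSpace H]
  {ι : H →L[ℝ] E} {μ : Measure E} {A : E → H →L[ℝ] H} [IsFiniteMeasure μ]
  {β : Lp H 2 μ} {α T : ℝ} {P : ℝ → Lp ℝ 2 μ →L[ℝ] Lp ℝ 2 μ}

theorem bform_smul_test (c : ℝ) (W : Lp H 2 μ) (v : Lp ℝ 2 μ) (V : Lp H 2 μ) :
    bform β W (c • v) (c • V) = c * bform β W v V := by
  rw [bform, bform, real_inner_smul_right, mul_add, ← integral_const_mul]
  congr 1
  refine integral_congr_ae ?_
  filter_upwards [Lp.coeFn_smul c v] with z hz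
  rw [hz, Pi.smul_apply, smul_eq_mul]
  ring

theorem formA_add_driftForm (hA : IsDiffusion ι μ A) {b : E → H} (h2 : CondA2 ι μ A b)
    (u : Lp ℝ 2 μ) {v : Lp ℝ 2 μ} {V : Lp H 2 μ} (hv : (v, V) ∈ graph ι μ A) :
    formA ι μ A u v + driftForm ι μ A b u v = bform (h2.memLp.toLp _) (D ι μ A u) v V := by
  rw [bform, formA, driftForm, L2.inner_def, hA.D_eq hv]
  congr 1
  refine integral_congr_ae ?_
  filter_upwards [h2.memLp.coeFn_toLp] with z hz
  rw [hz]

/-- Solutions of `(∂ₜ + L) u + f = 0` on `[0, T]` in integrated form; all data are extended to the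
real line. -/
structure IsSol (ι : H →L[ℝ] E) (A : E → H →L[ℝ] H) (β : Lp H 2 μ) (T : ℝ) (u : ℝ → Lp ℝ 2 μ)
    (U : ℝ → Lp H 2 μ) (f : ℝ → Lp ℝ 2 μ) : Prop where
  cont : Continuous u
  mem : ∀ᵐ s ∂volume.restrict (Ioc 0 T), (u s, U s) ∈ graph ι μ A
  memLp : MemLp U 2 volume
  integ : Integrable f volume
  eq : ∀ v V, IsBddTest ι μ A v V → ∀ s t, 0 ≤ s → s ≤ t → t ≤ T →
    inner ℝ (u t) v - inner ℝ (u s) v = ∫ r in s..t, (bform β (U r) v V - inner ℝ (f r) v)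

/-- Products of a scalar function of time and a fixed bounded element of F are the only test
functions the argument needs. -/
theorem isTest_smul (hA : IsDiffusion ι μ A) {v : Lp ℝ 2 μ} {V : Lp H 2 μ}
    (hv : IsBddTest ι μ A v V) {η ζ : ℝ → ℝ} (hζ : Continuous ζ) (hη : ∀ t, HasDerivAt η (ζ t) t) :
    IsTest ι μ A T (fun t => η t • v) (fun t => ζ t • v) where
  hasDeriv t _ := ((hη t).smul_const v).hasDerivWithinAt
  derivCont := (hζ.smul continuous_const).continuousOn
  memL2F := by
    have hmem (t : ℝ) : (η t • v, η t • V) ∈ graph ι μ A := (graph ι μ A).smul_mem (η t) hv.mem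
    have hηc : Continuous η := continuous_iff_continuousAt.2 fun t => (hη t).continuousAt
    refine ⟨.of_forall fun t => hA.memF_of_mem (hmem t), ?_⟩
    simp only [fun t => hA.D_eq (hmem t)]
    obtain ⟨C, hC⟩ := (isCompact_Icc (a := (0 : ℝ)) (b := T)).exists_bound_of_continuousOn
      (hηc.smul (continuous_const (y := V))).continuousOn
    exact MemLp.of_bound (hηc.smul continuous_const).aestronglyMeasurable C
      ((ae_restrict_iff' measurableSet_Icc).2 (.of_forall hC))
  bdd := by
    have hηc : Continuous η := continuous_iff_continuousAt.2 fun t => (hη t).continuousAt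
    obtain ⟨C, hC⟩ := (isCompact_Icc (a := (0 : ℝ)) (b := T)).exists_bound_of_continuousOn
      hηc.continuousOn
    obtain ⟨K, hK⟩ := hv.bdd
    refine ⟨C * |K|, fun t ht => ((hK.mono (le_abs_self K)).smul (η t)).mono ?_⟩
    exact mul_le_mul_of_nonneg_right (hC t ht) (abs_nonneg K)

theorem _root_.ContinuousOn.exists_extend {X : Type*} [TopologicalSpace X] {u : ℝ → X} {T : ℝ}
    (hT : 0 ≤ T) (hu : ContinuousOn u (Icc 0 T)) :
    ∃ w : ℝ → X, Continuous w ∧ EqOn w u (Icc 0 T) :=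
  ⟨IccExtend hT ((Icc 0 T).domRestrict u), hu.domRestrict.Icc_extend',
    fun _ ht => IccExtend_of_mem _ _ ht⟩

/-- Bounded elements of the domain of L belong to F and are dense in L². -/
theorem IsAssociated.eq_of_inner_test (hP : IsAssociated ι A β α T P) {x y : Lp ℝ 2 μ}
    (h : ∀ v V, IsBddTest ι μ A v V → inner ℝ x v = inner ℝ y v) : x = y := by
  refine ext_inner_right ℝ fun w => ?_
  obtain ⟨v, hv, hlim⟩ := hP.exists_tendsto_gen w
  refine tendsto_nhds_unique ((tendsto_const_nhds (x := x)).inner hlim)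
    (((tendsto_const_nhds (x := y)).inner hlim).congr fun n => ?_)
  obtain ⟨⟨K, hK⟩, g, hg⟩ := hv n
  obtain ⟨V, hV, -⟩ := hP.gen _ _ _ hg hK
  exact (h _ V ⟨hV, K, hK⟩).symm

/-- Test functions η(t)v with η(0) = 0 give a scalar weak equation for t ↦ (u_t, v). By
`eq_sub_integral_of_weak` it holds at every time, and at T it yields the terminal value. The
solution is extended constantly, gradient and source by zero, so that Steklov averages are defined
on the whole line. -/
theorem IsWeakSol.exists_isSol (hA : IsDiffusion ι μ A) {b : E → H} (h2 : CondA2 ι μ A b)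
    (hP : IsAssociated ι A (h2.memLp.toLp _) α T P) {φ : Lp ℝ 2 μ} {f u : ℝ → Lp ℝ 2 μ}
    (hf : IntervalIntegrable f volume 0 T) (hu : IsWeakSol ι μ A b T φ f u) :
    ∃ (w : ℝ → Lp ℝ 2 μ) (W : ℝ → Lp H 2 μ) (k : ℝ → Lp ℝ 2 μ),
      IsSol ι A (h2.memLp.toLp _) T w W k ∧ EqOn w u (Icc 0 T) ∧ w T = φ ∧
      EqOn W (fun s => D ι μ A (u s)) (Ioc 0 T) ∧ EqOn k f (Ioc 0 T) := by
  have hT := hP.T_pos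
  set β : Lp H 2 μ := h2.memLp.toLp _ with hβ
  obtain ⟨w, hwc, hw⟩ := hu.cont.exists_extend hT.le
  have hUm := hu.memL2F.memLp
  rw [← restrict_Ioc_eq_restrict_Icc] at hUm
  have hmem := hu.memL2F.mem_ae
  rw [← restrict_Ioc_eq_restrict_Icc] at hmem
  have hU : IntervalIntegrable (fun s => D ι μ A (u s)) volume 0 T := by
    rw [intervalIntegrable_iff_integrableOn_Ioc_of_le hT.le]
    exact hUm.integrable (by norm_num)
  have key : ∀ v V, IsBddTest ι μ A v V →
      IntervalIntegrable (fun r => bform β (D ι μ A (u r)) v V - inner ℝ (f r) v) volume 0 T ∧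
      ∀ s ∈ Icc 0 T, inner ℝ (u s) v = inner ℝ φ v -
        ∫ r in s..T, (bform β (D ι μ A (u r)) v V - inner ℝ (f r) v) := by
    intro v V hv
    obtain ⟨k, hk⟩ := exists_smul_bdd β hv.bdd
    have i1 : IntervalIntegrable (fun r => bform β (D ι μ A (u r)) v V) volume 0 T := by
      simp only [bform_eq_inner hk]
      exact ⟨hU.1.const_inner _, hU.2.const_inner _⟩
    have i2 : IntervalIntegrable (fun r => (inner ℝ (f r) v : ℝ)) volume 0 T :=
      ⟨hf.1.inner_const v, hf.2.inner_const v⟩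
    have i3 := i1.sub i2
    refine ⟨i3, fun s hs => ?_⟩
    refine eq_sub_integral_of_weak (c := fun s => inner ℝ (u s) v) hT
      (hu.cont.inner continuousOn_const) i3 (fun η ζ hζ hη hη0 => ?_) hs
    have hηc : Continuous η := continuous_iff_continuousAt.2 fun t => (hη t).continuousAt
    have hweak := hu.weak _ _ (isTest_smul hA hv hζ hη)
    have i4 : IntervalIntegrable (fun t => (inner ℝ (u t) v : ℝ) * ζ t) volume 0 T := by
      refine ContinuousOn.intervalIntegrable ?_
      rw [uIcc_of_le hT.le]
      exact (hu.cont.inner continuousOn_const).mul hζ.continuousOn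
    have i5 := i1.mul_continuousOn (hηc.continuousOn (s := uIcc 0 T))
    have i6 := i2.mul_continuousOn (hηc.continuousOn (s := uIcc 0 T))
    have e1 (t : ℝ) : (inner ℝ (u t) (ζ t • v) : ℝ) + formA ι μ A (u t) (η t • v) +
        driftForm ι μ A b (u t) (η t • v) =
        inner ℝ (u t) v * ζ t + bform β (D ι μ A (u t)) v V * η t := by
      rw [add_assoc, formA_add_driftForm hA h2 _ ((graph ι μ A).smul_mem (η t) hv.mem),
        bform_smul_test, real_inner_smul_right, mul_comm, mul_comm (η t)]
    have e2 (t : ℝ) : (inner ℝ (f t) (η t • v) : ℝ) = inner ℝ (f t) v * η t := by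
      rw [real_inner_smul_right, mul_comm]
    simp only [e1, e2, hη0, zero_smul, inner_zero_right, sub_zero] at hweak
    rw [intervalIntegral.integral_add i4 i5, real_inner_smul_right] at hweak
    have e3 : ∫ t in (0 : ℝ)..T, ((inner ℝ (u t) v : ℝ) * ζ t +
        (bform β (D ι μ A (u t)) v V - inner ℝ (f t) v) * η t) =
        ∫ t in (0 : ℝ)..T, ((inner ℝ (u t) v : ℝ) * ζ t +
          (bform β (D ι μ A (u t)) v V * η t - inner ℝ (f t) v * η t)) := by
      simp only [sub_mul]
    rw [e3, intervalIntegral.integral_add i4 (i5.sub i6), intervalIntegral.integral_sub i5 i6]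
    linarith
  refine ⟨w, (Ioc 0 T).indicator fun s => D ι μ A (u s), (Ioc 0 T).indicator f,
    ⟨hwc, ?_, ?_, ?_, ?_⟩, hw, ?_, fun s hs => indicator_of_mem hs _,
    fun s hs => indicator_of_mem hs _⟩
  · filter_upwards [hmem, ae_restrict_mem measurableSet_Ioc] with s h1 h3
    rw [indicator_of_mem h3, hw (Ioc_subset_Icc_self h3)]
    exact hA.mem_graph_D h1
  · exact (memLp_indicator_iff_restrict measurableSet_Ioc).2 hUm
  · rw [intervalIntegrable_iff_integrableOn_Ioc_of_le hT.le] at hf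
    exact hf.integrable_indicator measurableSet_Ioc
  · intro v V hv s t hs hst ht
    obtain ⟨i3, h⟩ := key v V hv
    rw [hw ⟨hs, hst.trans ht⟩, hw ⟨hs.trans hst, ht⟩, h s ⟨hs, hst.trans ht⟩,
      h t ⟨hs.trans hst, ht⟩]
    have h3 : ∫ r in s..t, (bform β ((Ioc 0 T).indicator (fun s => D ι μ A (u s)) r) v V -
        inner ℝ ((Ioc 0 T).indicator f r) v) =
        ∫ r in s..t, (bform β (D ι μ A (u r)) v V - inner ℝ (f r) v) := by
      refine intervalIntegral.integral_congr_ae (.of_forall fun r hr => ?_)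
      rw [uIoc_of_le hst] at hr
      have : r ∈ Ioc 0 T := ⟨hs.trans_lt hr.1, hr.2.trans ht⟩
      rw [indicator_of_mem this, indicator_of_mem this]
    rw [h3, ← intervalIntegral.integral_add_adjacent_intervals (a := s) (b := t)
      (c := T) (i3.mono_set (by rw [uIcc_of_le hst, uIcc_of_le hT.le]; exact Icc_subset_Icc hs ht))
      (i3.mono_set (by
        rw [uIcc_of_le ht, uIcc_of_le hT.le]; exact Icc_subset_Icc_left (hs.trans hst)))]
    ring
  · rw [hw ⟨hT.le, le_rfl⟩]
    refine hP.eq_of_inner_test fun v V hv => ?_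
    have h3 := (key v V hv).2 T ⟨hT.le, le_rfl⟩
    rwa [intervalIntegral.integral_same, sub_zero] at h3

end Weak

end LinearEq
end

noncomputable section
namespace LinearEq

/-! ### Steklov averages. -/

section Steklov

variable {X : Type*} [NormedAddCommGroup X] [NormedSpace ℝ X]

/-- The Steklov average of `u` over `[s, s + ε]`. -/
def steklov (ε : ℝ) (u : ℝ → X) (s : ℝ) : X := ε⁻¹ • ∫ r in s..s + ε, u r

theorem steklov_eq_sub {u : ℝ → X} (hu : ∀ a b, IntervalIntegrable u volume a b) (ε s : ℝ) :
    steklov ε u s = ε⁻¹ • ((∫ r in (0 : ℝ)..s + ε, u r) - ∫ r in (0 : ℝ)..s, u r) := by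
  rw [steklov, intervalIntegral.integral_interval_sub_left (hu _ _) (hu _ _)]

theorem continuous_steklov {u : ℝ → X} (hu : ∀ a b, IntervalIntegrable u volume a b) (ε : ℝ) :
    Continuous (steklov ε u) := by
  have h := intervalIntegral.continuous_primitive hu 0
  have h1 : steklov ε u = fun s => ε⁻¹ • ((∫ r in (0 : ℝ)..s + ε, u r) - ∫ r in (0 : ℝ)..s, u r) :=
    funext (steklov_eq_sub hu ε)
  rw [h1]
  exact ((h.comp (continuous_add_const ε)).sub h).const_smul _

variable [CompleteSpace X]

theorem hasDerivAt_steklov {u : ℝ → X} (hu : Continuous u) (ε s : ℝ) :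
    HasDerivAt (steklov ε u) (ε⁻¹ • (u (s + ε) - u s)) s := by
  have h1 : steklov ε u = fun s => ε⁻¹ • ((∫ r in (0 : ℝ)..s + ε, u r) - ∫ r in (0 : ℝ)..s, u r) :=
    funext (steklov_eq_sub (fun a b => hu.intervalIntegrable a b) ε)
  have h2 (s : ℝ) : HasDerivAt (fun s => ∫ r in (0 : ℝ)..s, u r) (u s) s :=
    intervalIntegral.integral_hasDerivAt_right (hu.intervalIntegrable _ _)
      (hu.stronglyMeasurableAtFilter _ _) hu.continuousAt
  rw [h1]
  exact (((h2 (s + ε)).comp_add_const s ε).sub (h2 s)).const_smul _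

theorem tendsto_steklov {u : ℝ → X} (hu : Continuous u) (s : ℝ) :
    Tendsto (fun ε => steklov ε u s) (𝓝[>] 0) (𝓝 (u s)) := by
  have h2 : HasDerivAt (fun t => ∫ r in s..t, u r) (u s) s :=
    intervalIntegral.integral_hasDerivAt_right (hu.intervalIntegrable _ _)
      (hu.stronglyMeasurableAtFilter _ _) hu.continuousAt
  have h3 := hasDerivAt_iff_tendsto_slope_zero.1 h2
  simp only [intervalIntegral.integral_same, sub_zero] at h3
  exact h3.mono_left (nhdsWithin_mono _ fun t ht => ne_of_gt ht)

omit [NormedSpace ℝ X] [CompleteSpace X] in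
theorem tendsto_eLpNorm_translate {p : ℝ≥0∞} (hp1 : 1 ≤ p) (hp : p ≠ ⊤) {u : ℝ → X}
    (hu : MemLp u p volume) :
    Tendsto (fun h : ℝ => eLpNorm (fun s => u (s + h) - u s) p volume) (𝓝 0) (𝓝 0) := by
  have : Fact (1 ≤ p) := ⟨hp1⟩
  set g : C(ℝ, C(ℝ, ℝ)) := (ContinuousMap.mk (fun a : ℝ × ℝ => a.2 + a.1)
    (by fun_prop)).curry with hg
  have hmp (h : ℝ) : MeasurePreserving (g h) volume volume := measurePreserving_add_right volume h
  have hc : Continuous fun h => Lp.compMeasurePreserving (g h) (hmp h) (hu.toLp u) :=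
    Continuous.compMeasurePreservingLp continuous_const g.continuous hmp hp
  have h1 := (Lp.tendsto_Lp_iff_tendsto_eLpNorm' _ _).1 (hc.tendsto 0)
  refine h1.congr fun h => eLpNorm_congr_ae ?_
  have e (h : ℝ) : Lp.compMeasurePreserving (g h) (hmp h) (hu.toLp u) =ᵐ[volume]
      fun s => u (s + h) :=
    (Lp.coeFn_compMeasurePreserving _ (hmp h)).trans
      ((hmp h).quasiMeasurePreserving.ae_eq_comp hu.coeFn_toLp)
  filter_upwards [e h, e 0] with s h1 h2
  rw [Pi.sub_apply, h1, h2, add_zero]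

/-- The difference is the mean of u(· + r) - u over the uniform probability measure on (0, ε];
Jensen's inequality and Tonelli's theorem reduce it to the single translates. -/
theorem eLpNorm_steklov_sub_le {p : ℝ≥0∞} (hp1 : 1 ≤ p) (hp : p ≠ ⊤) {u : ℝ → X}
    (hu : MemLp u p volume) {ε : ℝ} (hε : 0 < ε) {η : ℝ≥0∞}
    (h : ∀ r ∈ Ioc 0 ε, eLpNorm (fun s => u (s + r) - u s) p volume ≤ η) :
    eLpNorm (steklov ε u - u) p volume ≤ η := by
  -- Tonelli's theorem needs joint measurability of (s, r) ↦ u(s + r), immediate for a strongly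
  -- measurable representative.
  wlog hm : StronglyMeasurable u generalizing u
  · obtain ⟨w, hw, huw⟩ := hu.aestronglyMeasurable
    have h1 := this (u := w) (hu.ae_eq huw) (fun r hr => ?_) hw
    · have h2 : steklov ε u = steklov ε w := by
        funext s
        rw [steklov, steklov, intervalIntegral.integral_congr_ae]
        filter_upwards [huw] with r hr _ using hr
      rw [h2]
      refine (eLpNorm_congr_ae ?_).trans_le h1
      filter_upwards [huw] with s hs
      rw [Pi.sub_apply, Pi.sub_apply, hs]
    · refine (eLpNorm_congr_ae ?_).trans_le (h r hr)
      have h3 := (measurePreserving_add_right volume r).quasiMeasurePreserving.ae_eq_comp huw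
      filter_upwards [huw, h3] with s h4 h5
      rw [h4]
      congr 1
      exact h5.symm
  have hp0 : p ≠ 0 := (zero_lt_one.trans_le hp1).ne'
  have hq : 0 < p.toReal := ENNReal.toReal_pos hp0 hp
  have hε0 : ENNReal.ofReal ε ≠ 0 := by simpa using hε
  set ν : Measure ℝ := (ENNReal.ofReal ε)⁻¹ • volume.restrict (Ioc 0 ε) with hν
  have : IsProbabilityMeasure ν := ⟨by
    rw [hν, Measure.smul_apply, Measure.restrict_apply_univ, Real.volume_Ioc, sub_zero,
      smul_eq_mul, ENNReal.inv_mul_cancel hε0 ENNReal.ofReal_ne_top]⟩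
  have hνmem : ∀ᵐ r ∂ν, r ∈ Ioc 0 ε :=
    Measure.ae_smul_measure (ae_restrict_mem measurableSet_Ioc) _
  have hint (s : ℝ) : Integrable (fun r => u (s + r)) ν := by
    have h1 : MemLp (fun r => u (s + r)) p volume :=
      hu.comp_measurePreserving (measurePreserving_add_left volume s)
    have h2 : MemLp (fun r => u (s + r)) p ν :=
      (h1.restrict _).smul_measure (ENNReal.inv_ne_top.2 hε0)
    exact h2.integrable hp1
  have hst (s : ℝ) : steklov ε u s - u s = ∫ r, (u (s + r) - u s) ∂ν := by
    rw [integral_sub (hint s) (integrable_const _), integral_const, probReal_univ, one_smul, hν,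
      integral_smul_measure, steklov, ENNReal.toReal_inv, ENNReal.toReal_ofReal hε.le,
      ← intervalIntegral.integral_of_le hε.le, intervalIntegral.integral_comp_add_left, add_zero]
  have hjensen (s : ℝ) : ‖steklov ε u s - u s‖ₑ ^ p.toReal ≤
      ∫⁻ r, ‖u (s + r) - u s‖ₑ ^ p.toReal ∂ν := by
    have hms : AEStronglyMeasurable (fun r => u (s + r) - u s) ν :=
      ((hint s).sub (integrable_const _)).aestronglyMeasurable
    have h1 : ‖steklov ε u s - u s‖ₑ ≤ eLpNorm (fun r => u (s + r) - u s) p ν := by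
      rw [hst]
      refine (enorm_integral_le_lintegral_enorm _).trans ?_
      rw [← eLpNorm_one_eq_lintegral_enorm]
      exact eLpNorm_le_eLpNorm_of_exponent_le hp1 hms
    refine (ENNReal.rpow_le_rpow h1 hq.le).trans_eq ?_
    rw [eLpNorm_eq_lintegral_rpow_enorm_toReal hp0 hp, ← ENNReal.rpow_mul,
      one_div_mul_cancel hq.ne', ENNReal.rpow_one]
  have hpow : ∫⁻ s, ‖steklov ε u s - u s‖ₑ ^ p.toReal ≤ η ^ p.toReal := by
    calc _ ≤ ∫⁻ s, ∫⁻ r, ‖u (s + r) - u s‖ₑ ^ p.toReal ∂ν := lintegral_mono hjensen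
      _ = ∫⁻ r, (∫⁻ s, ‖u (s + r) - u s‖ₑ ^ p.toReal) ∂ν := by
          refine lintegral_lintegral_swap ?_
          refine Measurable.aemeasurable ?_
          refine Measurable.pow_const ?_ _
          exact ((hm.comp_measurable (measurable_fst.add measurable_snd)).sub
            (hm.comp_measurable measurable_fst)).enorm
      _ ≤ ∫⁻ _, η ^ p.toReal ∂ν := by
          refine lintegral_mono_ae ?_
          filter_upwards [hνmem] with r hr
          have h1 := ENNReal.rpow_le_rpow (h r hr) hq.le
          rwa [eLpNorm_eq_lintegral_rpow_enorm_toReal hp0 hp, ← ENNReal.rpow_mul,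
            one_div_mul_cancel hq.ne', ENNReal.rpow_one] at h1
      _ = η ^ p.toReal := by simp
  rw [eLpNorm_eq_lintegral_rpow_enorm_toReal hp0 hp]
  refine (ENNReal.rpow_le_rpow hpow (by positivity)).trans_eq ?_
  rw [← ENNReal.rpow_mul, mul_one_div_cancel hq.ne', ENNReal.rpow_one]

theorem tendsto_eLpNorm_steklov {p : ℝ≥0∞} (hp1 : 1 ≤ p) (hp : p ≠ ⊤) {u : ℝ → X}
    (hu : MemLp u p volume) :
    Tendsto (fun ε => eLpNorm (steklov ε u - u) p volume) (𝓝[>] 0) (𝓝 0) := by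
  rw [ENNReal.tendsto_nhds_zero]
  intro η hη
  have h1 := ENNReal.tendsto_nhds_zero.1 (tendsto_eLpNorm_translate hp1 hp hu) η hη
  obtain ⟨δ, hδ, hb⟩ := Metric.eventually_nhds_iff.1 h1
  filter_upwards [Ioo_mem_nhdsGT hδ] with ε hε
  refine eLpNorm_steklov_sub_le hp1 hp hu hε.1 fun r hr => hb ?_
  rw [Real.dist_eq, sub_zero, abs_of_pos hr.1]
  exact hr.2.trans_lt hε.2

end Steklov

end LinearEq
end

noncomputable section
namespace LinearEq

/-! ### Mean convergence in time. -/

section Mean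

variable {G : Type*} [NormedAddCommGroup G] [NormedSpace ℝ G] {a : Type*} {l : Filter a}
  {p : ℝ≥0∞} {ν : Measure ℝ}

/-- Convergence of functions of time in the mean of order `p`. -/
structure TendstoMean (p : ℝ≥0∞) (ν : Measure ℝ) (X : a → ℝ → G) (l : Filter a) (Y : ℝ → G) :
    Prop where
  meas : ∀ i, AEStronglyMeasurable (X i) ν
  memLp : MemLp Y p ν
  lim : Tendsto (fun i => eLpNorm (X i - Y) p ν) l (𝓝 0)

theorem tendstoMean_steklov [CompleteSpace G] (hp1 : 1 ≤ p) (hp : p ≠ ⊤) {u : ℝ → G}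
    (hu : MemLp u p volume) (s : Set ℝ) :
    TendstoMean p (volume.restrict s) (fun ε => steklov ε u) (𝓝[>] 0) u where
  meas ε := by
    refine (continuous_steklov (fun a b => ?_) ε).aestronglyMeasurable
    have : IsFiniteMeasure (volume.restrict (uIoc a b)) := by unfold uIoc; infer_instance
    exact intervalIntegrable_iff.2 ((hu.restrict _).integrable hp1)
  memLp := hu.restrict s
  lim := tendsto_of_tendsto_of_tendsto_of_le_of_le tendsto_const_nhds
    (tendsto_eLpNorm_steklov hp1 hp hu) (fun _ => zero_le)
    fun _ => eLpNorm_mono_measure _ Measure.restrict_le_self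

omit [NormedSpace ℝ G] in
theorem TendstoMean.add {X X' : a → ℝ → G} {Y Y' : ℝ → G} (h : TendstoMean 1 ν X l Y)
    (h' : TendstoMean 1 ν X' l Y') :
    TendstoMean 1 ν (fun i s => X i s + X' i s) l fun s => Y s + Y' s where
  meas i := (h.meas i).add (h'.meas i)
  memLp := h.memLp.add h'.memLp
  lim := by
    have h1 := h.lim.add h'.lim
    rw [add_zero] at h1
    refine tendsto_of_tendsto_of_tendsto_of_le_of_le tendsto_const_nhds h1 (fun _ => zero_le)
      fun i => ?_
    have h2 : ((fun s => X i s + X' i s) - fun s => Y s + Y' s) = (X i - Y) + (X' i - Y') := by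
      ext s
      simp only [Pi.sub_apply, Pi.add_apply]
      abel
    simp only [h2]
    exact eLpNorm_add_le ((h.meas i).sub h.memLp.1) ((h'.meas i).sub h'.memLp.1) le_rfl

omit [NormedSpace ℝ G] in
theorem TendstoMean.sum {κ : Type*} (t : Finset κ) {X : κ → a → ℝ → G} {Y : κ → ℝ → G}
    (h : ∀ k ∈ t, TendstoMean 1 ν (X k) l (Y k)) :
    TendstoMean 1 ν (fun i s => ∑ k ∈ t, X k i s) l fun s => ∑ k ∈ t, Y k s := by
  classical
  induction t using Finset.induction_on with
  | empty =>
    simp only [Finset.sum_empty]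
    refine ⟨fun i => aestronglyMeasurable_const, MemLp.zero, ?_⟩
    simp only [sub_self]
    simpa using tendsto_const_nhds
  | insert k t hk ih =>
    simp only [Finset.sum_insert hk]
    exact (h k (Finset.mem_insert_self k t)).add
      (ih fun j hj => h j (Finset.mem_insert_of_mem hj))

theorem TendstoMean.clm {G' : Type*} [NormedAddCommGroup G'] [NormedSpace ℝ G'] (L : G →L[ℝ] G')
    {X : a → ℝ → G} {Y : ℝ → G} (h : TendstoMean p ν X l Y) :
    TendstoMean p ν (fun i s => L (X i s)) l fun s => L (Y s) where
  meas i := L.continuous.comp_aestronglyMeasurable (h.meas i)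
  memLp := L.comp_memLp' h.memLp
  lim := by
    have h1 : Tendsto (fun i => ENNReal.ofReal ‖L‖ * eLpNorm (X i - Y) p ν) l (𝓝 0) := by
      have := ENNReal.Tendsto.const_mul (a := ENNReal.ofReal ‖L‖) h.lim
        (Or.inr ENNReal.ofReal_ne_top)
      rwa [mul_zero] at this
    refine tendsto_of_tendsto_of_tendsto_of_le_of_le tendsto_const_nhds h1 (fun _ => zero_le)
      fun i => ?_
    refine eLpNorm_le_mul_eLpNorm_of_ae_le_mul (.of_forall fun s => ?_) p
    simp only [Pi.sub_apply, ← map_sub]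
    exact L.le_opNorm _

variable {E : Type*} [MeasurableSpace E] {μ : Measure E} [IsFiniteMeasure μ]

theorem TendstoMean.innerL1 {K : Type*} [NormedAddCommGroup K] [InnerProductSpace ℝ K]
    {V W : a → ℝ → Lp K 2 μ} {V₀ W₀ : ℝ → Lp K 2 μ} (hV : TendstoMean 2 ν V l V₀)
    (hW : TendstoMean 2 ν W l W₀) :
    TendstoMean 1 ν (fun i s => LinearEq.innerL1 (V i s) (W i s)) l
      fun s => LinearEq.innerL1 (V₀ s) (W₀ s) := by
  have hm {V W : ℝ → Lp K 2 μ} (hV : AEStronglyMeasurable V ν) (hW : AEStronglyMeasurable W ν) :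
      AEStronglyMeasurable (fun s => LinearEq.innerL1 (V s) (W s)) ν :=
    continuous_innerL1.comp_aestronglyMeasurable (hV.prodMk hW)
  have hle {V W : ℝ → Lp K 2 μ} (hV : AEStronglyMeasurable V ν) (hW : AEStronglyMeasurable W ν) :
      eLpNorm (fun s => LinearEq.innerL1 (V s) (W s)) 1 ν ≤ eLpNorm V 2 ν * eLpNorm W 2 ν := by
    have h := eLpNorm_le_eLpNorm_mul_eLpNorm'_of_norm (p := 2) (q := 2) (r := 1) hV hW
      (fun v w => LinearEq.innerL1 v w) 1 (.of_forall fun s => by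
        simpa using norm_innerL1_le (V s) (W s))
    simpa using h
  refine ⟨fun i => hm (hV.meas i) (hW.meas i), ⟨hm hV.memLp.1 hW.memLp.1, ?_⟩, ?_⟩
  · exact (hle hV.memLp.1 hW.memLp.1).trans_lt (ENNReal.mul_lt_top hV.memLp.2 hW.memLp.2)
  · have h1 : Tendsto (fun i => eLpNorm (V i - V₀) 2 ν * (eLpNorm (W i - W₀) 2 ν + eLpNorm W₀ 2 ν)
        + eLpNorm V₀ 2 ν * eLpNorm (W i - W₀) 2 ν) l (𝓝 0) := by
      have h2 := ENNReal.Tendsto.mul hV.lim (Or.inr (by simpa using hW.memLp.2.ne))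
        (hW.lim.add (tendsto_const_nhds (x := eLpNorm W₀ 2 ν))) (Or.inr ENNReal.zero_ne_top)
      have h3 := ENNReal.Tendsto.const_mul (a := eLpNorm V₀ 2 ν) hW.lim (Or.inr hV.memLp.2.ne)
      have h4 := h2.add h3
      rwa [zero_mul, mul_zero, add_zero] at h4
    refine tendsto_of_tendsto_of_tendsto_of_le_of_le tendsto_const_nhds h1 (fun _ => zero_le)
      fun i => ?_
    have h2 : ((fun s => LinearEq.innerL1 (V i s) (W i s)) - fun s =>
        LinearEq.innerL1 (V₀ s) (W₀ s)) =
        (fun s => LinearEq.innerL1 ((V i - V₀) s) (W i s)) +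
          fun s => LinearEq.innerL1 (V₀ s) ((W i - W₀) s) := by
      ext1 s
      simp only [Pi.sub_apply, Pi.add_apply, innerL1_sub_left, innerL1_sub_right]
      abel
    simp only [h2]
    have m1 := (hV.meas i).sub hV.memLp.1
    have m2 := (hW.meas i).sub hW.memLp.1
    refine (eLpNorm_add_le (hm m1 (hW.meas i)) (hm hV.memLp.1 m2) le_rfl).trans
      (add_le_add ((hle m1 (hW.meas i)).trans ?_) (hle hV.memLp.1 m2))
    gcongr
    calc eLpNorm (W i) 2 ν = eLpNorm ((W i - W₀) + W₀) 2 ν := by rw [sub_add_cancel]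
      _ ≤ _ := eLpNorm_add_le m2 hW.memLp.1 (by norm_num)

/-- The coefficients converge only for each fixed s, so the change of coefficient is tested on the
fixed limit Y, where dominated convergence in time applies. The change from X to Y costs the bound
of g. -/
theorem TendstoMean.mulN {κ : Type*} [Fintype κ] [l.IsCountablyGenerated]
    {g : (κ → ℝ) → ℝ} (hg : BC g)
    {y : a → ℝ → κ → Lp ℝ 2 μ} {u : ℝ → κ → Lp ℝ 2 μ} (hy : ∀ i, Continuous (y i))
    (hu : Continuous u) (hyu : ∀ s, Tendsto (fun i => y i s) l (𝓝 (u s)))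
    {X : a → ℝ → Lp ℝ 1 μ} {Y : ℝ → Lp ℝ 1 μ} (hX : TendstoMean 1 ν X l Y) :
    TendstoMean 1 ν (fun i s => LinearEq.mulN g (y i s) (X i s)) l
      fun s => LinearEq.mulN g (u s) (Y s) := by
  obtain ⟨C, hC0, hC⟩ := hg.bdd
  have hcont := hg.continuous_mulN (G := ℝ) (μ := μ) (p := 1) (by norm_num)
  have hm {y : ℝ → κ → Lp ℝ 2 μ} (hy : Continuous y) {X : ℝ → Lp ℝ 1 μ}
      (hX : AEStronglyMeasurable X ν) :
      AEStronglyMeasurable (fun s => LinearEq.mulN g (y s) (X s)) ν :=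
    hcont.comp_aestronglyMeasurable (hy.aestronglyMeasurable.prodMk hX)
  refine ⟨fun i => hm (hy i) (hX.meas i), ?_, ?_⟩
  · exact hX.memLp.of_le_mul (c := C) (hm hu hX.memLp.1)
      (.of_forall fun s => hg.norm_mulN_le hC _ _)
  · have h1 : Tendsto (fun i => ∫⁻ s, ‖LinearEq.mulN g (y i s) (Y s) -
        LinearEq.mulN g (u s) (Y s)‖ₑ ∂ν) l (𝓝 (∫⁻ _, 0 ∂ν)) := by
      refine tendsto_of_seq_tendsto fun ns hns => ?_
      refine tendsto_lintegral_of_dominated_convergence'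
        (fun s => ENNReal.ofReal (2 * C) * ‖Y s‖ₑ) ?_ ?_ ?_ ?_
      · exact fun n => ((hm (hy (ns n)) hX.memLp.1).sub (hm hu hX.memLp.1)).enorm
      · refine fun n => .of_forall fun s => ?_
        simp only
        rw [← ofReal_norm, ← ofReal_norm, ← ENNReal.ofReal_mul (by positivity)]
        refine ENNReal.ofReal_le_ofReal ((norm_sub_le _ _).trans ?_)
        linarith [hg.norm_mulN_le hC (y (ns n) s) (Y s), hg.norm_mulN_le hC (u s) (Y s)]
      · rw [lintegral_const_mul' _ _ ENNReal.ofReal_ne_top, ← eLpNorm_one_eq_lintegral_enorm]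
        exact (ENNReal.mul_lt_top ENNReal.ofReal_lt_top hX.memLp.2).ne
      · refine .of_forall fun s => ?_
        have h2 := hg.tendsto_mulN (G := ℝ) (p := 1) (by norm_num) ((hyu s).comp hns)
          (tendsto_const_nhds (x := Y s))
        have h3 := (h2.sub_const (LinearEq.mulN g (u s) (Y s))).enorm
        rwa [sub_self, enorm_zero] at h3
    rw [lintegral_zero] at h1
    have h2 : Tendsto (fun i => ENNReal.ofReal C * eLpNorm (X i - Y) 1 ν) l (𝓝 0) := by
      have := ENNReal.Tendsto.const_mul (a := ENNReal.ofReal C) hX.lim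
        (Or.inr ENNReal.ofReal_ne_top)
      rwa [mul_zero] at this
    have h3 := h2.add h1
    rw [add_zero] at h3
    refine tendsto_of_tendsto_of_tendsto_of_le_of_le tendsto_const_nhds h3 (fun _ => zero_le)
      fun i => ?_
    have h4 : ((fun s => LinearEq.mulN g (y i s) (X i s)) - fun s =>
        LinearEq.mulN g (u s) (Y s)) = (fun s => LinearEq.mulN g (y i s) ((X i - Y) s)) +
          fun s => LinearEq.mulN g (y i s) (Y s) - LinearEq.mulN g (u s) (Y s) := by
      ext1 s
      simp only [Pi.sub_apply, Pi.add_apply, ← hg.mulL_apply, map_sub]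
      abel
    simp only [h4]
    refine (eLpNorm_add_le (hm (hy i) ((hX.meas i).sub hX.memLp.1))
      ((hm (hy i) hX.memLp.1).sub (hm hu hX.memLp.1)) le_rfl).trans (add_le_add ?_ ?_)
    · exact eLpNorm_le_mul_eLpNorm_of_ae_le_mul
        (.of_forall fun s => hg.norm_mulN_le hC _ _) 1
    · rw [eLpNorm_one_eq_lintegral_enorm]
      rfl

theorem TendstoMean.tendsto_integral [CompleteSpace G] {S : ℝ → G →L[ℝ] G} (hS : IsC0 S) {t r : ℝ}
    (htr : t ≤ r) {X : a → ℝ → G} {Y : ℝ → G}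
    (h : TendstoMean 1 (volume.restrict (Ioc t r)) X l Y) :
    Tendsto (fun i => ∫ s in t..r, S (s - t) (X i s)) l (𝓝 (∫ s in t..r, S (s - t) (Y s))) := by
  obtain ⟨M, hM0, hM⟩ := hS.exists_bound (r - t)
  have hY : IntervalIntegrable Y volume t r :=
    (intervalIntegrable_iff_integrableOn_Ioc_of_le htr).2 (memLp_one_iff_integrable.1 h.memLp)
  have h1 : ∀ᶠ i in l, IntervalIntegrable (X i) volume t r := by
    filter_upwards [h.lim.eventually_lt_const one_pos] with i hi
    have h2 : MemLp (X i - Y) 1 (volume.restrict (Ioc t r)) :=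
      ⟨(h.meas i).sub h.memLp.1, hi.trans ENNReal.one_lt_top⟩
    have h3 := h2.add h.memLp
    rw [sub_add_cancel] at h3
    exact (intervalIntegrable_iff_integrableOn_Ioc_of_le htr).2 (memLp_one_iff_integrable.1 h3)
  have h2 : Tendsto (fun i => M * (eLpNorm (X i - Y) 1 (volume.restrict (Ioc t r))).toReal) l
      (𝓝 0) := by
    simpa using ((ENNReal.tendsto_toReal ENNReal.zero_ne_top).comp h.lim).const_mul M
  rw [tendsto_iff_norm_sub_tendsto_zero]
  refine squeeze_zero' (.of_forall fun _ => norm_nonneg _) ?_ h2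
  filter_upwards [h1] with i hi
  rw [← intervalIntegral.integral_sub (hS.intervalIntegrable_apply htr hi)
    (hS.intervalIntegrable_apply htr hY)]
  simp only [← map_sub]
  refine (IsC0.norm_integral_apply_le htr hM (hi.sub hY)).trans_eq ?_
  rw [intervalIntegral.integral_of_le htr, eLpNorm_one_eq_lintegral_enorm,
    ← integral_norm_eq_lintegral_enorm ((h.meas i).sub h.memLp.1)]
  rfl

end Mean

end LinearEq
end

noncomputable section
namespace LinearEq

/-! ### Moving scalar multipliers through the pairings. -/

section Algebra

variable {E : Type*} [MeasurableSpace E] {μ : Measure E} {κ : Type*} [Fintype κ]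
  {H : Type*} [NormedAddCommGroup H] [InnerProductSpace ℝ H]

theorem BC.innerL1_mulN_right {g : (κ → ℝ) → ℝ} (hg : BC g) (u : κ → Lp ℝ 2 μ) (V W : Lp H 2 μ) :
    innerL1 V (mulN g u W) = mulN g u (innerL1 V W) := by
  refine Lp.ext ?_
  filter_upwards [coeFn_innerL1 V (mulN g u W), coeFn_innerL1 V W, hg.coeFn_mulN u W,
    hg.coeFn_mulN u (innerL1 V W)] with z h1 h2 h3 h4
  rw [h1, h4, h2, h3, real_inner_smul_right, smul_eq_mul]

theorem BC.inner_mulN_comm {g : (κ → ℝ) → ℝ} (hg : BC g) (u : κ → Lp ℝ 2 μ) (V W : Lp H 2 μ) :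
    (inner ℝ (mulN g u V) W : ℝ) = inner ℝ V (mulN g u W) := by
  rw [L2.inner_def, L2.inner_def]
  refine integral_congr_ae ?_
  filter_upwards [hg.coeFn_mulN u V, hg.coeFn_mulN u W] with z h1 h2
  rw [h1, h2, real_inner_smul_left, real_inner_smul_right]

theorem BC.toL1_mulN [IsFiniteMeasure μ] {g : (κ → ℝ) → ℝ} (hg : BC g) (u : κ → Lp ℝ 2 μ)
    (X : Lp ℝ 2 μ) : toL1 (mulN g u X) = mulN g u (toL1 X) := by
  refine Lp.ext ?_
  filter_upwards [coeFn_toL1 (mulN g u X), coeFn_toL1 X, hg.coeFn_mulN u X,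
    hg.coeFn_mulN u (toL1 X)] with z h1 h2 h3 h4
  rw [h1, h4, h2, h3]

theorem innerL1_sum_right (V : Lp H 2 μ) (s : Finset κ) (W : κ → Lp H 2 μ) :
    innerL1 V (∑ j ∈ s, W j) = ∑ j ∈ s, innerL1 V (W j) := by
  simp only [innerL1_eq_holder, map_sum]

theorem inner_eq_pair [IsFiniteMeasure μ] {V Y k : Lp H 2 μ} {v : Lp ℝ 2 μ}
    (hk : k =ᵐ[μ] fun z => v z • Y z) : (inner ℝ V k : ℝ) = pair (innerL1 V Y) v := by
  rw [L2.inner_def, pair]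
  refine integral_congr_ae ?_
  filter_upwards [hk, coeFn_innerL1 V Y] with z h1 h2
  rw [h1, h2, real_inner_smul_right, mul_comm]

end Algebra

/-! ### The chain rule for solutions. -/

section Ito

variable {E H : Type*} [NormedAddCommGroup E] [NormedSpace ℝ E]
  [MeasurableSpace E] [BorelSpace E]
  [NormedAddCommGroup H] [InnerProductSpace ℝ H] [CompleteSpace H] [SecondCountableTopology H]
  [MeasurableSpace H] [BorelSpace H]
  {ι : H →L[ℝ] E} {μ : Measure E} {A : E → H →L[ℝ] H} [IsFiniteMeasure μ]
  {β : Lp H 2 μ} {α T : ℝ} {P : ℝ → Lp ℝ 2 μ →L[ℝ] Lp ℝ 2 μ}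
  {κ : Type*} [Fintype κ] {Φ : (κ → ℝ) → ℝ}

theorem bform_sum (s : Finset κ) (W : κ → Lp H 2 μ) {v : Lp ℝ 2 μ} {V : Lp H 2 μ}
    (hv : ∃ K, BddBy K v) : bform β (∑ i ∈ s, W i) v V = ∑ i ∈ s, bform β (W i) v V := by
  obtain ⟨k, hk⟩ := exists_smul_bdd β hv
  simp only [bform_eq_inner hk, inner_sum]

theorem exists_bddBy_compN {g : (κ → ℝ) → ℝ} (hg : BC g) (hl : LC g) (u : κ → Lp ℝ 2 μ) :
    ∃ K, BddBy K (compN g u) := by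
  obtain ⟨C, -, hC⟩ := hg.bdd
  refine ⟨C, ?_⟩
  filter_upwards [hl.coeFn_compN u] with z hz
  rw [hz]
  exact hC _

/-- The second order term of the chain rule. -/
def secondOrder (Φ : (κ → ℝ) → ℝ) (u : κ → Lp ℝ 2 μ) (U : κ → Lp H 2 μ) : Lp ℝ 1 μ :=
  ∑ i, ∑ j, mulN (pd (pd Φ i) j) u (innerL1 (U i) (U j))

/-- The first order term of the chain rule. -/
def firstOrder (Φ : (κ → ℝ) → ℝ) (u : κ → Lp ℝ 2 μ) (f : κ → Lp ℝ 2 μ) : Lp ℝ 1 μ :=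
  ∑ i, mulN (pd Φ i) u (toL1 (f i))

/-- The equation of uᵢ is tested with Φᵢ(u)v, again bounded and in F. By the product rule its
gradient is Φᵢ(u)V + v ∑ⱼ Φᵢⱼ(u)Uⱼ; the first part gives the form of Φᵢ(u)Uᵢ, the second the second
order term. -/
theorem bform_mulN (hΦ : Smooth2 Φ) {u : κ → Lp ℝ 2 μ} {U : κ → Lp H 2 μ}
    (hu : ∀ i, (u i, U i) ∈ graph ι μ A) {i : κ} {k : Lp ℝ 2 μ}
    (heq : ∀ v V, IsBddTest ι μ A v V → bform β (U i) v V = inner ℝ k v) {v : Lp ℝ 2 μ}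
    {V : Lp H 2 μ} (hv : IsBddTest ι μ A v V) :
    bform β (mulN (pd Φ i) u (U i)) v V = pair (mulN (pd Φ i) u (toL1 k)) v -
      pair (∑ j, mulN (pd (pd Φ i) j) u (innerL1 (U i) (U j))) v := by
  have hi := hΦ.smooth1_pd i
  have hg := hΦ.bc_pd i
  set Y : Lp H 2 μ := ∑ j, mulN (pd (pd Φ i) j) u (U j) with hY
  have hmem : (compN (pd Φ i) u, Y) ∈ graph ι μ A := mem_graph_compN hi hu
  obtain ⟨K, hK⟩ := exists_bddBy_compN hg hi.lc u
  obtain ⟨K', hK'⟩ := hv.bdd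
  obtain ⟨q, hq, hq1, hq2⟩ := exists_mem_graph_mul hmem hv.mem hK hK'
  obtain ⟨y, hy⟩ := exists_smul_bdd Y hv.bdd
  have hc := hi.lc.coeFn_compN u
  have hq1' : q.1 =ᵐ[μ] fun z => pd Φ i (fun j => u j z) * v z := by
    filter_upwards [hq1, hc] with z h1 h2
    rw [h1, h2]
  have hq2' : q.2 = mulN (pd Φ i) u V + y := by
    refine Lp.ext ?_
    filter_upwards [hq2, hc, hy, hg.coeFn_mulN u V, Lp.coeFn_add (mulN (pd Φ i) u V) y]
      with z h1 h2 h3 h4 h5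
    rw [h1, h5, Pi.add_apply, h4, h3, h2]
  have hbdd : ∃ K, BddBy K q.1 := by
    refine ⟨|K| * |K'|, ?_⟩
    filter_upwards [hq1, hK, hK'] with z h1 h2 h3
    rw [h1, abs_mul]
    exact mul_le_mul (h2.trans (le_abs_self K)) (h3.trans (le_abs_self K')) (abs_nonneg _)
      (abs_nonneg _)
  have h := heq q.1 q.2 ⟨hq, hbdd⟩
  have e1 : (inner ℝ k q.1 : ℝ) = pair (mulN (pd Φ i) u (toL1 k)) v := by
    rw [inner_eq_integral_mul, pair]
    refine integral_congr_ae ?_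
    filter_upwards [hq1', hg.coeFn_mulN u (toL1 k), coeFn_toL1 k] with z h1 h2 h3
    rw [h1, h2, h3, smul_eq_mul]
    ring
  have e2 : ∫ z, inner ℝ (β z) (U i z) * q.1 z ∂μ =
      ∫ z, inner ℝ (β z) (mulN (pd Φ i) u (U i) z) * v z ∂μ := by
    refine integral_congr_ae ?_
    filter_upwards [hq1', hg.coeFn_mulN u (U i)] with z h1 h2
    rw [h1, h2, real_inner_smul_right]
    ring
  have e3 : (inner ℝ (U i) q.2 : ℝ) = inner ℝ (mulN (pd Φ i) u (U i)) V +
      pair (∑ j, mulN (pd (pd Φ i) j) u (innerL1 (U i) (U j))) v := by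
    rw [hq2', inner_add_right, hg.inner_mulN_comm, inner_eq_pair hy, hY, innerL1_sum_right]
    simp only [(hi.bc_pd _).innerL1_mulN_right]
  rw [bform, e1, e2, e3] at h
  rw [bform]
  linarith

theorem bform_compN (hΦ : Smooth2 Φ) {u : κ → Lp ℝ 2 μ} {U : κ → Lp H 2 μ} {k : κ → Lp ℝ 2 μ}
    (hu : ∀ i, (u i, U i) ∈ graph ι μ A)
    (heq : ∀ i v V, IsBddTest ι μ A v V → bform β (U i) v V = inner ℝ (k i) v) {v : Lp ℝ 2 μ}
    {V : Lp H 2 μ} (hv : IsBddTest ι μ A v V) :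
    bform β (∑ i, mulN (pd Φ i) u (U i)) v V = pair (firstOrder Φ u k - secondOrder Φ u U) v := by
  rw [bform_sum _ _ hv.bdd, pair_sub _ _ hv.bdd, firstOrder, secondOrder, pair_sum _ _ hv.bdd,
    pair_sum _ _ hv.bdd, ← Finset.sum_sub_distrib]
  exact Finset.sum_congr rfl fun i _ => bform_mulN hΦ hu (heq i) hv

variable {u : ℝ → Lp ℝ 2 μ} {U : ℝ → Lp H 2 μ} {f : ℝ → Lp ℝ 2 μ}

theorem IsSol.intervalIntegrable (h : IsSol ι A β T u U f) (a b : ℝ) :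
    IntervalIntegrable U volume a b := by
  have : IsFiniteMeasure (volume.restrict (uIoc a b)) := by unfold uIoc; infer_instance
  exact intervalIntegrable_iff.2 ((h.memLp.restrict _).integrable (by norm_num))

/-- The pair is an average of elements of a closed subspace. The hypotheses on s keep the averaging
window inside [0, T]. -/
theorem IsSol.steklov_mem (h : IsSol ι A β T u U f) {ε s : ℝ} (hε : 0 < ε) (hs : 0 ≤ s)
    (hsT : s + ε ≤ T) : (steklov ε u s, steklov ε U s) ∈ graph ι μ A := by
  have hle : s ≤ s + ε := by linarith
  have i1 : IntegrableOn u (Ioc s (s + ε)) :=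
    (intervalIntegrable_iff_integrableOn_Ioc_of_le hle).1 (h.cont.intervalIntegrable _ _)
  have i2 : IntegrableOn U (Ioc s (s + ε)) :=
    (intervalIntegrable_iff_integrableOn_Ioc_of_le hle).1 (h.intervalIntegrable _ _)
  have h1 : (⨍ r in Ioc s (s + ε), (u r, U r)) ∈ (graph ι μ A : Set (Lp ℝ 2 μ × Lp H 2 μ)) := by
    refine (graph ι μ A).convex.set_average_mem isClosed_graph (by simp [hε]) (by simp) ?_
      (i1.prodMk i2)
    exact ae_restrict_of_ae_restrict_of_subset (Ioc_subset_Ioc hs hsT) h.mem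
  have h2 : (⨍ r in Ioc s (s + ε), (u r, U r)) = (steklov ε u s, steklov ε U s) := by
    rw [setAverage_eq, steklov, steklov, intervalIntegral.integral_of_le hle,
      intervalIntegral.integral_of_le hle, integral_pair i1 i2]
    simp [hε.le]
  rwa [h2] at h1

/-- The form is linear and continuous in the gradient, so the integrated equation over [s, s + ε]
becomes a stationary equation at s whose right-hand side is the time derivative of the averaged
solution plus the averaged source. -/
theorem IsSol.bform_steklov (h : IsSol ι A β T u U f) {ε s : ℝ} (hε : 0 < ε) (hs : 0 ≤ s)
    (hsT : s + ε ≤ T) {v : Lp ℝ 2 μ} {V : Lp H 2 μ} (hv : IsBddTest ι μ A v V) :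
    bform β (steklov ε U s) v V = inner ℝ (ε⁻¹ • (u (s + ε) - u s) + steklov ε f s) v := by
  obtain ⟨k, hk⟩ := exists_smul_bdd β hv.bdd
  have h1 := h.eq v V hv s (s + ε) hs (by linarith) hsT
  have i1 := h.intervalIntegrable s (s + ε)
  have i2 : IntervalIntegrable f volume s (s + ε) := h.integ.intervalIntegrable
  simp only [bform_eq_inner hk] at h1 ⊢
  have i3 : IntervalIntegrable (fun r => (inner ℝ (V + k) (U r) : ℝ)) volume s (s + ε) :=
    ⟨i1.1.const_inner _, i1.2.const_inner _⟩
  have i4 : IntervalIntegrable (fun r => (inner ℝ (f r) v : ℝ)) volume s (s + ε) :=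
    ⟨i2.1.inner_const v, i2.2.inner_const v⟩
  rw [intervalIntegral.integral_sub i3 i4] at h1
  have e1 : ∫ r in s..s + ε, (inner ℝ (V + k) (U r) : ℝ) = inner ℝ (V + k) (∫ r in s..s + ε, U r) :=
    (innerSL ℝ (V + k)).intervalIntegral_comp_comm i1
  have e2 : ∫ r in s..s + ε, (inner ℝ (f r) v : ℝ) = inner ℝ (∫ r in s..s + ε, f r) v := by
    simp only [fun r => real_inner_comm v (f r), real_inner_comm v (∫ r in s..s + ε, f r)]
    exact (innerSL ℝ v).intervalIntegral_comp_comm i2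
  rw [e1, e2] at h1
  rw [steklov, steklov, real_inner_smul_right, ← smul_add, real_inner_smul_left,
    inner_add_left (u (s + ε) - u s), inner_sub_left, h1]
  ring

variable {u f : κ → ℝ → Lp ℝ 2 μ} {U : κ → ℝ → Lp H 2 μ}

theorem continuous_secondOrder (hΦ : Smooth2 Φ) :
    Continuous fun q : (κ → Lp ℝ 2 μ) × (κ → Lp H 2 μ) => secondOrder Φ q.1 q.2 := by
  unfold secondOrder
  refine continuous_finsetSum _ fun i _ => continuous_finsetSum _ fun j _ => ?_
  have hq : Continuous fun q : (κ → Lp ℝ 2 μ) × (κ → Lp H 2 μ) => (q.2 i, q.2 j) :=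
    ((continuous_apply i).comp continuous_snd).prodMk ((continuous_apply j).comp continuous_snd)
  have hc : Continuous fun q : (κ → Lp ℝ 2 μ) × (κ → Lp H 2 μ) => innerL1 (q.2 i) (q.2 j) :=
    continuous_innerL1.comp hq
  exact (((hΦ.smooth1_pd i).bc_pd j).continuous_mulN (G := ℝ) (μ := μ) (p := 1)
    (by norm_num)).comp (continuous_fst.prodMk hc)

theorem continuous_firstOrder (hΦ : Smooth2 Φ) :
    Continuous fun q : (κ → Lp ℝ 2 μ) × (κ → Lp ℝ 2 μ) => firstOrder Φ q.1 q.2 := by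
  unfold firstOrder
  refine continuous_finsetSum _ fun i _ => ?_
  refine ((hΦ.bc_pd i).continuous_mulN (G := ℝ) (μ := μ) (p := 1)
    (by norm_num)).comp (continuous_fst.prodMk ?_)
  exact toL1L.continuous.comp ((continuous_apply i).comp continuous_snd)

theorem firstOrder_add (hΦ : Smooth2 Φ) (x k k' : κ → Lp ℝ 2 μ) :
    firstOrder Φ x (fun i => k i + k' i) = firstOrder Φ x k + firstOrder Φ x k' := by
  simp only [firstOrder, ← Finset.sum_add_distrib]
  refine Finset.sum_congr rfl fun i _ => ?_
  rw [← (hΦ.bc_pd i).mulN_add]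
  congr 1
  exact toL1L.map_add _ _

/-- The chain rule for Steklov averages of solutions. -/
theorem IsSol.chain_rule_steklov (hP : IsAssociated ι A β α T P)
    (h : ∀ i, IsSol ι A β T (u i) (U i) (f i)) (hΦ : Smooth2 Φ) {ε t r : ℝ} (hε : 0 < ε)
    (ht : 0 ≤ t) (htr : t ≤ r) (hr : r + ε ≤ T) :
    ∫ s in t..r, l1Ext (P (s - t))
        (secondOrder Φ (fun i => steklov ε (u i) s) (fun i => steklov ε (U i) s) -
          firstOrder Φ (fun i => steklov ε (u i) s) fun i => steklov ε (f i) s) =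
      l1Ext (P (r - t)) (toL1 (compN Φ fun i => steklov ε (u i) r)) -
        toL1 (compN Φ fun i => steklov ε (u i) t) := by
  have hQ := hP.c0_l1Ext
  have cu : Continuous fun s i => steklov ε (u i) s := continuous_pi fun i =>
    continuous_steklov (fun a b => (h i).cont.intervalIntegrable a b) ε
  have cU : Continuous fun s i => steklov ε (U i) s := continuous_pi fun i =>
    continuous_steklov (fun a b => (h i).intervalIntegrable a b) ε
  have cf : Continuous fun s i => steklov ε (f i) s := continuous_pi fun i =>
    continuous_steklov (fun a b => (h i).integ.intervalIntegrable) ε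
  have cg : Continuous fun s =>
      secondOrder Φ (fun i => steklov ε (u i) s) (fun i => steklov ε (U i) s) -
        firstOrder Φ (fun i => steklov ε (u i) s) fun i => steklov ε (f i) s :=
    ((continuous_secondOrder hΦ).comp (cu.prodMk cU)).sub
      ((continuous_firstOrder hΦ).comp (cu.prodMk cf))
  have cΦ : Continuous fun s => toL1 (compN Φ fun i => steklov ε (u i) s) :=
    toL1L.continuous.comp (hΦ.lc.continuous_compN.comp cu)
  have h1 := intervalIntegral.integral_eq_sub_of_hasDeriv_right_of_le htr
    (f := fun s => l1Ext (P (s - t)) (toL1 (compN Φ fun i => steklov ε (u i) s)))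
    (f' := fun s => l1Ext (P (s - t))
        (secondOrder Φ (fun i => steklov ε (u i) s) (fun i => steklov ε (U i) s) -
          firstOrder Φ (fun i => steklov ε (u i) s) fun i => steklov ε (f i) s))
    (hQ.continuousOn_apply (fun s hs => hs.1) cΦ.continuousOn) (fun s hs => ?_)
    (hQ.intervalIntegrable_apply htr (cg.intervalIntegrable _ _))
  · rw [h1, sub_self, hQ.zero_apply]
  · have hsε : s + ε ≤ T := by linarith [hs.2]
    have hs0 : 0 ≤ s := ht.trans hs.1.le
    have hmem (i : κ) := (h i).steklov_mem hε hs0 hsε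
    -- The composed average solves a weak equation with an L¹ right-hand side, hence lies in the
    -- domain of the L¹ generator.
    have hgen := hP.hasGen_of_weak (mem_graph_compN hΦ.toSmooth1 hmem) fun v V hv =>
      bform_compN hΦ hmem (fun i v V hv => (h i).bform_steklov hε hs0 hsε hv) hv
    have hder := hΦ.hasDerivWithinAt_toL1_compN (y := fun s i => steklov ε (u i) s) (s := Ioi s)
      fun i => (hasDerivAt_steklov (h i).cont ε s).hasDerivWithinAt
    have h2 := hQ.hasDerivWithinAt_apply hs.1.le hder hgen
    refine h2.congr_deriv ?_
    congr 1
    have h3 : ∑ i, toL1 (mulN (pd Φ i) (fun i => steklov ε (u i) s)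
        (ε⁻¹ • (u i (s + ε) - u i s))) =
        firstOrder Φ (fun i => steklov ε (u i) s) fun i => ε⁻¹ • (u i (s + ε) - u i s) :=
      Finset.sum_congr rfl fun i _ => (hΦ.bc_pd i).toL1_mulN _ _
    -- The difference quotients enter once through the time derivative and once, with opposite sign,
    -- through the generator; they cancel and only the source remains.
    rw [h3, firstOrder_add hΦ]
    abel

theorem IsSol.tendstoMean_secondOrder (h : ∀ i, IsSol ι A β T (u i) (U i) (f i)) (hΦ : Smooth2 Φ)
    (s : Set ℝ) : TendstoMean 1 (volume.restrict s)
      (fun ε s => secondOrder Φ (fun i => steklov ε (u i) s) (fun i => steklov ε (U i) s))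
      (𝓝[>] 0) fun s => secondOrder Φ (fun i => u i s) fun i => U i s := by
  unfold secondOrder
  refine TendstoMean.sum _ fun i _ => TendstoMean.sum _ fun j _ => ?_
  refine TendstoMean.mulN ((hΦ.smooth1_pd i).bc_pd j)
    (y := fun ε s i => steklov ε (u i) s) (u := fun s i => u i s)
    (fun ε => continuous_pi fun i =>
      continuous_steklov (fun a b => (h i).cont.intervalIntegrable a b) ε)
    (continuous_pi fun i => (h i).cont)
    (fun s => tendsto_pi_nhds.2 fun i => tendsto_steklov (h i).cont s) ?_
  exact (tendstoMean_steklov (by norm_num) (by norm_num) (h i).memLp s).innerL1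
    (tendstoMean_steklov (by norm_num) (by norm_num) (h j).memLp s)

theorem IsSol.tendstoMean_firstOrder (h : ∀ i, IsSol ι A β T (u i) (U i) (f i)) (hΦ : Smooth2 Φ)
    (s : Set ℝ) : TendstoMean 1 (volume.restrict s)
      (fun ε s => firstOrder Φ (fun i => steklov ε (u i) s) (fun i => steklov ε (f i) s))
      (𝓝[>] 0) fun s => firstOrder Φ (fun i => u i s) fun i => f i s := by
  unfold firstOrder
  refine TendstoMean.sum _ fun i _ => ?_
  refine TendstoMean.mulN (hΦ.bc_pd i)
    (y := fun ε s i => steklov ε (u i) s) (u := fun s i => u i s)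
    (fun ε => continuous_pi fun i =>
      continuous_steklov (fun a b => (h i).cont.intervalIntegrable a b) ε)
    (continuous_pi fun i => (h i).cont)
    (fun s => tendsto_pi_nhds.2 fun i => tendsto_steklov (h i).cont s) ?_
  exact (tendstoMean_steklov le_rfl (by norm_num)
    (memLp_one_iff_integrable.2 (h i).integ) s).clm toL1L

theorem IsSol.intervalIntegrable_secondOrder (h : ∀ i, IsSol ι A β T (u i) (U i) (f i))
    (hΦ : Smooth2 Φ) (a b : ℝ) : IntervalIntegrable
      (fun s => secondOrder Φ (fun i => u i s) fun i => U i s) volume a b :=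
  intervalIntegrable_iff.2 (memLp_one_iff_integrable.1 (tendstoMean_secondOrder h hΦ _).memLp)

theorem IsSol.intervalIntegrable_firstOrder (h : ∀ i, IsSol ι A β T (u i) (U i) (f i))
    (hΦ : Smooth2 Φ) (a b : ℝ) : IntervalIntegrable
      (fun s => firstOrder Φ (fun i => u i s) fun i => f i s) volume a b :=
  intervalIntegrable_iff.2 (memLp_one_iff_integrable.1 (tendstoMean_firstOrder h hΦ _).memLp)

/-- The chain rule for solutions. -/
theorem IsSol.chain_rule (hP : IsAssociated ι A β α T P)
    (h : ∀ i, IsSol ι A β T (u i) (U i) (f i)) (hΦ : Smooth2 Φ) {t : ℝ} (ht : t ∈ Icc 0 T) :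
    toL1 (compN Φ fun i => u i t) +
        ∫ s in t..T, l1Ext (P (s - t)) (secondOrder Φ (fun i => u i s) fun i => U i s) =
      l1Ext (P (T - t)) (toL1 (compN Φ fun i => u i T)) +
        ∫ s in t..T, l1Ext (P (s - t)) (firstOrder Φ (fun i => u i s) fun i => f i s) := by
  have hQ := hP.c0_l1Ext
  have i2 (r : ℝ) (hr : t ≤ r) := hQ.intervalIntegrable_apply hr
    (intervalIntegrable_secondOrder h hΦ t r)
  have i1 (r : ℝ) (hr : t ≤ r) := hQ.intervalIntegrable_apply hr
    (intervalIntegrable_firstOrder h hΦ t r)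
  have cu : Continuous fun s i => u i s := continuous_pi fun i => (h i).cont
  have cΦ : Continuous fun x : κ → Lp ℝ 2 μ => toL1 (compN Φ x) :=
    toL1L.continuous.comp hΦ.lc.continuous_compN
  -- Stopping at r < T leaves room for the forward averages: every ε < T - r is admissible. The
  -- endpoint is reached afterwards by continuity in r.
  have key (r : ℝ) (hr : r ∈ Ico t T) : toL1 (compN Φ fun i => u i t) +
        ∫ s in t..r, l1Ext (P (s - t)) (secondOrder Φ (fun i => u i s) fun i => U i s) =
      l1Ext (P (r - t)) (toL1 (compN Φ fun i => u i r)) +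
        ∫ s in t..r, l1Ext (P (s - t)) (firstOrder Φ (fun i => u i s) fun i => f i s) := by
    have l2 := (tendstoMean_secondOrder h hΦ (Ioc t r)).tendsto_integral hQ hr.1
    have l1 := (tendstoMean_firstOrder h hΦ (Ioc t r)).tendsto_integral hQ hr.1
    have l0 (s : ℝ) : Tendsto (fun ε => toL1 (compN Φ fun i => steklov ε (u i) s)) (𝓝[>] 0)
        (𝓝 (toL1 (compN Φ fun i => u i s))) :=
      (cΦ.tendsto _).comp (tendsto_pi_nhds.2 fun i => tendsto_steklov (h i).cont s)
    refine tendsto_nhds_unique ((l0 t).add l2)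
      (((((l1Ext (P (r - t))).continuous.tendsto _).comp (l0 r)).add l1).congr' ?_)
    filter_upwards [Ioo_mem_nhdsGT (sub_pos.2 hr.2)] with ε hε
    have h1 := chain_rule_steklov hP h hΦ hε.1 ht.1 hr.1 (by linarith [hε.2])
    have cu : Continuous fun s i => steklov ε (u i) s := continuous_pi fun i =>
      continuous_steklov (fun a b => (h i).cont.intervalIntegrable a b) ε
    have cU : Continuous fun s i => steklov ε (U i) s := continuous_pi fun i =>
      continuous_steklov (fun a b => (h i).intervalIntegrable a b) ε
    have cf : Continuous fun s i => steklov ε (f i) s := continuous_pi fun i =>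
      continuous_steklov (fun a b => (h i).integ.intervalIntegrable) ε
    have j2 := hQ.intervalIntegrable_apply hr.1
      (((continuous_secondOrder hΦ).comp (cu.prodMk cU)).intervalIntegrable t r)
    have j1 := hQ.intervalIntegrable_apply hr.1
      (((continuous_firstOrder hΦ).comp (cu.prodMk cf)).intervalIntegrable t r)
    simp only [map_sub] at h1
    have h2 := (intervalIntegral.integral_sub j2 j1).symm.trans h1
    simp only [Function.comp_apply] at h2 ⊢
    rw [sub_eq_sub_iff_add_eq_add] at h2
    rw [add_comm (toL1 _), h2]
  rcases ht.2.eq_or_lt with rfl | htT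
  · simp [hQ.zero_apply]
  have cint {g : ℝ → Lp ℝ 1 μ} (hg : IntervalIntegrable g volume t T) :
      ContinuousOn (fun r => ∫ s in t..r, g s) (Icc t T) := by
    have := intervalIntegral.continuousOn_primitive_interval' hg (left_mem_uIcc)
    rwa [uIcc_of_le ht.2] at this
  have heq : EqOn (fun r => toL1 (compN Φ fun i => u i t) +
        ∫ s in t..r, l1Ext (P (s - t)) (secondOrder Φ (fun i => u i s) fun i => U i s))
      (fun r => l1Ext (P (r - t)) (toL1 (compN Φ fun i => u i r)) +
        ∫ s in t..r, l1Ext (P (s - t)) (firstOrder Φ (fun i => u i s) fun i => f i s))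
      (Icc t T) := by
    refine EqOn.of_subset_closure (s := Ico t T) key ?_ ?_ Ico_subset_Icc_self
      (closure_Ico htT.ne).superset
    · exact continuousOn_const.add (cint (i2 T ht.2))
    · exact (hQ.continuousOn_apply (fun r hr => hr.1) (cΦ.comp cu).continuousOn).add
        (cint (i1 T ht.2))
  exact heq ⟨ht.2, le_rfl⟩

end Ito

end LinearEq
end

noncomputable section
namespace LinearEq

/-! ### Smooth approximations of the Euclidean norm and of its square. -/

section SmoothNorm

variable {κ : Type*} [Fintype κ]

/-- A smooth approximation of the Euclidean norm. -/
def smoothNorm (c : ℝ) (x : κ → ℝ) : ℝ := √(∑ k, x k ^ 2 + c)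

theorem sum_sq_nonneg (x : κ → ℝ) : 0 ≤ ∑ k, x k ^ 2 := Finset.sum_nonneg fun _ _ => sq_nonneg _

theorem abs_le_sqrt_sum_sq (x : κ → ℝ) (i : κ) : |x i| ≤ √(∑ k, x k ^ 2) :=
  Real.abs_le_sqrt (Finset.single_le_sum (f := fun k => x k ^ 2) (fun _ _ => sq_nonneg _)
    (Finset.mem_univ i))

open Classical in
theorem pd_eq_of_hasFDerivAt {Φ : (κ → ℝ) → ℝ} {L : (κ → ℝ) →L[ℝ] ℝ} {x : κ → ℝ}
    (h : HasFDerivAt Φ L x) (i : κ) : pd Φ i x = L (Pi.single i 1) := by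
  rw [pd, h.fderiv]

theorem pd_affine {Φ : (κ → ℝ) → ℝ} (h : Differentiable ℝ Φ) (a b : ℝ) (i : κ) :
    pd (fun x => a * Φ x - b) i = fun x => a * pd Φ i x := by
  classical
  funext x
  rw [pd_eq_of_hasFDerivAt (((h x).hasFDerivAt.const_mul a).sub_const b),
    pd_eq_of_hasFDerivAt (h x).hasFDerivAt]
  simp

variable {c : ℝ} (hc : 0 < c)
include hc

theorem sq_smoothNorm (x : κ → ℝ) : smoothNorm c x ^ 2 = ∑ k, x k ^ 2 + c :=
  Real.sq_sqrt (by have := sum_sq_nonneg x; linarith)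

theorem smoothNorm_pos (x : κ → ℝ) : 0 < smoothNorm c x :=
  Real.sqrt_pos.2 (by have := sum_sq_nonneg x; linarith)

theorem sqrt_sum_sq_le_smoothNorm (x : κ → ℝ) : √(∑ k, x k ^ 2) ≤ smoothNorm c x :=
  Real.sqrt_le_sqrt (by linarith)

theorem sqrt_le_smoothNorm (x : κ → ℝ) : √c ≤ smoothNorm c x :=
  Real.sqrt_le_sqrt (by have := sum_sq_nonneg x; linarith)

theorem abs_le_smoothNorm (x : κ → ℝ) (i : κ) : |x i| ≤ smoothNorm c x :=
  (abs_le_sqrt_sum_sq x i).trans (sqrt_sum_sq_le_smoothNorm hc x)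

theorem smoothNorm_le (x : κ → ℝ) : smoothNorm c x ≤ √(∑ k, x k ^ 2) + √c :=
by
  refine Real.sqrt_le_iff.2 ⟨by positivity, ?_⟩
  nlinarith [Real.sq_sqrt (sum_sq_nonneg x), Real.sq_sqrt hc.le,
    mul_nonneg (Real.sqrt_nonneg (∑ k, x k ^ 2)) (Real.sqrt_nonneg c)]

theorem contDiff_smoothNorm : ContDiff ℝ ∞ (smoothNorm c : (κ → ℝ) → ℝ) :=
  ContDiff.sqrt (by fun_prop) fun x => (by have := sum_sq_nonneg x; linarith : _ < _).ne'

theorem hasFDerivAt_smoothNorm (x : κ → ℝ) : HasFDerivAt (smoothNorm c)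
    ((smoothNorm c x)⁻¹ • ∑ k, x k • ContinuousLinearMap.proj (R := ℝ) (φ := fun _ : κ => ℝ) k)
    x := by
  have h1 : HasFDerivAt (fun x : κ → ℝ => ∑ k, x k ^ 2 + c)
      (∑ k, (2 * x k) • ContinuousLinearMap.proj (R := ℝ) (φ := fun _ : κ => ℝ) k) x := by
    refine (HasFDerivAt.fun_sum fun k _ => ?_).add_const c
    have h2 := (hasDerivAt_pow 2 (x k)).comp_hasFDerivAt x
      (ContinuousLinearMap.proj (R := ℝ) (φ := fun _ : κ => ℝ) k).hasFDerivAt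
    exact h2.congr_fderiv (by simp)
  refine (h1.sqrt (by have := sum_sq_nonneg x; linarith : _ < _).ne').congr_fderiv ?_
  ext d
  have := smoothNorm_pos hc x
  simp only [_root_.smul_apply, _root_.sum_apply, ContinuousLinearMap.proj_apply, smul_eq_mul,
    Finset.mul_sum]
  refine Finset.sum_congr rfl fun k _ => ?_
  change 1 / (2 * smoothNorm c x) * _ = _
  field_simp

theorem pd_smoothNorm (i : κ) : pd (smoothNorm c) i = fun x => x i * (smoothNorm c x)⁻¹ := by
  classical
  funext x
  rw [pd_eq_of_hasFDerivAt (hasFDerivAt_smoothNorm hc x)]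
  simp [Pi.single_apply, mul_comm]

open Classical in
theorem pd_pd_smoothNorm (i j : κ) (x : κ → ℝ) : pd (pd (smoothNorm c) i) j x =
    (smoothNorm c x)⁻¹ * ((if i = j then 1 else 0) - x i * x j / smoothNorm c x ^ 2) := by
  have hN := smoothNorm_pos hc x
  have h1 := (hasDerivAt_inv hN.ne').comp_hasFDerivAt x (hasFDerivAt_smoothNorm hc x)
  have h2 := (ContinuousLinearMap.proj (R := ℝ) (φ := fun _ : κ => ℝ) i).hasFDerivAt (x := x)
  have h3 := h2.mul h1
  rw [pd_smoothNorm hc]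
  refine (pd_eq_of_hasFDerivAt h3 j).trans ?_
  simp [Pi.single_apply]
  split_ifs <;> field_simp <;> ring

theorem abs_pd_smoothNorm_le (i : κ) (x : κ → ℝ) : |pd (smoothNorm c) i x| ≤ 1 := by
  have hN := smoothNorm_pos hc x
  rw [pd_smoothNorm hc, abs_mul, abs_inv, abs_of_pos hN, ← div_eq_mul_inv]
  exact div_le_one_of_le₀ (abs_le_smoothNorm hc x i) hN.le

theorem abs_pd_pd_smoothNorm_le (i j : κ) (x : κ → ℝ) :
    |pd (pd (smoothNorm c) i) j x| ≤ (√c)⁻¹ * 2 := by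
  classical
  have hN := smoothNorm_pos hc x
  rw [pd_pd_smoothNorm hc, abs_mul, abs_inv, abs_of_pos hN]
  have h1 : (smoothNorm c x)⁻¹ ≤ (√c)⁻¹ :=
    inv_anti₀ (Real.sqrt_pos.2 hc) (sqrt_le_smoothNorm hc x)
  refine mul_le_mul h1 ?_ (abs_nonneg _) (by positivity)
  have h2 : |x i * x j / smoothNorm c x ^ 2| ≤ 1 := by
    rw [abs_div, abs_mul, abs_of_pos (by positivity : 0 < smoothNorm c x ^ 2), sq]
    exact div_le_one_of_le₀ (mul_le_mul (abs_le_smoothNorm hc x i) (abs_le_smoothNorm hc x j)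
      (abs_nonneg _) hN.le) (by positivity)
  have h3 : |(if i = j then 1 else 0 : ℝ)| ≤ 1 := by split_ifs <;> simp
  have h4 := norm_sub_le (if i = j then 1 else 0 : ℝ) (x i * x j / smoothNorm c x ^ 2)
  simp only [Real.norm_eq_abs] at h4
  linarith

theorem smooth2_smoothNorm : Smooth2 (smoothNorm c : (κ → ℝ) → ℝ) where
  smooth := contDiff_smoothNorm hc
  bdd i := ⟨1, abs_pd_smoothNorm_le hc i⟩
  bdd2 i j := ⟨_, abs_pd_pd_smoothNorm_le hc i j⟩

omit hc in
/-- A smooth approximation of the square of the Euclidean norm, with bounded first derivatives. -/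
def quadApprox (c : ℝ) (x : κ → ℝ) : ℝ := 2 * √c * smoothNorm c x - 2 * c

theorem pd_quadApprox (i : κ) :
    pd (quadApprox c) i = fun x => 2 * √c * pd (smoothNorm c) i x :=
  pd_affine ((contDiff_smoothNorm hc).differentiable (by simp)) _ _ i

theorem pd_pd_quadApprox (i j : κ) :
    pd (pd (quadApprox c) i) j = fun x => 2 * √c * pd (pd (smoothNorm c) i) j x := by
  rw [pd_quadApprox hc]
  have := pd_affine ((contDiff_pd (contDiff_smoothNorm hc) i).differentiable (by simp))
    (2 * √c) 0 j
  simpa using this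

/-- The factor √c cancels the bound 2/√c of the Hessian of `smoothNorm`. Uniformity in c supplies
the majorant when c tends to infinity. -/
theorem abs_pd_pd_quadApprox_le (i j : κ) (x : κ → ℝ) :
    |pd (pd (quadApprox c) i) j x| ≤ 4 := by
  have h0 : 0 < √c := Real.sqrt_pos.2 hc
  rw [pd_pd_quadApprox hc, abs_mul, abs_of_pos (by positivity)]
  calc 2 * √c * |pd (pd (smoothNorm c) i) j x| ≤ 2 * √c * ((√c)⁻¹ * 2) := by
        gcongr; exact abs_pd_pd_smoothNorm_le hc i j x
    _ = 4 := by field_simp; norm_num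

theorem abs_pd_quadApprox_le (i : κ) (x : κ → ℝ) : |pd (quadApprox c) i x| ≤ 2 * |x i| := by
  have hN := smoothNorm_pos hc x
  have h0 : 0 < √c := Real.sqrt_pos.2 hc
  rw [pd_quadApprox hc, pd_smoothNorm hc]
  simp only [abs_mul, abs_inv, abs_of_pos hN, abs_of_pos h0, abs_two]
  rw [← div_eq_mul_inv, ← mul_div_assoc, div_le_iff₀ hN]
  nlinarith [sqrt_le_smoothNorm hc x, abs_nonneg (x i)]

theorem smooth2_quadApprox : Smooth2 (quadApprox c : (κ → ℝ) → ℝ) where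
  smooth := by
    have := contDiff_smoothNorm (κ := κ) hc
    unfold quadApprox
    fun_prop
  bdd i := ⟨2 * √c * 1, fun x => by
    have h0 : 0 < √c := Real.sqrt_pos.2 hc
    rw [pd_quadApprox hc, abs_mul, abs_of_pos (by positivity)]
    gcongr
    exact abs_pd_smoothNorm_le hc i x⟩
  bdd2 i j := ⟨4, abs_pd_pd_quadApprox_le hc i j⟩

/-- With N the smoothed norm, N² - c = |x|², so 2√c(N - √c) = 2√c|x|²/(N + √c), which in terms of ρ
= √c/N ≤ 1 is 2ρ/(1 + ρ) · |x|². As c → ∞, ρ → 1; both the domination by |x|² and the limit are read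
off. -/
theorem quadApprox_eq (x : κ → ℝ) :
    quadApprox c x = 2 * (√c * (smoothNorm c x)⁻¹) / (1 + √c * (smoothNorm c x)⁻¹) *
      ∑ k, x k ^ 2 := by
  have hN := smoothNorm_pos hc x
  have h0 : 0 < √c := Real.sqrt_pos.2 hc
  have h1 := sq_smoothNorm hc x
  have h2 := Real.sq_sqrt hc.le
  have h3 : ∑ k, x k ^ 2 = smoothNorm c x ^ 2 - √c ^ 2 := by linarith
  have h4 : 2 * c = 2 * √c ^ 2 := by rw [h2]
  rw [h3, quadApprox, h4]
  field_simp
  ring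

theorem abs_quadApprox_le (x : κ → ℝ) : |quadApprox c x| ≤ ∑ k, x k ^ 2 := by
  have hN := smoothNorm_pos hc x
  have h0 : 0 < √c := Real.sqrt_pos.2 hc
  rw [quadApprox_eq hc, abs_mul, abs_of_nonneg (sum_sq_nonneg x)]
  refine mul_le_of_le_one_left (sum_sq_nonneg x) ?_
  have h1 : √c * (smoothNorm c x)⁻¹ ≤ 1 := by
    rw [← div_eq_mul_inv]
    exact div_le_one_of_le₀ (sqrt_le_smoothNorm hc x) hN.le
  have h2 : 0 < √c * (smoothNorm c x)⁻¹ := by positivity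
  rw [abs_of_pos (by positivity), div_le_one (by positivity)]
  linarith

omit hc in
theorem tendsto_ratio (x : κ → ℝ) :
    Tendsto (fun n : ℕ => √((n : ℝ) + 1) * (smoothNorm ((n : ℝ) + 1) x)⁻¹) atTop (𝓝 1) := by
  have h1 : Tendsto (fun n : ℕ => √(1 + (∑ k, x k ^ 2) * (1 / ((n : ℝ) + 1)))) atTop (𝓝 1) := by
    have h2 := (tendsto_one_div_add_atTop_nhds_zero_nat (𝕜 := ℝ)).const_mul (∑ k, x k ^ 2)
    have h3 := (Real.continuous_sqrt.tendsto _).comp (h2.const_add 1)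
    simp only [mul_zero, add_zero, Real.sqrt_one] at h3
    exact h3
  have h2 := h1.inv₀ one_ne_zero
  rw [inv_one] at h2
  refine h2.congr fun n => ?_
  have hn : (0 : ℝ) < (n : ℝ) + 1 := by positivity
  have h3 : smoothNorm ((n : ℝ) + 1) x =
      √((n : ℝ) + 1) * √(1 + (∑ k, x k ^ 2) * (1 / ((n : ℝ) + 1))) := by
    rw [smoothNorm, ← Real.sqrt_mul hn.le]
    congr 1
    field_simp
    ring
  have h4 := Real.sqrt_pos.2 hn
  rw [h3, mul_inv, mul_inv_cancel_left₀ h4.ne']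

omit hc in
theorem tendsto_quadApprox (x : κ → ℝ) :
    Tendsto (fun n : ℕ => quadApprox ((n : ℝ) + 1) x) atTop (𝓝 (∑ k, x k ^ 2)) := by
  have h := tendsto_ratio x
  have h1 := ((h.const_mul 2).div (h.const_add 1) (by norm_num)).mul_const (∑ k, x k ^ 2)
  have h2 : (2 : ℝ) * 1 / (1 + 1) * ∑ k, x k ^ 2 = ∑ k, x k ^ 2 := by norm_num
  rw [h2] at h1
  exact h1.congr fun n => (quadApprox_eq (by positivity) x).symm

omit hc in
theorem tendsto_pd_quadApprox (i : κ) (x : κ → ℝ) :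
    Tendsto (fun n : ℕ => pd (quadApprox ((n : ℝ) + 1)) i x) atTop (𝓝 (2 * x i)) := by
  have h := (tendsto_ratio x).const_mul (2 * x i)
  rw [mul_one] at h
  refine h.congr fun n => ?_
  have hn : (0 : ℝ) < (n : ℝ) + 1 := by positivity
  rw [pd_quadApprox hn, pd_smoothNorm hn]
  ring

omit hc in
theorem tendsto_inv_smoothNorm (x : κ → ℝ) :
    Tendsto (fun n : ℕ => (smoothNorm ((n : ℝ) + 1) x)⁻¹) atTop (𝓝 0) := by
  have h1 : Tendsto (fun n : ℕ => √((n : ℝ) + 1)) atTop atTop :=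
    Real.tendsto_sqrt_atTop.comp (tendsto_atTop_add_const_right _ _ tendsto_natCast_atTop_atTop)
  refine tendsto_inv_atTop_zero.comp (tendsto_atTop_mono (fun n => ?_) h1)
  exact sqrt_le_smoothNorm (by positivity) x

open Classical in
omit hc in
theorem tendsto_pd_pd_quadApprox (i j : κ) (x : κ → ℝ) :
    Tendsto (fun n : ℕ => pd (pd (quadApprox ((n : ℝ) + 1)) i) j x) atTop
      (𝓝 (2 * if i = j then 1 else 0)) := by
  have h1 := (tendsto_ratio x).const_mul 2
  have h2 := ((tendsto_inv_smoothNorm x).pow 2).const_mul (x i * x j)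
  have h3 := h1.mul (h2.const_sub (if i = j then 1 else 0))
  rw [mul_one, zero_pow two_ne_zero, mul_zero, sub_zero] at h3
  refine h3.congr fun n => ?_
  have hn : (0 : ℝ) < (n : ℝ) + 1 := by positivity
  rw [pd_pd_quadApprox hn]
  simp only [pd_pd_smoothNorm hn]
  rw [inv_pow, div_eq_mul_inv]
  ring

omit hc in
theorem tendsto_smoothNorm (x : κ → ℝ) :
    Tendsto (fun n : ℕ => smoothNorm (1 / ((n : ℝ) + 1)) x) atTop (𝓝 (√(∑ k, x k ^ 2))) := by
  have h2 := (tendsto_one_div_add_atTop_nhds_zero_nat (𝕜 := ℝ)).const_add (∑ k, x k ^ 2)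
  rw [add_zero] at h2
  exact (Real.continuous_sqrt.tendsto _).comp h2

omit hc in
theorem tendsto_pd_smoothNorm (i : κ) (x : κ → ℝ) :
    Tendsto (fun n : ℕ => pd (smoothNorm (1 / ((n : ℝ) + 1))) i x) atTop
      (𝓝 (x i / √(∑ k, x k ^ 2))) := by
  have h (n : ℕ) : pd (smoothNorm (1 / ((n : ℝ) + 1))) i x =
      x i * (smoothNorm (1 / ((n : ℝ) + 1)) x)⁻¹ := by
    rw [pd_smoothNorm (by positivity)]
  simp only [h, div_eq_mul_inv (x i)]
  -- At the origin the approximations vanish, and so does the limit by the convention x / 0 = 0, in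
  -- agreement with x̂ = 0 there.
  rcases eq_or_ne (√(∑ k, x k ^ 2)) 0 with h0 | h0
  · have h1 : x i = 0 := by
      have := abs_le_sqrt_sum_sq x i
      rw [h0] at this
      exact abs_eq_zero.1 (le_antisymm this (abs_nonneg _))
    simp [h1]
  · exact ((tendsto_smoothNorm x).inv₀ h0).const_mul _

/-- Convexity of `smoothNorm`, applied to vectors of an inner product space. -/
theorem sum_pd_pd_smoothNorm_nonneg {H : Type*} [NormedAddCommGroup H] [InnerProductSpace ℝ H]
    (x : κ → ℝ) (U : κ → H) :
    0 ≤ ∑ i, ∑ j, pd (pd (smoothNorm c) i) j x * (inner ℝ (U i) (U j) : ℝ) := by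
  classical
  have hN := smoothNorm_pos hc x
  have h1 : ∑ i, ∑ j, pd (pd (smoothNorm c) i) j x * (inner ℝ (U i) (U j) : ℝ) =
      (smoothNorm c x)⁻¹ * (∑ i, ‖U i‖ ^ 2 - ‖∑ i, x i • U i‖ ^ 2 / smoothNorm c x ^ 2) := by
    have h2 : ‖∑ i, x i • U i‖ ^ 2 = ∑ i, ∑ j, x i * x j * (inner ℝ (U i) (U j) : ℝ) := by
      rw [← real_inner_self_eq_norm_sq, sum_inner]
      refine Finset.sum_congr rfl fun i _ => ?_
      rw [inner_sum]
      refine Finset.sum_congr rfl fun j _ => ?_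
      rw [real_inner_smul_left, real_inner_smul_right]
      ring
    rw [h2, Finset.sum_div, ← Finset.sum_sub_distrib, Finset.mul_sum]
    refine Finset.sum_congr rfl fun i _ => ?_
    have h3 : ‖U i‖ ^ 2 = ∑ j, (if i = j then 1 else 0) * (inner ℝ (U i) (U j) : ℝ) := by
      simp
    rw [h3, Finset.sum_div, ← Finset.sum_sub_distrib, Finset.mul_sum]
    refine Finset.sum_congr rfl fun j _ => ?_
    rw [pd_pd_smoothNorm hc]
    ring
  rw [h1]
  refine mul_nonneg (inv_nonneg.2 hN.le) (sub_nonneg.2 ?_)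
  rw [div_le_iff₀ (by positivity)]
  -- The Hessian is N⁻¹(I - x ⊗ x / N²); Cauchy–Schwarz and |x|² ≤ N² make it nonnegative on vectors
  -- of H.
  have h2 : ‖∑ i, x i • U i‖ ≤ ∑ i, |x i| * ‖U i‖ := by
    refine (norm_sum_le _ _).trans_eq (Finset.sum_congr rfl fun i _ => ?_)
    rw [norm_smul, Real.norm_eq_abs]
  have h3 := Finset.sum_mul_sq_le_sq_mul_sq Finset.univ (fun i => |x i|) fun i => ‖U i‖
  simp only [sq_abs] at h3
  calc ‖∑ i, x i • U i‖ ^ 2 ≤ (∑ i, |x i| * ‖U i‖) ^ 2 := by gcongr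
    _ ≤ (∑ i, x i ^ 2) * ∑ i, ‖U i‖ ^ 2 := h3
    _ ≤ (∑ i, ‖U i‖ ^ 2) * smoothNorm c x ^ 2 := by
        rw [mul_comm, sq_smoothNorm hc]
        gcongr
        linarith

end SmoothNorm

end LinearEq
end

noncomputable section
namespace LinearEq

/-! ### Dominated convergence for Duhamel integrals. -/

theorem IsC0.tendsto_integral_apply {X : Type*} [NormedAddCommGroup X] [NormedSpace ℝ X]
    [CompleteSpace X] {S : ℝ → X →L[ℝ] X} (hS : IsC0 S) {t r : ℝ} (htr : t ≤ r)
    {F : ℕ → ℝ → X} {Y : ℝ → X} {B : ℝ → ℝ}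
    (hF : ∀ n, AEStronglyMeasurable (F n) (volume.restrict (Ioc t r)))
    (hB : IntervalIntegrable B volume t r) (hFB : ∀ n s, ‖F n s‖ ≤ B s)
    (hlim : ∀ s, Tendsto (fun n => F n s) atTop (𝓝 (Y s))) :
    IntervalIntegrable (fun s => S (s - t) (Y s)) volume t r ∧
      Tendsto (fun n => ∫ s in t..r, S (s - t) (F n s)) atTop
        (𝓝 (∫ s in t..r, S (s - t) (Y s))) := by
  have hB' := (intervalIntegrable_iff_integrableOn_Ioc_of_le htr).1 hB
  have hFi (n : ℕ) : IntervalIntegrable (F n) volume t r :=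
    (intervalIntegrable_iff_integrableOn_Ioc_of_le htr).2
      (hB'.mono' (hF n) (.of_forall (hFB n)))
  have hY : IntervalIntegrable Y volume t r := by
    refine (intervalIntegrable_iff_integrableOn_Ioc_of_le htr).2 (hB'.mono' ?_ ?_)
    · exact aestronglyMeasurable_of_tendsto_ae atTop hF (.of_forall hlim)
    · exact .of_forall fun s => le_of_tendsto' (hlim s).norm fun n => hFB n s
  refine ⟨hS.intervalIntegrable_apply htr hY, ?_⟩
  obtain ⟨M, hM0, hM⟩ := hS.exists_bound (r - t)
  refine intervalIntegral.tendsto_integral_filter_of_dominated_convergence (fun s => M * B s) ?_ ?_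
    (hB.const_mul M) ?_
  · refine .of_forall fun n => ?_
    rw [uIoc_of_le htr]
    exact ((intervalIntegrable_iff_integrableOn_Ioc_of_le htr).1
      (hS.intervalIntegrable_apply htr (hFi n))).aestronglyMeasurable
  · refine .of_forall fun n => .of_forall fun s hs => ?_
    rw [uIoc_of_le htr] at hs
    have h1 := hM (s - t) ⟨by linarith [hs.1], by linarith [hs.2]⟩
    exact ((S (s - t)).le_of_opNorm_le h1 _).trans (mul_le_mul_of_nonneg_left (hFB n s) hM0)
  · exact .of_forall fun s _ => ((S (s - t)).continuous.tendsto _).comp (hlim s)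

/-! ### Order in L¹ and the limits of the approximating functions. -/

section Limits

variable {E : Type*} [MeasurableSpace E] {μ : Measure E} [IsFiniteMeasure μ]
  {H : Type*} [NormedAddCommGroup H] [InnerProductSpace ℝ H]

theorem coeFn_sum_congr {κ : Type*} {p : ℝ≥0∞} (t : Finset κ) {F : κ → Lp ℝ p μ} {g : κ → E → ℝ}
    (h : ∀ i, F i =ᵐ[μ] g i) : ⇑(∑ i ∈ t, F i) =ᵐ[μ] fun z => ∑ i ∈ t, g i z := by
  classical
  induction t using Finset.induction_on with
  | empty =>
    filter_upwards [Lp.coeFn_zero ℝ p μ] with z hz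
    simpa using hz
  | insert i t hi ih =>
    rw [Finset.sum_insert hi]
    filter_upwards [Lp.coeFn_add (F i) (∑ i ∈ t, F i), h i, ih] with z h1 h2 h3
    rw [h1, Pi.add_apply, h2, h3, Finset.sum_insert hi]

theorem toL1_nonneg {u : Lp ℝ 2 μ} : 0 ≤ toL1 u ↔ 0 ≤ u := by
  rw [← Lp.coeFn_nonneg, ← Lp.coeFn_nonneg]
  constructor <;> intro h <;> filter_upwards [h, coeFn_toL1 u] with z h1 h2
  · rwa [← h2]
  · rwa [h2]

theorem toL1_le_toL1 {u v : Lp ℝ 2 μ} : toL1 u ≤ toL1 v ↔ u ≤ v := by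
  rw [← sub_nonneg, ← sub_nonneg (a := v)]
  exact (iff_of_eq (congrArg (0 ≤ ·) (toL1L.map_sub v u).symm)).trans toL1_nonneg

theorem smul_nonneg_L1 {a : ℝ} (ha : 0 ≤ a) {F : Lp ℝ 1 μ} (hF : 0 ≤ F) : 0 ≤ a • F := by
  rw [← Lp.coeFn_nonneg] at hF ⊢
  filter_upwards [hF, Lp.coeFn_smul a F] with z h1 h2
  rw [h2]
  exact mul_nonneg ha h1

/-- F = |F| is the L¹ limit of the moduli of L² functions, on which the extension agrees with the
positive operator S. -/
theorem l1Ext_nonneg {S : Lp ℝ 2 μ →L[ℝ] Lp ℝ 2 μ} (h : IsL1Ext S (l1Ext S))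
    (hS : ∀ u, 0 ≤ u → 0 ≤ S u) {F : Lp ℝ 1 μ} (hF : 0 ≤ F) : 0 ≤ l1Ext S F := by
  obtain ⟨k, -, hk⟩ := exists_bddBy_tendsto_L1 F
  have h1 : Tendsto (fun n => |toL1 (k n)|) atTop (𝓝 F) := by
    have h2 : Tendsto (fun n => |toL1 (k n)|) atTop (𝓝 |F|) := hk.sup_nhds hk.neg
    rwa [abs_of_nonneg hF] at h2
  refine ge_of_tendsto' (((l1Ext S).continuous.tendsto F).comp h1) fun n => ?_
  have h2 : |toL1 (k n)| = toL1 |k n| := by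
    refine Lp.ext ?_
    filter_upwards [Lp.coeFn_abs (toL1 (k n)), coeFn_toL1 (k n), coeFn_toL1 |k n|,
      Lp.coeFn_abs (k n)] with z h1 h2 h3 h4
    rw [h1, h2, h3, h4]
  rw [Function.comp_apply, h2, h |k n|]
  exact toL1_nonneg.2 (hS _ (abs_nonneg _))

variable {κ : Type*} [Fintype κ] {Φ : (κ → ℝ) → ℝ}

theorem coeFn_secondOrder (hΦ : Smooth2 Φ) (u : κ → Lp ℝ 2 μ) (U : κ → Lp H 2 μ) :
    secondOrder Φ u U =ᵐ[μ] fun z =>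
      ∑ i, ∑ j, pd (pd Φ i) j (fun k => u k z) * (inner ℝ (U i z) (U j z) : ℝ) := by
  refine coeFn_sum_congr _ fun i => coeFn_sum_congr _ fun j => ?_
  filter_upwards [((hΦ.smooth1_pd i).bc_pd j).coeFn_mulN u (innerL1 (U i) (U j)),
    coeFn_innerL1 (U i) (U j)] with z h1 h2
  rw [h1, h2, smul_eq_mul]

theorem coeFn_firstOrder (hΦ : Smooth2 Φ) (u f : κ → Lp ℝ 2 μ) :
    firstOrder Φ u f =ᵐ[μ] fun z => ∑ i, pd Φ i (fun k => u k z) * f i z := by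
  refine coeFn_sum_congr _ fun i => ?_
  filter_upwards [(hΦ.bc_pd i).coeFn_mulN u (toL1 (f i)), coeFn_toL1 (f i)] with z h1 h2
  rw [h1, h2, smul_eq_mul]

theorem coeFn_sumInnerL1 {l : ℕ} (v w : Fin l → Lp H 2 μ) :
    sumInnerL1 v w =ᵐ[μ] fun z => ∑ i, (inner ℝ (v i z) (w i z) : ℝ) :=
  coeFn_sum_congr _ fun i => coeFn_innerL1 (v i) (w i)

theorem secondOrder_smoothNorm_nonneg {c : ℝ} (hc : 0 < c) (u : κ → Lp ℝ 2 μ) (U : κ → Lp H 2 μ) :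
    0 ≤ secondOrder (smoothNorm c) u U := by
  rw [← Lp.coeFn_nonneg]
  filter_upwards [coeFn_secondOrder (smooth2_smoothNorm hc) u U] with z hz
  rw [hz]
  exact sum_pd_pd_smoothNorm_nonneg hc _ _

theorem norm_secondOrder_le (hΦ : Smooth2 Φ) {C : ℝ} (hC : ∀ i j x, |pd (pd Φ i) j x| ≤ C)
    (u : κ → Lp ℝ 2 μ) (U : κ → Lp H 2 μ) :
    ‖secondOrder Φ u U‖ ≤ ∑ i, ∑ j, C * (‖U i‖ * ‖U j‖) := by
  refine norm_sum_le_of_le _ fun i _ => norm_sum_le_of_le _ fun j _ => ?_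
  refine (((hΦ.smooth1_pd i).bc_pd j).norm_mulN_le (hC i j) u _).trans ?_
  have hC0 : 0 ≤ C := (abs_nonneg _).trans (hC i j 0)
  exact mul_le_mul_of_nonneg_left (norm_innerL1_le _ _) hC0

theorem norm_firstOrder_le (hΦ : Smooth2 Φ) {C : ℝ} (hC : ∀ i x, |pd Φ i x| ≤ C * |x i|)
    (u f : κ → Lp ℝ 2 μ) : ‖firstOrder Φ u f‖ ≤ ∑ i, C * ‖innerL1 (u i) (f i)‖ := by
  refine norm_sum_le_of_le _ fun i _ => Lp.norm_le_mul_norm_of_ae_le_mul ?_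
  filter_upwards [(hΦ.bc_pd i).coeFn_mulN u (toL1 (f i)), coeFn_toL1 (f i),
    coeFn_innerL1 (u i) (f i)] with z h1 h2 h3
  rw [h1, h2, h3, norm_smul, Real.norm_eq_abs, Real.norm_eq_abs, Real.norm_eq_abs]
  have h4 : |(inner ℝ (u i z) (f i z) : ℝ)| = |u i z| * |f i z| := by
    rw [← abs_mul, mul_comm]
    simp
  rw [h4, ← mul_assoc]
  exact mul_le_mul_of_nonneg_right (hC i _) (abs_nonneg _)

variable {l : ℕ}

theorem tendsto_compN_quadApprox (x : Fin l → Lp ℝ 2 μ) :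
    Tendsto (fun n : ℕ => toL1 (compN (quadApprox ((n : ℝ) + 1)) x)) atTop
      (𝓝 (sumInnerL1 x x)) := by
  have hs (n : ℕ) : Smooth2 (quadApprox ((n : ℝ) + 1) : (Fin l → ℝ) → ℝ) :=
    smooth2_quadApprox (by positivity)
  have h1 (n : ℕ) : toL1 (compN (quadApprox ((n : ℝ) + 1)) x) =ᵐ[μ]
      fun z => quadApprox ((n : ℝ) + 1) fun i => x i z :=
    (coeFn_toL1 _).trans ((hs n).lc.coeFn_compN x)
  have h2 : sumInnerL1 x x =ᵐ[μ] fun z => ∑ i, x i z ^ 2 := by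
    filter_upwards [coeFn_sumInnerL1 x x] with z hz
    rw [hz]
    exact Finset.sum_congr rfl fun i _ => by simp [sq]
  refine tendsto_Lp_of_dominated (by norm_num) (Lp.memLp (sumInnerL1 x x)).norm (fun n => ?_) ?_
  · filter_upwards [h1 n, h2] with z e1 e2
    rw [e1, e2, Real.norm_eq_abs, Real.norm_of_nonneg (sum_sq_nonneg fun i => x i z)]
    exact abs_quadApprox_le (by positivity) _
  · filter_upwards [ae_all_iff.2 h1, h2] with z e1 e2
    simp only [e1, e2]
    exact tendsto_quadApprox _

theorem tendsto_secondOrder_quadApprox (u : Fin l → Lp ℝ 2 μ) (U : Fin l → Lp H 2 μ) :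
    Tendsto (fun n : ℕ => secondOrder (quadApprox ((n : ℝ) + 1)) u U) atTop
      (𝓝 ((2 : ℝ) • sumInnerL1 U U)) := by
  classical
  have hs (n : ℕ) : Smooth2 (quadApprox ((n : ℝ) + 1) : (Fin l → ℝ) → ℝ) :=
    smooth2_quadApprox (by positivity)
  have h1 (n : ℕ) := coeFn_secondOrder (hs n) u U
  have hb : MemLp (fun z => ∑ i, ∑ j, 4 * ‖innerL1 (U i) (U j) z‖) 1 μ :=
    memLp_finsetSum _ fun i _ => memLp_finsetSum _ fun j _ => (Lp.memLp _).norm.const_mul 4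
  have h3 := ae_all_iff.2 fun i => ae_all_iff.2 fun j => coeFn_innerL1 (U i) (U j)
  refine tendsto_Lp_of_dominated (by norm_num) hb (fun n => ?_) ?_
  · filter_upwards [h1 n, h3] with z e1 e3
    rw [e1]
    refine norm_sum_le_of_le _ fun i _ => norm_sum_le_of_le _ fun j _ => ?_
    rw [e3, norm_mul]
    exact mul_le_mul_of_nonneg_right (abs_pd_pd_quadApprox_le (by positivity) i j _)
      (norm_nonneg _)
  · filter_upwards [ae_all_iff.2 h1, coeFn_sumInnerL1 U U,
      Lp.coeFn_smul (2 : ℝ) (sumInnerL1 U U)] with z e1 e2 e3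
    simp only [e1]
    rw [e3, Pi.smul_apply, e2, smul_eq_mul, Finset.mul_sum]
    refine tendsto_finsetSum _ fun i _ => ?_
    have h4 : 2 * (inner ℝ (U i z) (U i z) : ℝ) =
        ∑ j, (2 * if i = j then 1 else 0) * (inner ℝ (U i z) (U j z) : ℝ) := by
      simp
    rw [h4]
    refine tendsto_finsetSum _ fun j _ => ?_
    convert (tendsto_pd_pd_quadApprox i j fun k => u k z).mul_const
      (inner ℝ (U i z) (U j z) : ℝ)

theorem tendsto_firstOrder_quadApprox (u f : Fin l → Lp ℝ 2 μ) :
    Tendsto (fun n : ℕ => firstOrder (quadApprox ((n : ℝ) + 1)) u f) atTop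
      (𝓝 ((2 : ℝ) • sumInnerL1 u f)) := by
  have hs (n : ℕ) : Smooth2 (quadApprox ((n : ℝ) + 1) : (Fin l → ℝ) → ℝ) :=
    smooth2_quadApprox (by positivity)
  have h1 (n : ℕ) := coeFn_firstOrder (hs n) u f
  have hb : MemLp (fun z => ∑ i, 2 * ‖innerL1 (u i) (f i) z‖) 1 μ :=
    memLp_finsetSum _ fun i _ => (Lp.memLp _).norm.const_mul 2
  have h3 := ae_all_iff.2 fun i => coeFn_innerL1 (u i) (f i)
  have h4 (x y : ℝ) : (inner ℝ x y : ℝ) = x * y := by simp [mul_comm]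
  refine tendsto_Lp_of_dominated (by norm_num) hb (fun n => ?_) ?_
  · filter_upwards [h1 n, h3] with z e1 e3
    rw [e1]
    refine norm_sum_le_of_le _ fun i _ => ?_
    rw [e3, h4, norm_mul, norm_mul, ← mul_assoc]
    exact mul_le_mul_of_nonneg_right (abs_pd_quadApprox_le (by positivity) i _) (norm_nonneg _)
  · filter_upwards [ae_all_iff.2 h1, coeFn_sumInnerL1 u f,
      Lp.coeFn_smul (2 : ℝ) (sumInnerL1 u f)] with z e1 e2 e3
    simp only [e1]
    rw [e3, Pi.smul_apply, e2, smul_eq_mul, Finset.mul_sum]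
    refine tendsto_finsetSum _ fun i _ => ?_
    rw [h4, ← mul_assoc]
    exact (tendsto_pd_quadApprox i _).mul_const _

theorem tendsto_compN_smoothNorm (x : Fin l → Lp ℝ 2 μ) :
    Tendsto (fun n : ℕ => compN (smoothNorm (1 / ((n : ℝ) + 1))) x) atTop (𝓝 (euclNorm x)) := by
  have hc (n : ℕ) : (0 : ℝ) < 1 / ((n : ℝ) + 1) := by positivity
  have h1 (n : ℕ) := (smooth2_smoothNorm (κ := Fin l) (hc n)).lc.coeFn_compN x
  have h2 : euclNorm x =ᵐ[μ] fun z => √(∑ i, x i z ^ 2) := MemLp.coeFn_toLp _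
  refine tendsto_Lp_of_dominated (by norm_num)
    ((Lp.memLp (euclNorm x)).norm.add (memLp_const (1 : ℝ))) (fun n => ?_) ?_
  · filter_upwards [h1 n, h2] with z e1 e2
    rw [e1, Pi.add_apply, e2, Real.norm_of_nonneg (smoothNorm_pos (hc n) _).le,
      Real.norm_of_nonneg (Real.sqrt_nonneg _)]
    refine (smoothNorm_le (hc n) _).trans (add_le_add_right ?_ _)
    rw [Real.sqrt_le_left zero_le_one, one_pow, div_le_one (by positivity)]
    linarith [n.cast_nonneg (α := ℝ)]
  · filter_upwards [ae_all_iff.2 h1, h2] with z e1 e2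
    simp only [e1, e2]
    exact tendsto_smoothNorm _

/-- The approximation of `hatInner` by means of `smoothNorm`. -/
def approxHat (c : ℝ) (u f : Fin l → Lp ℝ 2 μ) : Lp ℝ 2 μ := ∑ i, mulN (pd (smoothNorm c) i) u (f i)

/-- Since `smoothNorm` has bounded first derivatives, its first order term is an L² function; the
comparison can thus be integrated in L² although the chain rule lives in L¹. -/
theorem toL1_approxHat {c : ℝ} (hc : 0 < c) (u f : Fin l → Lp ℝ 2 μ) :
    toL1 (approxHat c u f) = firstOrder (smoothNorm c) u f := by
  change toL1L (approxHat c u f) = _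
  rw [approxHat, map_sum, firstOrder]
  exact Finset.sum_congr rfl fun i _ => ((smooth2_smoothNorm hc).bc_pd i).toL1_mulN u (f i)

theorem norm_approxHat_le {c : ℝ} (hc : 0 < c) (u f : Fin l → Lp ℝ 2 μ) :
    ‖approxHat c u f‖ ≤ ∑ i, ‖f i‖ := by
  refine norm_sum_le_of_le _ fun i _ => ?_
  simpa using ((smooth2_smoothNorm hc).bc_pd i).norm_mulN_le (abs_pd_smoothNorm_le hc i) u (f i)

theorem tendsto_approxHat (u f : Fin l → Lp ℝ 2 μ) :
    Tendsto (fun n : ℕ => approxHat (1 / ((n : ℝ) + 1)) u f) atTop (𝓝 (hatInner u f)) := by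
  have hc (n : ℕ) : (0 : ℝ) < 1 / ((n : ℝ) + 1) := by positivity
  have h1 (n : ℕ) : approxHat (1 / ((n : ℝ) + 1)) u f =ᵐ[μ] fun z =>
      ∑ i, pd (smoothNorm (1 / ((n : ℝ) + 1))) i (fun k => u k z) * f i z := by
    refine coeFn_sum_congr _ fun i => ?_
    filter_upwards [((smooth2_smoothNorm (hc n)).bc_pd i).coeFn_mulN u (f i)] with z h1
    rw [h1, smul_eq_mul]
  have h2 : hatInner u f =ᵐ[μ] fun z => ∑ i, u i z / √(∑ j, u j z ^ 2) * f i z :=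
    MemLp.coeFn_toLp _
  refine tendsto_Lp_of_dominated (by norm_num) (memLp_sum_abs f) (fun n => ?_) ?_
  · filter_upwards [h1 n] with z e1
    rw [e1]
    refine norm_sum_le_of_le _ fun i _ => ?_
    rw [norm_mul]
    exact mul_le_of_le_one_left (norm_nonneg _) (abs_pd_smoothNorm_le (hc n) i _)
  · filter_upwards [ae_all_iff.2 h1, h2] with z e1 e2
    simp only [e1, e2]
    exact tendsto_finsetSum _ fun i _ => (tendsto_pd_smoothNorm i _).mul_const _

end Limits

/-! ### Energy identity and comparison. -/

section Main

variable {E H : Type*} [NormedAddCommGroup E] [NormedSpace ℝ E]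
  [MeasurableSpace E] [BorelSpace E]
  [NormedAddCommGroup H] [InnerProductSpace ℝ H] [CompleteSpace H] [SecondCountableTopology H]
  [MeasurableSpace H] [BorelSpace H]
  {ι : H →L[ℝ] E} {μ : Measure E} {A : E → H →L[ℝ] H} [IsFiniteMeasure μ]
  {β : Lp H 2 μ} {α T : ℝ} {P : ℝ → Lp ℝ 2 μ →L[ℝ] Lp ℝ 2 μ}
  {l : ℕ} {u f : Fin l → ℝ → Lp ℝ 2 μ} {U : Fin l → ℝ → Lp H 2 μ}

/-- The square has unbounded first derivatives, so the chain rule is applied to `quadApprox` with c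
= n + 1. Its bounds are uniform in n, and 4‖Uᵢ‖‖Uⱼ‖ and 2‖uᵢ‖‖fᵢ‖, integrable in time, dominate. -/
theorem IsSol.energy_identity (hP : IsAssociated ι A β α T P)
    (h : ∀ i, IsSol ι A β T (u i) (U i) (f i)) {t : ℝ} (ht : t ∈ Icc 0 T) :
    IntervalIntegrable (fun s => l1Ext (P (s - t)) (sumInnerL1 (fun i => U i s) fun i => U i s))
        volume t T ∧
      IntervalIntegrable (fun s => l1Ext (P (s - t)) (sumInnerL1 (fun i => u i s) fun i => f i s))
        volume t T ∧
      sumInnerL1 (fun i => u i t) (fun i => u i t) + (2 : ℝ) • ∫ s in t..T, l1Ext (P (s - t))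
          (sumInnerL1 (fun i => U i s) fun i => U i s) =
        l1Ext (P (T - t)) (sumInnerL1 (fun i => u i T) fun i => u i T) +
          (2 : ℝ) • ∫ s in t..T, l1Ext (P (s - t))
            (sumInnerL1 (fun i => u i s) fun i => f i s) := by
  have hQ := hP.c0_l1Ext
  have hs (n : ℕ) : Smooth2 (quadApprox ((n : ℝ) + 1) : (Fin l → ℝ) → ℝ) :=
    smooth2_quadApprox (by positivity)
  obtain ⟨i2, l2⟩ := hQ.tendsto_integral_apply ht.2
    (fun n => (memLp_one_iff_integrable.2 ((intervalIntegrable_iff_integrableOn_Ioc_of_le ht.2).1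
      (intervalIntegrable_secondOrder h (hs n) t T))).1)
    (B := fun s => ∑ i, ∑ j, 4 * (‖U i s‖ * ‖U j s‖)) (by
      refine Integrable.intervalIntegrable ?_
      exact integrable_finsetSum _ fun i _ => integrable_finsetSum _ fun j _ =>
        ((h i).memLp.norm.integrable_mul (h j).memLp.norm).const_mul 4)
    (fun n s => norm_secondOrder_le (hs n) (abs_pd_pd_quadApprox_le (by positivity)) _ _)
    (fun s => tendsto_secondOrder_quadApprox _ _)
  obtain ⟨i1, l1⟩ := hQ.tendsto_integral_apply ht.2
    (fun n => (memLp_one_iff_integrable.2 ((intervalIntegrable_iff_integrableOn_Ioc_of_le ht.2).1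
      (intervalIntegrable_firstOrder h (hs n) t T))).1)
    (B := fun s => ∑ i, 2 * (‖u i s‖ * ‖f i s‖)) (by
      have h1 (i : Fin l) : IntervalIntegrable (fun s => 2 * (‖u i s‖ * ‖f i s‖)) volume t T :=
        ((h i).integ.intervalIntegrable.norm.continuousOn_mul
          (h i).cont.norm.continuousOn).const_mul 2
      have h2 := IntervalIntegrable.sum Finset.univ fun i _ => h1 i
      exact h2.congr fun s _ => Finset.sum_apply _ _ _)
    (fun n s => (norm_firstOrder_le (hs n) (abs_pd_quadApprox_le (by positivity)) _ _).trans
      (Finset.sum_le_sum fun i _ => mul_le_mul_of_nonneg_left (norm_innerL1_le _ _) two_pos.le))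
    (fun s => tendsto_firstOrder_quadApprox _ _)
  have half {g : ℝ → Lp ℝ 1 μ} (hg : IntervalIntegrable
      (fun s => l1Ext (P (s - t)) ((2 : ℝ) • g s)) volume t T) :
      IntervalIntegrable (fun s => l1Ext (P (s - t)) (g s)) volume t T := by
    have h1 := hg.smul (2⁻¹ : ℝ)
    simpa [Pi.smul_def, smul_smul] using h1
  have hlim := tendsto_nhds_unique
    (((tendsto_compN_quadApprox fun i => u i t).add l2).congr fun n => chain_rule hP h (hs n) ht)
    ((((l1Ext (P (T - t))).continuous.tendsto _).comp
      (tendsto_compN_quadApprox fun i => u i T)).add l1)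
  refine ⟨half i2, half i1, ?_⟩
  simpa only [map_smul, intervalIntegral.integral_smul] using hlim

/-- The chain rule for `smoothNorm` with c = 1/(n + 1): convexity and positivity of the semigroup
give the second order integral a sign. The resulting inequality in L¹ between L² functions holds in
L², where the limit is taken with ∑ ‖fᵢ‖ dominating. -/
theorem IsSol.comparison (hP : IsAssociated ι A β α T P)
    (hpos : ∀ t : ℝ, 0 ≤ t → ∀ u, 0 ≤ u → 0 ≤ P t u)
    (h : ∀ i, IsSol ι A β T (u i) (U i) (f i)) {t : ℝ} (ht : t ∈ Icc 0 T) :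
    IntervalIntegrable (fun s => P (s - t) (hatInner (fun i => u i s) fun i => f i s))
        volume t T ∧
      euclNorm (fun i => u i t) ≤ P (T - t) (euclNorm fun i => u i T) +
        ∫ s in t..T, P (s - t) (hatInner (fun i => u i s) fun i => f i s) := by
  have hc (n : ℕ) : (0 : ℝ) < 1 / ((n : ℝ) + 1) := by positivity
  have cu : Continuous fun s i => u i s := continuous_pi fun i => (h i).cont
  have hm (n : ℕ) : AEStronglyMeasurable
      (fun s => approxHat (1 / ((n : ℝ) + 1)) (fun i => u i s) fun i => f i s)
      (volume.restrict (Ioc t T)) := by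
    unfold approxHat
    refine Finset.aestronglyMeasurable_fun_sum _ fun i _ => ?_
    exact (((smooth2_smoothNorm (hc n)).bc_pd i).continuous_mulN (G := ℝ) (μ := μ) (p := 2)
      (by norm_num)).comp_aestronglyMeasurable
      (cu.aestronglyMeasurable.prodMk (h i).integ.aestronglyMeasurable.restrict)
  have hB : IntervalIntegrable (fun s => ∑ i, ‖f i s‖) volume t T :=
    (integrable_finsetSum _ fun i _ => (h i).integ.norm).intervalIntegrable
  obtain ⟨i1, l1⟩ := hP.c0.tendsto_integral_apply ht.2 hm hB
    (fun n s => norm_approxHat_le (hc n) _ _) (fun s => tendsto_approxHat _ _)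
  refine ⟨i1, ?_⟩
  refine le_of_tendsto_of_tendsto' (tendsto_compN_smoothNorm fun i => u i t)
    ((((P (T - t)).continuous.tendsto _).comp (tendsto_compN_smoothNorm fun i => u i T)).add l1)
    fun n => ?_
  have h1 := chain_rule hP h (smooth2_smoothNorm (hc n)) ht
  have h2 : 0 ≤ ∫ s in t..T, l1Ext (P (s - t)) (secondOrder (smoothNorm (1 / ((n : ℝ) + 1)))
      (fun i => u i s) fun i => U i s) := by
    rw [intervalIntegral.integral_of_le ht.2]
    have : IsOrderedModule ℝ (Lp ℝ 1 μ) := IsOrderedModule.of_smul_nonneg fun a ha F hF =>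
      smul_nonneg_L1 ha hF
    refine integral_nonneg_of_ae ?_
    filter_upwards [ae_restrict_mem measurableSet_Ioc] with s hs
    have hs0 : 0 ≤ s - t := by linarith [hs.1]
    exact l1Ext_nonneg (hP.isL1Ext hs0) (hpos _ hs0) (secondOrder_smoothNorm_nonneg (hc n) _ _)
  have hi : IntervalIntegrable (fun s => P (s - t)
      (approxHat (1 / ((n : ℝ) + 1)) (fun i => u i s) fun i => f i s)) volume t T := by
    refine hP.c0.intervalIntegrable_apply ht.2 ?_
    refine (intervalIntegrable_iff_integrableOn_Ioc_of_le ht.2).2 ?_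
    exact ((intervalIntegrable_iff_integrableOn_Ioc_of_le ht.2).1 hB).mono' (hm n)
      (.of_forall fun s => norm_approxHat_le (hc n) _ _)
  -- The inclusion of L² into L¹ is continuous, so it commutes with the Bochner integral and
  -- intertwines P with its extension.
  have h3 : toL1 (∫ s in t..T, P (s - t)
      (approxHat (1 / ((n : ℝ) + 1)) (fun i => u i s) fun i => f i s)) =
      ∫ s in t..T, l1Ext (P (s - t))
        (firstOrder (smoothNorm (1 / ((n : ℝ) + 1))) (fun i => u i s) fun i => f i s) := by
    refine (toL1L.intervalIntegral_comp_comm hi).symm.trans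
      (intervalIntegral.integral_congr fun s hs => ?_)
    rw [uIcc_of_le ht.2] at hs
    have hs0 : 0 ≤ s - t := by linarith [hs.1]
    rw [← toL1_approxHat (hc n), hP.l1Ext_toL1 hs0]
    rfl
  rw [hP.l1Ext_toL1 (by linarith [ht.2]), ← h3] at h1
  rw [← toL1_le_toL1]
  refine (le_add_of_nonneg_right h2).trans (h1.trans ?_).le
  exact (toL1L.map_add _ _).symm

end Main

end LinearEq
end

theorem proposition2p8 {E H : Type*}
    [NormedAddCommGroup E] [NormedSpace ℝ E] [CompleteSpace E] [SecondCountableTopology E]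
    [MeasurableSpace E] [BorelSpace E]
    [NormedAddCommGroup H] [InnerProductSpace ℝ H] [CompleteSpace H] [SecondCountableTopology H]
    [MeasurableSpace H] [BorelSpace H]
    (ι : H →L[ℝ] E) (hι_inj : Function.Injective ι) (hι_dense : DenseRange ι)
    (μ : Measure E) [IsFiniteMeasure μ]
    (A : E → H →L[ℝ] H) (hA_meas : ∀ h : H, Measurable fun z => A z h)
    (hA_pos : ∀ z, (A z).IsPositive)
    (b : E → H) (hb : Measurable b)
    (T : ℝ) (hT : 0 < T)
    (P : ℝ → Lp ℝ 2 μ →L[ℝ] Lp ℝ 2 μ)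
    (hA1 : LinearEq.CondA1 ι μ A) (hA2 : LinearEq.CondA2 ι μ A b)
    (hA3 : LinearEq.CondA3 ι μ A b T P)
    (l : ℕ) (φ : Fin l → Lp ℝ 2 μ) (f u : Fin l → ℝ → Lp ℝ 2 μ)
    (hf : ∀ i, IntervalIntegrable (f i) volume 0 T)
    (hu : ∀ i, LinearEq.IsWeakSol ι μ A b T (φ i) (f i) (u i)) :
    -- the semigroup extends to `L¹(μ)`
    (∀ t ∈ Icc (0 : ℝ) T, LinearEq.IsL1Ext (P t) (LinearEq.l1Ext (P t))) ∧
    ∀ t ∈ Icc (0 : ℝ) T,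
      -- the identity, in `L¹(μ)`
      (IntervalIntegrable (fun s => LinearEq.l1Ext (P (s - t))
          (LinearEq.sumInnerL1 (fun i => LinearEq.D ι μ A (u i s))
            (fun i => LinearEq.D ι μ A (u i s)))) volume t T ∧
        IntervalIntegrable (fun s => LinearEq.l1Ext (P (s - t))
          (LinearEq.sumInnerL1 (fun i => u i s) (fun i => f i s))) volume t T ∧
        LinearEq.sumInnerL1 (fun i => u i t) (fun i => u i t)
            + (2 : ℝ) • ∫ s in t..T, LinearEq.l1Ext (P (s - t))
              (LinearEq.sumInnerL1 (fun i => LinearEq.D ι μ A (u i s))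
                (fun i => LinearEq.D ι μ A (u i s)))
          = LinearEq.l1Ext (P (T - t)) (LinearEq.sumInnerL1 φ φ)
            + (2 : ℝ) • ∫ s in t..T, LinearEq.l1Ext (P (s - t))
              (LinearEq.sumInnerL1 (fun i => u i s) (fun i => f i s))) ∧
      -- the comparison, in `L²(μ)`
      (IntervalIntegrable (fun s => P (s - t)
          (LinearEq.hatInner (fun i => u i s) (fun i => f i s))) volume t T ∧
        LinearEq.euclNorm (fun i => u i t)
          ≤ P (T - t) (LinearEq.euclNorm φ)
            + ∫ s in t..T, P (s - t) (LinearEq.hatInner (fun i => u i s) (fun i => f i s))) := by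
  have hA : LinearEq.IsDiffusion ι μ A := ⟨hA_meas, hA_pos, hA1⟩
  obtain ⟨α, hP⟩ := LinearEq.isAssociated_of_cond hT hA hA2 hA3
  choose w W k hsol hw hwT hW hk using fun i => (hu i).exists_isSol hA hA2 hP (hf i)
  refine ⟨fun t ht => hP.isL1Ext ht.1, fun t ht => ?_⟩
  -- W and k are known to agree with the gradients and with f only on (0, T]; the half-open
  -- integration interval avoids time 0 even when t = 0.
  have hsub : uIoc t T ⊆ Ioc 0 T := by
    rw [uIoc_of_le ht.2]
    exact Ioc_subset_Ioc_left ht.1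
  have eW {s : ℝ} (hs : s ∈ uIoc t T) :
      (fun i => W i s) = fun i => LinearEq.D ι μ A (u i s) :=
    funext fun i => hW i (hsub hs)
  have ew {s : ℝ} (hs : s ∈ Icc 0 T) : (fun i => w i s) = fun i => u i s :=
    funext fun i => hw i hs
  have ek {s : ℝ} (hs : s ∈ uIoc t T) : (fun i => k i s) = fun i => f i s :=
    funext fun i => hk i (hsub hs)
  have eT : (fun i => w i T) = φ := funext hwT
  have e1 : EqOn (fun s => LinearEq.l1Ext (P (s - t)) (LinearEq.sumInnerL1 (fun i => W i s)
      fun i => W i s)) (fun s => LinearEq.l1Ext (P (s - t)) (LinearEq.sumInnerL1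
        (fun i => LinearEq.D ι μ A (u i s)) fun i => LinearEq.D ι μ A (u i s))) (uIoc t T) :=
    fun s hs => by simp only [eW hs]
  have e2 : EqOn (fun s => LinearEq.l1Ext (P (s - t)) (LinearEq.sumInnerL1 (fun i => w i s)
      fun i => k i s)) (fun s => LinearEq.l1Ext (P (s - t)) (LinearEq.sumInnerL1
        (fun i => u i s) fun i => f i s)) (uIoc t T) :=
    fun s hs => by simp only [ew (Ioc_subset_Icc_self (hsub hs)), ek hs]
  have e3 : EqOn (fun s => P (s - t) (LinearEq.hatInner (fun i => w i s) fun i => k i s))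
      (fun s => P (s - t) (LinearEq.hatInner (fun i => u i s) fun i => f i s)) (uIoc t T) :=
    fun s hs => by simp only [ew (Ioc_subset_Icc_self (hsub hs)), ek hs]
  obtain ⟨i1, i2, hid⟩ := LinearEq.IsSol.energy_identity hP hsol ht
  obtain ⟨i3, hcomp⟩ := LinearEq.IsSol.comparison hP hA3.pos hsol ht
  rw [ew ht, eT, intervalIntegral.integral_congr_ae (.of_forall fun s hs => e1 hs),
    intervalIntegral.integral_congr_ae (.of_forall fun s hs => e2 hs)] at hid
  rw [ew ht, eT, intervalIntegral.integral_congr_ae (.of_forall fun s hs => e3 hs)] at hcomp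
  exact ⟨⟨i1.congr e1, i2.congr e2, hid⟩, i3.congr e3, hcomp⟩
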